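/- Let $\alpha,\beta,\mu,\sigma$ be real constants with $\alpha,\mu,\sigma\neq 0$, let $\rho(t)$ be a real function that does not vanish on a set $I\subseteq\mathbb R$ of times, and let $R$ be an antiderivative of $1/\rho$ on $I$: $R$ is differentiable at every $t\in I$ with $R'(t)=1/\rho(t)$. Write $\int \frac{c}{\rho(t)}\,dt=c\,R(t)$ for constants $c$. Consider the system $$\rho(t)u_t+3\mu(uv)_x+\sigma u_{xxx}=0,\qquad u_x=v_y .\tag{1}$$ For constants $k_j,p_j,\theta_j^0$ ($1\le j\le N$) put $$\theta_j=k_jx+p_jy-\int\frac{\sigma k_j^3p_j+3\beta\mu k_jp_j+3\alpha\mu k_j^2}{p_j\,\rho(t)}dt+\theta_j^0,$$ $$e^{A_{sj}}=\frac{\sigma k_sk_j(k_s-k_j)(p_s-p_j)p_sp_j-\alpha\mu(k_jp_s-k_sp_j)^2}{\sigma k_sk_j(k_s+k_j)(p_s+p_j)p_sp_j-\alpha\mu(k_jp_s-k_sp_j)^2},$$ $$f_N=\sum_{\varsigma\in\{0,1\}^N}\exp\Big(\sum_{j}\varsigma_j\theta_j+\sum_{s<j}\varsigma_s\varsigma_jA_{sj}\Big).$$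 The solution generated by a function $f$ is $$u=\alpha+\tfrac{2\sigma}{\mu}(\log f)_{xy},\qquad v=\beta+\tfrac{2\sigma}{\mu}(\log f)_{xx},\tag{2}$$ taken where $f\ne0$, with $(\log f)_x=f_x/f$. The $N$-soliton solution is the one generated by $f_N$. Let $N=2M$, let $l_1,\dots,l_{2M}$ be nonzero complex numbers, and let $m_1,\dots,m_{2M}$ be nonzero, pairwise different complex numbers with $m_{n+M}=\overline{m_n}$ for $1\le n\le M$. For real $\varepsilon\neq0$ let $f^{\varepsilon}$ be the $2M$-soliton function $f_{2M}$ with $$k_j=l_j\varepsilon,\qquad p_j=k_jm_j,\qquad \theta_j^0=i\pi .$$ Put $$\Theta_s=x+m_sy-3\mu\int\frac{\beta m_s+\alpha}{\rho(t)\,m_s}dt,\qquad a_{sj}=\frac{2\sigma m_sm_j(m_s+m_j)}{\alpha\mu(m_s-m_j)^2}\quad(s\neq j),$$ $$F=\sum_{n=0}^{M}\frac1{n!\,2^n}\sum_{(s_1,j_1,\dots,s_n,j_n)}a_{s_1j_1}\cdots a_{s_nj_n}\prod_{l\ne s_1,j_1,\dots,s_n,j_n}\Theta_l ,$$ where the inner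 sum is over all $2n$-tuples of pairwise different indices in $\{1,\dots,2M\}$, and let $(U,V)$ be generated by $F$ through (2). Then: 1. For all sufficiently small $\varepsilon\ne0$ the denominators of the $e^{A_{sj}}$ and the $e^{A_{sj}}$ themselves are nonzero, and the $2M$-soliton solution $(u^\varepsilon,v^\varepsilon)$ generated by $f^\varepsilon$ satisfies (1) at all points with $t\in I$ and $f^\varepsilon\neq0$. 2. As $\varepsilon\to0$, $f^{\varepsilon}/(\varepsilon^{2M}\prod_jl_j)\to F$ locally uniformly on $\{(x,y,t):t\in I\}$, and $u^\varepsilon\to U$, $v^\varepsilon\to V$ locally uniformly on $\{(x,y,t): t\in I,\ F(x,y,t)\ne0\}$. 3. $(U,V)$ is an $M$-lump rational solution of (1): it satisfies (1) at all points with $t\in I$ and $F\neq0$; $F$ is a real polynomial of total degree $2M$ in $(x,y,R(t))$, and $U,V$ are the quotients of real polynomials in $(x,y,R(t))$ by $F^2$; and it is localized in the plane: for each $t\in I$, $F(x,y,t)\ne0$ for all $(x,y)$ outside a bounded set, and $U\to\alpha$, $V\to\beta$ as $x^2+y^2\to\infty$. -/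

import Mathlib

open Filter Topology

namespace VcKdV

noncomputable section

/-- `(u, v)` is a classical solution at the point `(x, y, t)` of the system
`ρ(t) u_t + 3 μ (u v)_x + σ u_xxx = 0`, `u_x = v_y`
(all the derivatives that occur exist, and both equations hold). -/
def SolvesAt (ρ : ℝ → ℝ) (μ σ : ℝ) (u v : ℝ → ℝ → ℝ → ℂ) (x y t : ℝ) : Prop :=
  DifferentiableAt ℝ (fun τ => u x y τ) t ∧
  ContDiffAt ℝ 3 (fun ξ => u ξ y t) x ∧
  DifferentiableAt ℝ (fun ξ => v ξ y t) x ∧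
  DifferentiableAt ℝ (fun η => v x η t) y ∧
  (ρ t : ℂ) * deriv (fun τ => u x y τ) t
      + 3 * (μ : ℂ) * deriv (fun ξ => u ξ y t * v ξ y t) x
      + (σ : ℂ) * iteratedDeriv 3 (fun ξ => u ξ y t) x = 0 ∧
  deriv (fun ξ => u ξ y t) x = deriv (fun η => v x η t) y

/-- `u = α + (2σ/μ) (log f)_xy`. For complex-valued `f` the derivative `(log f)_x` is the
logarithmic derivative `f_x / f`, so that no branch of the logarithm is involved. -/
def uOf (α μ σ : ℝ) (f : ℝ → ℝ → ℝ → ℂ) (x y t : ℝ) : ℂ :=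
  (α : ℂ) + 2 * (σ : ℂ) / (μ : ℂ) * deriv (fun η => logDeriv (fun ξ => f ξ η t) x) y

/-- `v = β + (2σ/μ) (log f)_xx`. -/
def vOf (β μ σ : ℝ) (f : ℝ → ℝ → ℝ → ℂ) (x y t : ℝ) : ℂ :=
  (β : ℂ) + 2 * (σ : ℂ) / (μ : ℂ) * deriv (logDeriv (fun ξ => f ξ y t)) x

/-- The phase `θ = k x + p y - ω(t) + θ₀` with
`ω(t) = ∫ (σ k³ p + 3 β μ k p + 3 α μ k²) / (p ρ(t)) dt`; here `R` is the chosen antiderivative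
of `1 / ρ`, and `∫ c / ρ(t) dt` is `c * R t` for every constant `c`. -/
def phase (R : ℝ → ℝ) (α β μ σ : ℝ) (k p θ₀ : ℂ) (x y t : ℝ) : ℂ :=
  k * (x : ℂ) + p * (y : ℂ)
    - (σ * k ^ 3 * p + 3 * β * μ * k * p + 3 * α * μ * k ^ 2) / p * (R t : ℂ) + θ₀

/-- The denominator of the interaction coefficient of two solitons with parameters `(k, p)` and
`(k', p')`. -/
def expADen (α μ σ : ℝ) (k p k' p' : ℂ) : ℂ :=
  σ * k * k' * (k + k') * (p + p') * p * p' - α * μ * (k' * p - k * p') ^ 2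

/-- The interaction coefficient `exp A_{sj}` of two solitons with parameters
`(k, p)` and `(k', p')`. -/
def expA (α μ σ : ℝ) (k p k' p' : ℂ) : ℂ :=
  (σ * k * k' * (k - k') * (p - p') * p * p' - α * μ * (k' * p - k * p') ^ 2) /
    expADen α μ σ k p k' p'

/-- The `N`-soliton function
`f_N = ∑_{ς ∈ {0,1}^N} exp (∑_j ς_j θ_j + ∑_{s<j} ς_s ς_j A_{sj})`; the set `S` consists of the
indices `j` with `ς_j = 1`. -/
def soliton (R : ℝ → ℝ) (α β μ σ : ℝ) {N : ℕ} (k p θ₀ : Fin N → ℂ) (x y t : ℝ) : ℂ :=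
  ∑ S : Finset (Fin N),
    Complex.exp (∑ j ∈ S, phase R α β μ σ (k j) (p j) (θ₀ j) x y t) *
      ∏ s ∈ S, ∏ j ∈ S.filter (fun j => s < j), expA α μ σ (k s) (p s) (k j) (p j)

/-- `Θ = x + p y - 3 μ ∫ (β p + α) / (ρ(t) p) dt`. -/
def lumpTheta (R : ℝ → ℝ) (α β μ : ℝ) (p : ℂ) (x y t : ℝ) : ℂ :=
  (x : ℂ) + p * (y : ℂ) - 3 * μ * ((β * p + α) / p * (R t : ℂ))

/-- `a = 2 σ p p' (p + p') / (α μ (p - p')²)`. -/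
def lumpCoeff (α μ σ : ℝ) (p p' : ℂ) : ℂ :=
  2 * σ * p * p' * (p + p') / (α * μ * (p - p') ^ 2)

/-- The function
`f_{2M} = ∑_{n=0}^{M} 1/(n! 2ⁿ) ∑ a_{s₁j₁} ⋯ a_{sₙjₙ} ∏_{l ≠ s₁, j₁, …, sₙ, jₙ} Θ_l`,
where the inner sum runs over all `2n`-tuples `(s₁, j₁, …, sₙ, jₙ)` of pairwise different indices:
`e (i, 0) = s_i`, `e (i, 1) = j_i`. -/
def lump (R : ℝ → ℝ) (α β μ σ : ℝ) {M : ℕ} (p : Fin (2 * M) → ℂ) (x y t : ℝ) : ℂ :=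
  ∑ n ∈ Finset.range (M + 1), 1 / ((n.factorial : ℂ) * 2 ^ n) *
    ∑ e : (Fin n × Fin 2) ↪ Fin (2 * M),
      (∏ i : Fin n, lumpCoeff α μ σ (p (e (i, 0))) (p (e (i, 1)))) *
        ∏ l ∈ (Finset.univ.map e)ᶜ, lumpTheta R α β μ (p l) x y t

end

end VcKdV

/-! Put z = R(t), so that ρ ∂_t becomes ∂_z. With u and v given by (2), the equation u_x = v_y holds
automatically, and the evolution equation is a constant multiple of the x-derivative of H(f)/f²,
where H is half of Hirota's form (D_y(D_z + 3μβ D_x + σ D_x³) + 3μα D_x²) f·f. It therefore suffices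
that H(f) = 0 (`IsJet.solvesAt`).

For the solitons put κ = -αμ/σ, k = P + Q, p = κ(1/P + 1/Q). The frequency becomes -3βμ(P+Q) -
σ(P³+Q³), and e^A becomes the product of the four quotients (P-P')/(P+P'), (P-Q')/(P+Q'),
(Q-P')/(Q+P'), (Q-Q')/(Q+Q'). Expanding H(f) over pairs (S, S') of index sets leaves a sum of
weights times X³Y - TY - 3X², where X, T, Y are the differences over S and S' of the sums of r, r³,
1/r for the parameters r = P, Q. The residue calculus of ∏ (z+v)/(z-v) turns each summand into a sum
over single parameters (`sum_resWeight_mul_mul`). The resulting terms cancel in pairs: moving the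
index i from S to S' and passing from one parameter of i to the other changes only the sign
(`hirotaTerm_add_hirotaTerm`, `hirota_condition`).

For the long wave limit write e^A = 1 + ε² l l' c and expand over sets E of pairs. A pair
contributes ε², and an index outside the support contributes 1 - e^{lεΘ} = O(ε), the sign coming
from θ⁰ = iπ. The total order 2|E| + N - |supp E| is at least N, with equality exactly for
matchings. After division by ε^N ∏ l the function extends smoothly through ε = 0
(`soliton_eq_normSoliton`, `contDiff_normSoliton`), where it is the sum over matchings, which is F
(`lump_eq_limitJet`). Hence all derivatives in x, y, z converge locally uniformly, the bilinear
equation passes to the limit (`hirota_limitJet_zero`), and so do u and v where F ≠ 0.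

F is real because conjugation permutes the m_j. Its leading part is the product of the 2M linear
forms Θ_j; since the m_j are not real, this product grows like the 2M-th power of the norm in the
(x, y)-plane, while every other term and every derivative of F is of smaller order
(`lump_localized`). -/

namespace VcKdV

noncomputable section

/-! ### Residue identities -/

/-- The residue weights of `∏ (z + v a) / (z - v a)`. -/
def resWeight {ι : Type*} [DecidableEq ι] (s : Finset ι) (v : ι → ℂ) (a : ι) : ℂ :=
  ∏ b ∈ s.erase a, (v a + v b) / (v a - v b)

lemma resWeight_insert_of_mem {ι : Type*} [DecidableEq ι] {s : Finset ι} (v : ι → ℂ) {a c : ι}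
    (hc : c ∉ s) (ha : a ∈ s) :
    resWeight (insert c s) v a = (v a + v c) / (v a - v c) * resWeight s v a := by
  have hca : c ≠ a := fun h => hc (h ▸ ha)
  rw [resWeight, Finset.erase_insert_of_ne hca, Finset.prod_insert (by simp [hc]), resWeight]

lemma resWeight_insert_self {ι : Type*} [DecidableEq ι] {s : Finset ι} (v : ι → ℂ) {c : ι}
    (hc : c ∉ s) :
    resWeight (insert c s) v c = ∏ b ∈ s, (v c + v b) / (v c - v b) := by
  rw [resWeight, Finset.erase_insert hc]

/-- Partial fractions: the quotient has simple poles at the v a and the value 1 at infinity. -/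
lemma prod_add_div_sub_eq {ι : Type*} [DecidableEq ι] (v : ι → ℂ) (s : Finset ι)
    (hv : Set.InjOn v s) (z : ℂ) (hz : ∀ a ∈ s, z ≠ v a) :
    ∏ a ∈ s, (z + v a) / (z - v a) = 1 + ∑ a ∈ s, 2 * v a * resWeight s v a / (z - v a) := by
  induction s using Finset.induction_on generalizing z with
  | empty => simp
  | insert c s hc ih =>
    have hvs : Set.InjOn v s := hv.mono (by simp)
    have hcs : ∀ a ∈ s, v c ≠ v a := fun a ha h =>
      hc ((hv (by simp) (by simp [ha]) h) ▸ ha)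
    have hzc : z - v c ≠ 0 := sub_ne_zero.2 (hz c (by simp))
    -- Separating the poles at `v a` and `v c` leaves the expansion for `s` at the two points z and
    -- `v c`; this is why z is generalized in the induction.
    have key : ∀ a ∈ s, 2 * v a * resWeight (insert c s) v a / (z - v a)
        = (z + v c) / (z - v c) * (2 * v a * resWeight s v a / (z - v a))
          - 2 * v c / (z - v c) * (2 * v a * resWeight s v a / (v c - v a)) := by
      intro a ha
      have h1 : z - v a ≠ 0 := sub_ne_zero.2 (hz a (by simp [ha]))
      have h2 : v c - v a ≠ 0 := sub_ne_zero.2 (hcs a ha)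
      have h4 : v a - v c = -(v c - v a) := by ring
      rw [resWeight_insert_of_mem v hc ha, h4, div_neg]
      field_simp
      ring
    rw [Finset.prod_insert hc, Finset.sum_insert hc, resWeight_insert_self v hc,
      Finset.sum_congr rfl key, Finset.sum_sub_distrib, ← Finset.mul_sum, ← Finset.mul_sum,
      ih hvs (v c) hcs, ih hvs z (fun a ha => hz a (by simp [ha]))]
    field_simp
    ring

/-- For a in s the new weight w' satisfies (v a - v c) w' = (v a + v c) w. Summing against g gives a
recursion that raises the order of a moment of the weights by one. -/
lemma sum_resWeight_insert {ι : Type*} [DecidableEq ι] (v : ι → ℂ) {s : Finset ι} {c : ι}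
    (hc : c ∉ s) (hv : Set.InjOn v (insert c s : Finset ι)) (g : ι → ℂ) :
    ∑ a ∈ insert c s, resWeight (insert c s) v a * (v a * g a)
      = v c * ∑ a ∈ insert c s, resWeight (insert c s) v a * g a
        + ∑ a ∈ s, resWeight s v a * (v a * g a) + v c * ∑ a ∈ s, resWeight s v a * g a := by
  have hcs : ∀ a ∈ s, v c ≠ v a := fun a ha h =>
    hc ((hv (by simp) (by simp [ha]) h) ▸ ha)
  rw [Finset.sum_insert hc, Finset.sum_insert hc, mul_add, Finset.mul_sum, Finset.mul_sum]
  have : ∑ a ∈ s, resWeight (insert c s) v a * (v a * g a)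
      = ∑ a ∈ s, v c * (resWeight (insert c s) v a * g a)
        + (∑ a ∈ s, resWeight s v a * (v a * g a) + ∑ a ∈ s, v c * (resWeight s v a * g a)) := by
    rw [← Finset.sum_add_distrib, ← Finset.sum_add_distrib]
    refine Finset.sum_congr rfl fun a ha => ?_
    have h3 : v a - v c ≠ 0 := sub_ne_zero.2 (hcs a ha).symm
    rw [resWeight_insert_of_mem v hc ha]
    field_simp
    ring
  rw [this]; ring

/-- For nonzero v this is the partial fraction expansion at z = 0. The induction avoids that
restriction. -/
lemma sum_resWeight {ι : Type*} [DecidableEq ι] (v : ι → ℂ) (s : Finset ι)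
    (hv : Set.InjOn v s) : ∑ a ∈ s, resWeight s v a = (1 - (-1) ^ s.card) / 2 := by
  induction s using Finset.induction_on with
  | empty => simp
  | insert c s hc ih =>
    have hvs : Set.InjOn v s := hv.mono (by simp)
    have hcs : ∀ a ∈ s, v c ≠ v a := fun a ha h =>
      hc ((hv (by simp) (by simp [ha]) h) ▸ ha)
    rw [Finset.sum_insert hc, resWeight_insert_self v hc, prod_add_div_sub_eq v s hvs _ hcs,
      add_assoc, ← Finset.sum_add_distrib, Finset.card_insert_of_notMem hc]
    have : ∀ a ∈ s, 2 * v a * resWeight s v a / (v c - v a) + resWeight (insert c s) v a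
        = - resWeight s v a := by
      intro a ha
      have h2 : v c - v a ≠ 0 := sub_ne_zero.2 (hcs a ha)
      rw [resWeight_insert_of_mem v hc ha]
      have h4 : v a - v c = -(v c - v a) := by ring
      rw [h4, div_neg]
      field_simp
      ring
    rw [Finset.sum_congr rfl this, Finset.sum_neg_distrib, ih hvs]
    ring

lemma sum_resWeight_mul {ι : Type*} [DecidableEq ι] (v : ι → ℂ) (s : Finset ι)
    (hv : Set.InjOn v s) : ∑ a ∈ s, resWeight s v a * v a = ∑ a ∈ s, v a := by
  induction s using Finset.induction_on with
  | empty => simp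
  | insert c s hc ih =>
    have hvs : Set.InjOn v s := hv.mono (by simp)
    have := sum_resWeight_insert v hc hv (fun _ => 1)
    simp only [mul_one] at this
    rw [this, ih hvs, sum_resWeight v _ hv, sum_resWeight v _ hvs, Finset.sum_insert hc,
      Finset.card_insert_of_notMem hc]
    ring

lemma sum_resWeight_mul_sq {ι : Type*} [DecidableEq ι] (v : ι → ℂ) (s : Finset ι)
    (hv : Set.InjOn v s) : ∑ a ∈ s, resWeight s v a * v a ^ 2 = (∑ a ∈ s, v a) ^ 2 := by
  induction s using Finset.induction_on with
  | empty => simp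
  | insert c s hc ih =>
    have hvs : Set.InjOn v s := hv.mono (by simp)
    have := sum_resWeight_insert v hc hv v
    simp only [← pow_two] at this
    rw [this, ih hvs, sum_resWeight_mul v _ hv, sum_resWeight_mul v _ hvs, Finset.sum_insert hc]
    ring

/-- The moments of order 1, 2, 3 are the coefficients of ∏ (z+v)/(z-v) = exp(2 ∑ (v/z + v³/(3z³) +
…)) at infinity. -/
lemma sum_resWeight_mul_cube {ι : Type*} [DecidableEq ι] (v : ι → ℂ) (s : Finset ι)
    (hv : Set.InjOn v s) : ∑ a ∈ s, resWeight s v a * v a ^ 3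
      = (2 * (∑ a ∈ s, v a) ^ 3 + ∑ a ∈ s, v a ^ 3) / 3 := by
  induction s using Finset.induction_on with
  | empty => simp
  | insert c s hc ih =>
    have hvs : Set.InjOn v s := hv.mono (by simp)
    have := sum_resWeight_insert v hc hv (fun a => v a ^ 2)
    simp only [← pow_succ'] at this
    rw [this, ih hvs, sum_resWeight_mul_sq v _ hv, sum_resWeight_mul_sq v _ hvs,
      Finset.sum_insert hc, Finset.sum_insert hc]
    ring

/-- This is the first-order coefficient of ∏ (z+v)/(z-v) at z = 0. -/
lemma sum_resWeight_mul_inv {ι : Type*} [DecidableEq ι] (v : ι → ℂ) (s : Finset ι)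
    (hv : Set.InjOn v s) (h0 : ∀ a ∈ s, v a ≠ 0) : ∑ a ∈ s, resWeight s v a * (v a)⁻¹
      = - (-1) ^ s.card * ∑ a ∈ s, (v a)⁻¹ := by
  induction s using Finset.induction_on with
  | empty => simp
  | insert c s hc ih =>
    have hvs : Set.InjOn v s := hv.mono (by simp)
    have hc0 : v c ≠ 0 := h0 c (by simp)
    have key := sum_resWeight_insert v hc hv (fun a => (v a)⁻¹)
    have e1 : ∀ t ⊆ insert c s, ∀ w : ι → ℂ, ∑ a ∈ t, w a * (v a * (v a)⁻¹) = ∑ a ∈ t, w a := by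
      intro t ht w
      refine Finset.sum_congr rfl fun a ha => ?_
      rw [mul_inv_cancel₀ (h0 a (ht ha)), mul_one]
    rw [e1 _ subset_rfl, e1 _ (by simp), ih hvs (fun a ha => h0 a (by simp [ha])),
      sum_resWeight v _ hv, sum_resWeight v _ hvs, Finset.card_insert_of_notMem hc] at key
    rw [Finset.sum_insert (f := fun a => (v a)⁻¹) hc, Finset.card_insert_of_notMem hc]
    apply mul_left_cancel₀ hc0
    have h5 : v c * (v c)⁻¹ = 1 := mul_inv_cancel₀ hc0
    linear_combination -key - (-1) ^ s.card * h5

/-- The right side contains the polynomial of the Hirota condition. The factors on the left are the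
power sums after the sign of one parameter is reversed, which is what makes the later cancellation
possible. For an even number of parameters the zeroth moment vanishes, so the product of the two
full power sums drops out of the expanded left side. -/
lemma sum_resWeight_mul_mul {ι : Type*} [DecidableEq ι] (v : ι → ℂ) (s : Finset ι)
    (hv : Set.InjOn v s) (h0 : ∀ a ∈ s, v a ≠ 0) (hs : Even s.card) :
    ∑ a ∈ s, resWeight s v a *
        ((∑ b ∈ s, v b ^ 3 - 2 * v a ^ 3) * (∑ b ∈ s, (v b)⁻¹ - 2 * (v a)⁻¹))
      = -(4 / 3) * ((∑ b ∈ s, v b) ^ 3 * ∑ b ∈ s, (v b)⁻¹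
          - (∑ b ∈ s, v b ^ 3) * ∑ b ∈ s, (v b)⁻¹ - 3 * (∑ b ∈ s, v b) ^ 2) := by
  have m0 := sum_resWeight v s hv
  have m2 := sum_resWeight_mul_sq v s hv
  have m3 := sum_resWeight_mul_cube v s hv
  have m4 := sum_resWeight_mul_inv v s hv h0
  rw [hs.neg_one_pow] at m0 m4
  set T := ∑ b ∈ s, v b ^ 3
  set Y := ∑ b ∈ s, (v b)⁻¹
  set X := ∑ b ∈ s, v b
  have : ∀ a ∈ s, resWeight s v a * ((T - 2 * v a ^ 3) * (Y - 2 * (v a)⁻¹))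
      = T * Y * resWeight s v a - 2 * Y * (resWeight s v a * v a ^ 3)
        - 2 * T * (resWeight s v a * (v a)⁻¹) + 4 * (resWeight s v a * v a ^ 2) := by
    intro a ha
    have := h0 a ha
    field_simp
    ring
  rw [Finset.sum_congr rfl this, Finset.sum_add_distrib, Finset.sum_sub_distrib,
    Finset.sum_sub_distrib, ← Finset.mul_sum, ← Finset.mul_sum, ← Finset.mul_sum, ← Finset.mul_sum,
    m0, m2, m3, m4]
  ring

/-! ### The Hirota condition -/

/-- The weight of the index set `S` in a multi-soliton function. -/
def pairWeight {ι : Type*} [LinearOrder ι] (A : ι → ι → ℂ) (X : ι → ℂ) (S : Finset ι) : ℂ :=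
  (∏ s ∈ S, X s) * ∏ s ∈ S, ∏ j ∈ S.filter (fun j => s < j), A s j

lemma pairWeight_insert {ι : Type*} [LinearOrder ι] {A : ι → ι → ℂ} (hA : ∀ i j, A i j = A j i)
    (X : ι → ℂ) {S : Finset ι} {i : ι} (hi : i ∉ S) :
    pairWeight A X (insert i S) = X i * (∏ j ∈ S, A i j) * pairWeight A X S := by
  have h1 : ∏ j ∈ S, A i j
      = (∏ j ∈ S, if i < j then A i j else 1) * ∏ j ∈ S, if j < i then A j i else 1 := by
    rw [← Finset.prod_mul_distrib]
    refine Finset.prod_congr rfl fun j hj => ?_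
    rcases lt_trichotomy i j with h | h | h
    · simp [h, h.not_gt]
    · exact absurd (h ▸ hj) hi
    · simp [h, h.not_gt, hA i j]
  rw [pairWeight, pairWeight, Finset.prod_insert hi, Finset.prod_insert hi, h1]
  simp only [Finset.prod_filter]
  rw [Finset.prod_insert hi]
  simp only [Finset.prod_insert hi, lt_irrefl, if_false, one_mul, Finset.prod_mul_distrib]
  ring

/-- The sign of the index `i`: positive on `S`, negative elsewhere. -/
def pairSign {ι : Type*} [DecidableEq ι] (S : Finset ι) (i : ι) : ℂ := if i ∈ S then 1 else -1

/-- The signed spectral parameters of the pair `(S, S')`. -/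
def signedParam {ι : Type*} [DecidableEq ι] (r : ι × Bool → ℂ) (S : Finset ι) (a : ι × Bool) : ℂ :=
  pairSign S a.1 * r a

/-- The indices of the signed spectral parameters of the pair `(S, S')`. -/
def paramIndex {ι : Type*} [DecidableEq ι] (S S' : Finset ι) : Finset (ι × Bool) :=
  symmDiff S S' ×ˢ Finset.univ

/-- The difference of the sums of `r` over two sets of indices. -/
def sumDiff {ι : Type*} (r : ι × Bool → ℂ) (S S' : Finset ι) : ℂ :=
  ∑ i ∈ S, (r (i, true) + r (i, false)) - ∑ i ∈ S', (r (i, true) + r (i, false))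

lemma sum_signedParam {ι : Type*} [DecidableEq ι] (r : ι × Bool → ℂ) (S S' : Finset ι) :
    ∑ a ∈ paramIndex S S', signedParam r S a = sumDiff r S S' := by
  have hd : Disjoint (S \ S') (S' \ S) := by
    rw [Finset.disjoint_left]; intro a; simp; tauto
  have hu : symmDiff S S' = (S \ S') ∪ (S' \ S) := rfl
  rw [paramIndex, Finset.sum_product, hu, Finset.sum_union hd, sumDiff,
    ← Finset.sum_sdiff_sub_sum_sdiff, sub_eq_add_neg, ← Finset.sum_neg_distrib]
  congr 1 <;> refine Finset.sum_congr rfl fun i hi => ?_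
  · simp [signedParam, pairSign, (Finset.mem_sdiff.1 hi).1]
  · simp [signedParam, pairSign, (Finset.mem_sdiff.1 hi).2, add_comm]

lemma pairSign_mul_self {ι : Type*} [DecidableEq ι] (S : Finset ι) (i : ι) :
    pairSign S i * pairSign S i = 1 := by
  unfold pairSign; split_ifs <;> norm_num

lemma signedParam_cube {ι : Type*} [DecidableEq ι] (r : ι × Bool → ℂ) (S : Finset ι)
    (a : ι × Bool) : signedParam r S a ^ 3 = signedParam (fun b => r b ^ 3) S a := by
  simp only [signedParam]
  linear_combination pairSign S a.1 * r a ^ 3 * pairSign_mul_self S a.1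

lemma signedParam_inv {ι : Type*} [DecidableEq ι] (r : ι × Bool → ℂ) (S : Finset ι)
    (a : ι × Bool) : (signedParam r S a)⁻¹ = signedParam (fun b => (r b)⁻¹) S a := by
  simp only [signedParam, mul_inv]
  congr 1
  unfold pairSign; split_ifs <;> norm_num

/-- The factor of a pair of spectral parameters at `z`. -/
def paramFactor {ι : Type*} (r : ι × Bool → ℂ) (z : ℂ) (j : ι) : ℂ :=
  (z + r (j, true)) / (z - r (j, true)) * ((z + r (j, false)) / (z - r (j, false)))

/-- Because of this symmetry an index in S', whose parameters carry a minus sign, contributes the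
inverse factor. -/
lemma paramFactor_neg {ι : Type*} (r : ι × Bool → ℂ) (z : ℂ) (j : ι) :
    paramFactor r (-z) j = (paramFactor r z j)⁻¹ := by
  simp only [paramFactor, mul_inv, inv_div]
  rw [show -z - r (j, true) = -(z + r (j, true)) by ring,
    show -z - r (j, false) = -(z + r (j, false)) by ring,
    show -z + r (j, true) = -(z - r (j, true)) by ring,
    show -z + r (j, false) = -(z - r (j, false)) by ring, neg_div_neg_eq, neg_div_neg_eq]

lemma prod_symmDiff_paramFactor {ι : Type*} [DecidableEq ι] (r : ι × Bool → ℂ) (z : ℂ)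
    (A B : Finset ι) (h : ∀ j ∈ A ∪ B, paramFactor r z j ≠ 0) (S : Finset ι)
    (hS : ∀ j ∈ symmDiff A B, j ∈ S ↔ j ∈ A) :
    ∏ j ∈ symmDiff A B, ∏ c : Bool,
        (z + signedParam r S (j, c)) / (z - signedParam r S (j, c))
      = (∏ j ∈ A, paramFactor r z j) * ∏ j ∈ B, (paramFactor r z j)⁻¹ := by
  have hd : Disjoint (A \ B) (B \ A) := by
    rw [Finset.disjoint_left]; intro a; simp; tauto
  have hu : symmDiff A B = (A \ B) ∪ (B \ A) := rfl
  have hA : ∏ j ∈ A, paramFactor r z j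
      = (∏ j ∈ A \ B, paramFactor r z j) * ∏ j ∈ A ∩ B, paramFactor r z j := by
    rw [mul_comm]; exact (Finset.prod_inter_mul_prod_sdiff A B _).symm
  have hB : ∏ j ∈ B, (paramFactor r z j)⁻¹
      = (∏ j ∈ B \ A, (paramFactor r z j)⁻¹) * ∏ j ∈ A ∩ B, (paramFactor r z j)⁻¹ := by
    rw [mul_comm, Finset.inter_comm]; exact (Finset.prod_inter_mul_prod_sdiff B A _).symm
  have hAB : (∏ j ∈ A ∩ B, paramFactor r z j) * ∏ j ∈ A ∩ B, (paramFactor r z j)⁻¹ = 1 := by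
    rw [← Finset.prod_mul_distrib]
    refine Finset.prod_eq_one fun j hj => mul_inv_cancel₀ (h j ?_)
    simp only [Finset.mem_inter] at hj
    simp [hj.1]
  have e1 : ∏ j ∈ A \ B, ∏ c : Bool,
        (z + signedParam r S (j, c)) / (z - signedParam r S (j, c))
      = ∏ j ∈ A \ B, paramFactor r z j := by
    refine Finset.prod_congr rfl fun j hj => ?_
    have : j ∈ S := (hS j (by rw [hu]; simp only [Finset.mem_union]; exact Or.inl hj)).2
      (Finset.mem_sdiff.1 hj).1
    simp [signedParam, pairSign, this, paramFactor, mul_div_mul_comm]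
  have e2 : ∏ j ∈ B \ A, ∏ c : Bool,
        (z + signedParam r S (j, c)) / (z - signedParam r S (j, c))
      = ∏ j ∈ B \ A, (paramFactor r z j)⁻¹ := by
    refine Finset.prod_congr rfl fun j hj => ?_
    have : j ∉ S := fun hjS => (Finset.mem_sdiff.1 hj).2
      ((hS j (by rw [hu]; simp only [Finset.mem_union]; exact Or.inr hj)).1 hjS)
    simp [signedParam, pairSign, this, paramFactor, ← sub_eq_add_neg, mul_div_mul_comm, mul_comm]
  rw [hA, hB, hu, Finset.prod_union hd, e1, e2]
  linear_combination -(∏ j ∈ A \ B, paramFactor r z j) * (∏ j ∈ B \ A, (paramFactor r z j)⁻¹) * hAB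

/-- The weight at a parameter of i splits into the factor of the other parameter of i and one factor
for each remaining index. Indices common to A and B may be included, since their factors cancel. -/
lemma resWeight_paramIndex {ι : Type*} [DecidableEq ι] (r : ι × Bool → ℂ)
    (S S' A B : Finset ι) (i : ι) (b : Bool) (hAB : symmDiff S S' = insert i (symmDiff A B))
    (hi : i ∉ symmDiff A B) (hS : ∀ j ∈ symmDiff A B, j ∈ S ↔ j ∈ A)
    (h : ∀ j ∈ A ∪ B, paramFactor r (signedParam r S (i, b)) j ≠ 0) :
    resWeight (paramIndex S S') (signedParam r S) (i, b)
      = (signedParam r S (i, b) + signedParam r S (i, !b))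
          / (signedParam r S (i, b) - signedParam r S (i, !b))
        * ((∏ j ∈ A, paramFactor r (signedParam r S (i, b)) j)
          * ∏ j ∈ B, (paramFactor r (signedParam r S (i, b)) j)⁻¹) := by
  have e : (paramIndex S S').erase (i, b)
      = insert (i, !b) (symmDiff A B ×ˢ (Finset.univ : Finset Bool)) := by
    ext ⟨j, c⟩
    by_cases hj : j = i
    · subst hj
      cases b <;> cases c <;> simp_all [paramIndex]
    · simp [paramIndex, hAB, hj]
  rw [resWeight, e, Finset.prod_insert (by simp [hi]), Finset.prod_product,
    prod_symmDiff_paramFactor r _ A B h S hS]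

/-- The interaction coefficient in terms of the spectral parameters. -/
def paramCoeff {ι : Type*} (r : ι × Bool → ℂ) (i j : ι) : ℂ :=
  ((r (i, true) - r (j, true)) * (r (i, true) - r (j, false))
      * (r (i, false) - r (j, true)) * (r (i, false) - r (j, false))) /
    ((r (i, true) + r (j, true)) * (r (i, true) + r (j, false))
      * (r (i, false) + r (j, true)) * (r (i, false) + r (j, false)))

lemma paramCoeff_comm {ι : Type*} (r : ι × Bool → ℂ) (i j : ι) :
    paramCoeff r i j = paramCoeff r j i := by
  unfold paramCoeff
  congr 1 <;> ring

/-- This ties the interaction coefficients to the residue weights: in the product of the two, the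
factor at one parameter of i cancels and the factor at the other survives. -/
lemma paramCoeff_eq {ι : Type*} (r : ι × Bool → ℂ) (i j : ι) (b : Bool) :
    paramCoeff r i j = (paramFactor r (r (i, b)) j)⁻¹ * (paramFactor r (r (i, !b)) j)⁻¹ := by
  cases b <;>
  · simp only [paramCoeff, paramFactor, mul_inv, inv_div, Bool.not_true, Bool.not_false]
    simp only [div_eq_mul_inv, mul_inv]
    ring

/-- One summand of the residue expansion of the Hirota condition. -/
def hirotaTerm {ι : Type*} [LinearOrder ι] (r : ι × Bool → ℂ) (X : ι → ℂ) (S S' : Finset ι)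
    (a : ι × Bool) : ℂ :=
  pairWeight (paramCoeff r) X S * pairWeight (paramCoeff r) X S' *
    (resWeight (paramIndex S S') (signedParam r S) a *
      ((sumDiff (fun b => r b ^ 3) S S' - 2 * signedParam r S a ^ 3) *
        (sumDiff (fun b => (r b)⁻¹) S S' - 2 * (signedParam r S a)⁻¹)))

/-- With i on the left and the parameter `r (i, b)`, or i on the right and `r (i, !b)`, the
interaction and residue factors both reduce to the inverses of the factors at `r (i, !b)` over A and
at `r (i, b)` over B. Only the quotient formed from the two parameters of i changes sign. -/
lemma hirotaTerm_add_hirotaTerm {ι : Type*} [LinearOrder ι] (r : ι × Bool → ℂ)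
    (hr : Function.Injective r) (hadd : ∀ a b, r a + r b ≠ 0) (X : ι → ℂ) (A B : Finset ι)
    (i : ι) (hA : i ∉ A) (hB : i ∉ B) (b : Bool) :
    hirotaTerm r X (insert i A) B (i, b) + hirotaTerm r X A (insert i B) (i, !b) = 0 := by
  have hf : ∀ b, ∀ j, j ≠ i → paramFactor r (r (i, b)) j ≠ 0 := by
    intro b j hj
    have : ∀ c, r (i, b) - r (j, c) ≠ 0 := fun c =>
      sub_ne_zero.2 fun h => hj (by have := hr h; simp_all)
    exact mul_ne_zero (div_ne_zero (hadd _ _) (this _)) (div_ne_zero (hadd _ _) (this _))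
  have hnAB : ∀ j ∈ A ∪ B, j ≠ i := by
    rintro j hj rfl
    simp [hA, hB] at hj
  have hiAB : i ∉ symmDiff A B := by simp [Finset.mem_symmDiff, hA, hB]
  have s1 : ∀ c, signedParam r (insert i A) (i, c) = r (i, c) := by simp [signedParam, pairSign]
  have s2 : ∀ c, signedParam r A (i, c) = - r (i, c) := by simp [signedParam, pairSign, hA]
  have w1 := resWeight_paramIndex r (insert i A) B A B i b
    (by ext j; by_cases hj : j = i
        · subst hj; simp [Finset.mem_symmDiff, hB]
        · simp [Finset.mem_symmDiff, hj]) hiAB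
    (fun j hj => by
      have : j ≠ i := fun h => hiAB (h ▸ hj)
      simp [this])
    (fun j hj => by rw [s1]; exact hf b j (hnAB j hj))
  have w2 := resWeight_paramIndex r A (insert i B) A B i (!b)
    (by ext j; by_cases hj : j = i
        · subst hj; simp [Finset.mem_symmDiff, hA]
        · simp [Finset.mem_symmDiff, hj]) hiAB
    (fun j hj => Iff.rfl)
    (fun j hj => by rw [s2, paramFactor_neg]; exact inv_ne_zero (hf (!b) j (hnAB j hj)))
  -- On both sides i contributes `g (i, !b)` minus `g (i, b)`, so the power-sum factors of the two
  -- terms agree.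
  have d : ∀ g : ι × Bool → ℂ, sumDiff g (insert i A) B - 2 * g (i, b)
      = sumDiff g A (insert i B) + 2 * g (i, !b) := by
    intro g
    simp only [sumDiff, Finset.sum_insert hA, Finset.sum_insert hB]
    cases b <;> simp <;> ring
  have d1 := d (fun a => r a ^ 3)
  have d2 := d (fun a => (r a)⁻¹)
  have cA : ∏ j ∈ A, paramCoeff r i j
      = (∏ j ∈ A, (paramFactor r (r (i, b)) j)⁻¹) * ∏ j ∈ A, (paramFactor r (r (i, !b)) j)⁻¹ := by
    rw [← Finset.prod_mul_distrib]
    exact Finset.prod_congr rfl fun j _ => paramCoeff_eq r i j b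
  have cB : ∏ j ∈ B, paramCoeff r i j
      = (∏ j ∈ B, (paramFactor r (r (i, b)) j)⁻¹) * ∏ j ∈ B, (paramFactor r (r (i, !b)) j)⁻¹ := by
    rw [← Finset.prod_mul_distrib]
    exact Finset.prod_congr rfl fun j _ => paramCoeff_eq r i j b
  have iA : (∏ j ∈ A, (paramFactor r (r (i, b)) j)⁻¹) * ∏ j ∈ A, paramFactor r (r (i, b)) j = 1 := by
    rw [← Finset.prod_mul_distrib]
    exact Finset.prod_eq_one fun j hj => inv_mul_cancel₀ (hf b j (hnAB j (by simp [hj])))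
  have iB : (∏ j ∈ B, (paramFactor r (r (i, !b)) j)⁻¹) * ∏ j ∈ B, paramFactor r (r (i, !b)) j
      = 1 := by
    rw [← Finset.prod_mul_distrib]
    exact Finset.prod_eq_one fun j hj => inv_mul_cancel₀ (hf (!b) j (hnAB j (by simp [hj])))
  rw [hirotaTerm, hirotaTerm, w1, w2, pairWeight_insert (paramCoeff_comm r) X hA,
    pairWeight_insert (paramCoeff_comm r) X hB, s1, s1, s2, s2, cA, cB]
  simp only [paramFactor_neg, inv_inv, Bool.not_not, inv_neg]
  have e3 : (-r (i, !b)) ^ 3 = -(r (i, !b) ^ 3) := by ring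
  have e4 : (-r (i, !b) + -r (i, b)) / (-r (i, !b) - -r (i, b))
      = - ((r (i, b) + r (i, !b)) / (r (i, b) - r (i, !b))) := by
    rw [← neg_div]; congr 1 <;> ring
  rw [e3, e4, mul_neg, sub_neg_eq_add, mul_neg, sub_neg_eq_add, d1, d2]
  set q := (r (i, b) + r (i, !b)) / (r (i, b) - r (i, !b))
  set t1 := sumDiff (fun a => r a ^ 3) A (insert i B) + 2 * r (i, !b) ^ 3
  set t2 := sumDiff (fun a => (r a)⁻¹) A (insert i B) + 2 * (r (i, !b))⁻¹
  set wA := pairWeight (paramCoeff r) X A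
  set wB := pairWeight (paramCoeff r) X B
  set p1 := ∏ j ∈ A, (paramFactor r (r (i, !b)) j)⁻¹
  set p2 := ∏ j ∈ B, (paramFactor r (r (i, b)) j)⁻¹
  linear_combination X i * wA * wB * q * t1 * t2 * p1 * p2 * (iA - iB)

lemma sum_hirotaTerm {ι : Type*} [LinearOrder ι] [Fintype ι] (r : ι × Bool → ℂ)
    (hr : Function.Injective r) (hadd : ∀ a b, r a + r b ≠ 0) (X : ι → ℂ) :
    ∑ S : Finset ι, ∑ S' : Finset ι, ∑ a ∈ paramIndex S S', hirotaTerm r X S S' a = 0 := by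
  have e : ∑ S : Finset ι, ∑ S' : Finset ι, ∑ a ∈ paramIndex S S', hirotaTerm r X S S' a
      = ∑ q ∈ (Finset.univ : Finset ((Finset ι × Finset ι) × (ι × Bool))).filter
          (fun q => q.2.1 ∈ symmDiff q.1.1 q.1.2), hirotaTerm r X q.1.1 q.1.2 q.2 := by
    rw [Finset.sum_filter, Fintype.sum_prod_type, Fintype.sum_prod_type]
    refine Finset.sum_congr rfl fun S _ => Finset.sum_congr rfl fun S' _ => ?_
    rw [← Finset.sum_filter]
    refine Finset.sum_congr ?_ fun _ _ => rfl
    ext a; simp [paramIndex]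
  have main : ∀ (S S' : Finset ι) (i : ι) (b : Bool), i ∈ S → i ∉ S' →
      hirotaTerm r X S S' (i, b) + hirotaTerm r X (symmDiff S {i}) (symmDiff S' {i}) (i, !b) = 0 := by
    intro S S' i b h1 h2
    have := hirotaTerm_add_hirotaTerm r hr hadd X (S.erase i) S' i (by simp) h2 b
    rw [Finset.insert_erase h1] at this
    have e1 : symmDiff S {i} = S.erase i := by
      ext j; by_cases hj : j = i <;> simp [Finset.mem_symmDiff, hj, h1]
    have e2 : symmDiff S' {i} = insert i S' := by
      ext j; by_cases hj : j = i <;> simp [Finset.mem_symmDiff, hj, h2]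
    rw [e1, e2, this]
  rw [e]
  -- The involution moves i to the other set and exchanges its two parameters. It has no fixed point
  -- because it flips the Boolean.
  refine Finset.sum_involution
    (fun q _ => ((symmDiff q.1.1 {q.2.1}, symmDiff q.1.2 {q.2.1}), (q.2.1, !q.2.2))) ?_ ?_ ?_ ?_
  · rintro ⟨⟨S, S'⟩, i, b⟩ h
    simp only [Finset.mem_filter, Finset.mem_univ, true_and, Finset.mem_symmDiff] at h
    rcases h with ⟨h1, h2⟩ | ⟨h1, h2⟩
    · exact main S S' i b h1 h2
    · have := main (symmDiff S {i}) (symmDiff S' {i}) i (!b)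
        (by simp [Finset.mem_symmDiff, h2]) (by simp [Finset.mem_symmDiff, h1])
      simp only [symmDiff_symmDiff_cancel_right, Bool.not_not] at this
      rw [add_comm]
      exact this
  · rintro ⟨⟨S, S'⟩, i, b⟩ _ _ h
    simp at h
  · rintro ⟨⟨S, S'⟩, i, b⟩ h
    simp only [Finset.mem_filter, Finset.mem_univ, true_and, Finset.mem_symmDiff] at h ⊢
    simp only [Finset.mem_singleton]
    tauto
  · rintro ⟨⟨S, S'⟩, i, b⟩ _
    simp [symmDiff_symmDiff_cancel_right]

/-- The Hirota condition in terms of the spectral parameters. -/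
lemma hirota_condition {ι : Type*} [LinearOrder ι] [Fintype ι] (r : ι × Bool → ℂ)
    (hr : Function.Injective r) (hadd : ∀ a b, r a + r b ≠ 0) (X : ι → ℂ) :
    ∑ S : Finset ι, ∑ S' : Finset ι,
      pairWeight (paramCoeff r) X S * pairWeight (paramCoeff r) X S' *
        (sumDiff r S S' ^ 3 * sumDiff (fun b => (r b)⁻¹) S S'
          - sumDiff (fun b => r b ^ 3) S S' * sumDiff (fun b => (r b)⁻¹) S S'
          - 3 * sumDiff r S S' ^ 2) = 0 := by
  have h0 : ∀ a, r a ≠ 0 := fun a h => hadd a a (by simp [h])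
  have key : ∀ S S' : Finset ι, ∑ a ∈ paramIndex S S', hirotaTerm r X S S' a
      = -(4 / 3) * (pairWeight (paramCoeff r) X S * pairWeight (paramCoeff r) X S' *
        (sumDiff r S S' ^ 3 * sumDiff (fun b => (r b)⁻¹) S S'
          - sumDiff (fun b => r b ^ 3) S S' * sumDiff (fun b => (r b)⁻¹) S S'
          - 3 * sumDiff r S S' ^ 2)) := by
    intro S S'
    have sgn : ∀ i, pairSign S i ≠ 0 := fun i h => by
      have := pairSign_mul_self S i; simp [h] at this
    have hinj : Set.InjOn (signedParam r S) (paramIndex S S') := by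
      rintro ⟨i, b⟩ _ ⟨j, c⟩ _ h
      by_contra hne
      have hne' : r (i, b) ≠ r (j, c) := fun hh => hne (hr hh)
      have ha := hadd (i, b) (j, c)
      simp only [signedParam, pairSign] at h
      split_ifs at h
      · simp only [one_mul] at h; exact hne' h
      · exact ha (by linear_combination h)
      · exact ha (by linear_combination -h)
      · exact hne' (by linear_combination -h)
    have hne : ∀ a ∈ paramIndex S S', signedParam r S a ≠ 0 := fun a _ =>
      mul_ne_zero (sgn _) (h0 a)
    -- Each index of the symmetric difference brings two parameters.
    have hev : Even (paramIndex S S').card := by simp [paramIndex]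
    have := sum_resWeight_mul_mul (signedParam r S) (paramIndex S S') hinj hne hev
    have c3 : ∑ a ∈ paramIndex S S', signedParam r S a ^ 3
        = sumDiff (fun b => r b ^ 3) S S' := by
      rw [← sum_signedParam]
      exact Finset.sum_congr rfl fun a _ => signedParam_cube r S a
    have c1 : ∑ a ∈ paramIndex S S', (signedParam r S a)⁻¹
        = sumDiff (fun b => (r b)⁻¹) S S' := by
      rw [← sum_signedParam]
      exact Finset.sum_congr rfl fun a _ => signedParam_inv r S a
    rw [c3, c1, sum_signedParam] at this
    simp only [hirotaTerm]
    rw [← Finset.mul_sum, this]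
    ring
  have := sum_hirotaTerm r hr hadd X
  simp only [key, ← Finset.mul_sum] at this
  simpa using this

/-! ### Families of partial derivatives and the bilinear equation -/

/-- `G a b c` is the partial derivative of `G 0 0 0` of order `a` in the first, `b` in the second
and `c` in the third variable. -/
structure IsJet (G : ℕ → ℕ → ℕ → ℝ → ℝ → ℝ → ℂ) : Prop where
  fst : ∀ a b c x y z, HasDerivAt (fun ξ => G a b c ξ y z) (G (a + 1) b c x y z) x
  snd : ∀ a b c x y z, HasDerivAt (fun η => G a b c x η z) (G a (b + 1) c x y z) y
  trd : ∀ a b c x y z, HasDerivAt (fun ζ => G a b c x y ζ) (G a b (c + 1) x y z) z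

/-- Half of Hirota's bilinear form
`(D_y (D_z + 3 μ β D_x + σ D_x³) + 3 μ α D_x²) f · f`. -/
def hirota (α β μ σ : ℝ) (G : ℕ → ℕ → ℕ → ℝ → ℝ → ℝ → ℂ) (x y z : ℝ) : ℂ :=
  (G 0 0 0 x y z * G 0 1 1 x y z - G 0 1 0 x y z * G 0 0 1 x y z)
    + 3 * μ * β * (G 0 0 0 x y z * G 1 1 0 x y z - G 1 0 0 x y z * G 0 1 0 x y z)
    + 3 * μ * α * (G 0 0 0 x y z * G 2 0 0 x y z - G 1 0 0 x y z * G 1 0 0 x y z)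
    + σ * (G 0 0 0 x y z * G 3 1 0 x y z - G 3 0 0 x y z * G 0 1 0 x y z
        - 3 * G 1 0 0 x y z * G 2 1 0 x y z + 3 * G 2 0 0 x y z * G 1 1 0 x y z)

/-- `u` in terms of the derivatives of `f`. -/
def uJet (α μ σ : ℝ) (G : ℕ → ℕ → ℕ → ℝ → ℝ → ℝ → ℂ) (x y z : ℝ) : ℂ :=
  α + 2 * σ / μ * ((G 1 1 0 x y z * G 0 0 0 x y z - G 1 0 0 x y z * G 0 1 0 x y z)
    / G 0 0 0 x y z ^ 2)

/-- `v` in terms of the derivatives of `f`. -/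
def vJet (β μ σ : ℝ) (G : ℕ → ℕ → ℕ → ℝ → ℝ → ℝ → ℂ) (x y z : ℝ) : ℂ :=
  β + 2 * σ / μ * ((G 2 0 0 x y z * G 0 0 0 x y z - G 1 0 0 x y z * G 1 0 0 x y z)
    / G 0 0 0 x y z ^ 2)

/-- The derivatives of `f` divided by `f`. -/
def normJet (G : ℕ → ℕ → ℕ → ℝ → ℝ → ℝ → ℂ) (a b c : ℕ) (x y z : ℝ) : ℂ :=
  G a b c x y z / G 0 0 0 x y z

/-- Uniqueness of derivatives: it identifies the termwise derivatives of the exponential sum with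
the derivatives of its smooth normalized form. -/
lemma IsJet.ext {G G' : ℕ → ℕ → ℕ → ℝ → ℝ → ℝ → ℂ} (h : IsJet G) (h' : IsJet G')
    (h0 : G 0 0 0 = G' 0 0 0) : G = G' := by
  have ha : ∀ a, G a 0 0 = G' a 0 0 := by
    intro a
    induction a with
    | zero => exact h0
    | succ a ih =>
      funext x y z
      have := h.fst a 0 0 x y z
      rw [ih] at this
      exact this.unique (h'.fst a 0 0 x y z)
  have hb : ∀ b a, G a b 0 = G' a b 0 := by
    intro b a
    induction b with
    | zero => exact ha a
    | succ b ih =>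
      funext x y z
      have := h.snd a b 0 x y z
      rw [ih] at this
      exact this.unique (h'.snd a b 0 x y z)
  funext a b c
  induction c with
  | zero => exact hb b a
  | succ c ih =>
    funext x y z
    have := h.trd a b c x y z
    rw [ih] at this
    exact this.unique (h'.trd a b c x y z)

section

variable {G : ℕ → ℕ → ℕ → ℝ → ℝ → ℝ → ℂ} (h : IsJet G)

include h

lemma IsJet.normJet_fst (a b c : ℕ) {x y z : ℝ} (h0 : G 0 0 0 x y z ≠ 0) :
    HasDerivAt (fun ξ => normJet G a b c ξ y z)
      (normJet G (a + 1) b c x y z - normJet G a b c x y z * normJet G 1 0 0 x y z) x := by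
  have := (h.fst a b c x y z).div (h.fst 0 0 0 x y z) h0
  refine this.congr_deriv ?_
  simp only [normJet]
  field_simp

lemma IsJet.normJet_snd (a b c : ℕ) {x y z : ℝ} (h0 : G 0 0 0 x y z ≠ 0) :
    HasDerivAt (fun η => normJet G a b c x η z)
      (normJet G a (b + 1) c x y z - normJet G a b c x y z * normJet G 0 1 0 x y z) y := by
  have := (h.snd a b c x y z).div (h.snd 0 0 0 x y z) h0
  refine this.congr_deriv ?_
  simp only [normJet]
  field_simp

lemma IsJet.normJet_trd (a b c : ℕ) {x y z : ℝ} (h0 : G 0 0 0 x y z ≠ 0) :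
    HasDerivAt (fun ζ => normJet G a b c x y ζ)
      (normJet G a b (c + 1) x y z - normJet G a b c x y z * normJet G 0 0 1 x y z) z := by
  have := (h.trd a b c x y z).div (h.trd 0 0 0 x y z) h0
  refine this.congr_deriv ?_
  simp only [normJet]
  field_simp

lemma IsJet.logDeriv_eq (x y z : ℝ) :
    logDeriv (fun ξ => G 0 0 0 ξ y z) x = normJet G 1 0 0 x y z := by
  rw [logDeriv_apply, (h.fst 0 0 0 x y z).deriv, normJet]

lemma IsJet.uOf_eq (α μ σ : ℝ) (R : ℝ → ℝ) {x y t : ℝ} (h0 : G 0 0 0 x y (R t) ≠ 0) :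
    uOf α μ σ (fun x y t => G 0 0 0 x y (R t)) x y t
      = α + 2 * σ / μ * (normJet G 1 1 0 x y (R t)
          - normJet G 1 0 0 x y (R t) * normJet G 0 1 0 x y (R t)) := by
  have : (fun η => logDeriv (fun ξ => G 0 0 0 ξ η (R t)) x)
      = fun η => normJet G 1 0 0 x η (R t) := funext fun η => h.logDeriv_eq x η (R t)
  rw [uOf, this, (h.normJet_snd 1 0 0 h0).deriv]

lemma IsJet.vOf_eq (β μ σ : ℝ) (R : ℝ → ℝ) {x y t : ℝ} (h0 : G 0 0 0 x y (R t) ≠ 0) :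
    vOf β μ σ (fun x y t => G 0 0 0 x y (R t)) x y t
      = β + 2 * σ / μ * (normJet G 2 0 0 x y (R t)
          - normJet G 1 0 0 x y (R t) * normJet G 1 0 0 x y (R t)) := by
  have : logDeriv (fun ξ => G 0 0 0 ξ y (R t))
      = fun ξ => normJet G 1 0 0 ξ y (R t) := funext fun ξ => h.logDeriv_eq ξ y (R t)
  rw [vOf, this, (h.normJet_fst 1 0 0 h0).deriv]

lemma IsJet.uOf_eq_uJet (α μ σ : ℝ) (R : ℝ → ℝ) {x y t : ℝ} (h0 : G 0 0 0 x y (R t) ≠ 0) :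
    uOf α μ σ (fun x y t => G 0 0 0 x y (R t)) x y t = uJet α μ σ G x y (R t) := by
  rw [h.uOf_eq α μ σ R h0, uJet]
  simp only [normJet]
  field_simp

lemma IsJet.vOf_eq_vJet (β μ σ : ℝ) (R : ℝ → ℝ) {x y t : ℝ} (h0 : G 0 0 0 x y (R t) ≠ 0) :
    vOf β μ σ (fun x y t => G 0 0 0 x y (R t)) x y t = vJet β μ σ G x y (R t) := by
  rw [h.vOf_eq β μ σ R h0, vJet]
  simp only [normJet]
  field_simp

lemma IsJet.contDiff_fst (n a b c : ℕ) (y z : ℝ) : ContDiff ℝ n (fun ξ => G a b c ξ y z) := by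
  induction n generalizing a with
  | zero =>
    exact contDiff_zero.2 (Differentiable.continuous fun x => (h.fst a b c x y z).differentiableAt)
  | succ n ih =>
    have : deriv (fun ξ => G a b c ξ y z) = fun ξ => G (a + 1) b c ξ y z :=
      funext fun x => (h.fst a b c x y z).deriv
    push_cast
    refine contDiff_succ_iff_deriv.2 ⟨fun x => (h.fst a b c x y z).differentiableAt, ?_, ?_⟩
    · simp
    · rw [this]; exact ih (a + 1)

/-- Solutions of the bilinear equation generate solutions of the system. -/
lemma IsJet.solvesAt (ρ R : ℝ → ℝ) (α β μ σ : ℝ) (hμ : μ ≠ 0) {x y t : ℝ} (hρ : ρ t ≠ 0)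
    (hR : HasDerivAt R (1 / ρ t) t) (hG : ∀ x y z, hirota α β μ σ G x y z = 0)
    (h0 : G 0 0 0 x y (R t) ≠ 0) :
    SolvesAt ρ μ σ (uOf α μ σ (fun x y t => G 0 0 0 x y (R t)))
      (vOf β μ σ (fun x y t => G 0 0 0 x y (R t))) x y t := by
  set z := R t with hz
  have ex : ∀ᶠ ξ in 𝓝 x, G 0 0 0 ξ y z ≠ 0 :=
    (h.fst 0 0 0 x y z).continuousAt.eventually_ne h0
  have ey : ∀ᶠ η in 𝓝 y, G 0 0 0 x η z ≠ 0 :=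
    (h.snd 0 0 0 x y z).continuousAt.eventually_ne h0
  have et : ∀ᶠ τ in 𝓝 t, G 0 0 0 x y (R τ) ≠ 0 := by
    have : ContinuousAt (fun τ => G 0 0 0 x y (R τ)) t :=
      ContinuousAt.comp (f := R) (h.trd 0 0 0 x y (R t)).continuousAt hR.continuousAt
    exact this.eventually_ne h0
  set κ : ℂ := 2 * σ / μ with hκ
  have ux : (fun ξ => uOf α μ σ (fun x y t => G 0 0 0 x y (R t)) ξ y t) =ᶠ[𝓝 x]
      fun ξ => α + κ * (normJet G 1 1 0 ξ y z - normJet G 1 0 0 ξ y z * normJet G 0 1 0 ξ y z) :=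
    ex.mono fun ξ hξ => h.uOf_eq α μ σ R hξ
  have vx : (fun ξ => vOf β μ σ (fun x y t => G 0 0 0 x y (R t)) ξ y t) =ᶠ[𝓝 x]
      fun ξ => β + κ * (normJet G 2 0 0 ξ y z - normJet G 1 0 0 ξ y z * normJet G 1 0 0 ξ y z) :=
    ex.mono fun ξ hξ => h.vOf_eq β μ σ R hξ
  have vy : (fun η => vOf β μ σ (fun x y t => G 0 0 0 x y (R t)) x η t) =ᶠ[𝓝 y]
      fun η => β + κ * (normJet G 2 0 0 x η z - normJet G 1 0 0 x η z * normJet G 1 0 0 x η z) :=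
    ey.mono fun η hη => h.vOf_eq β μ σ R hη
  have ut : (fun τ => uOf α μ σ (fun x y t => G 0 0 0 x y (R t)) x y τ) =ᶠ[𝓝 t]
      fun τ => α + κ * (normJet G 1 1 0 x y (R τ)
        - normJet G 1 0 0 x y (R τ) * normJet G 0 1 0 x y (R τ)) :=
    et.mono fun τ hτ => h.uOf_eq α μ σ R hτ
  set a : ℕ → ℝ → ℂ := fun n ξ => normJet G n 0 0 ξ y z with ha
  set b : ℕ → ℝ → ℂ := fun n ξ => normJet G n 1 0 ξ y z with hb
  have da : ∀ n ξ, G 0 0 0 ξ y z ≠ 0 → HasDerivAt (a n) (a (n + 1) ξ - a n ξ * a 1 ξ) ξ :=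
    fun n ξ hξ => h.normJet_fst n 0 0 hξ
  have db : ∀ n ξ, G 0 0 0 ξ y z ≠ 0 → HasDerivAt (b n) (b (n + 1) ξ - b n ξ * a 1 ξ) ξ :=
    fun n ξ hξ => h.normJet_fst n 1 0 hξ
  have dy : ∀ a b c, HasDerivAt (fun η => normJet G a b c x η z)
      (normJet G a (b + 1) c x y z - normJet G a b c x y z * normJet G 0 1 0 x y z) y :=
    fun a b c => h.normJet_snd a b c h0
  have dt : ∀ a b c, HasDerivAt (fun τ => normJet G a b c x y (R τ))
      ((1 / ρ t) • (normJet G a b (c + 1) x y z - normJet G a b c x y z * normJet G 0 0 1 x y z))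
      t := fun a b c =>
    HasDerivAt.scomp (h := R) t (h.normJet_trd a b c h0) hR
  have Dut := (((dt 1 1 0).sub ((dt 1 0 0).mul (dt 0 1 0))).const_mul κ).const_add (α : ℂ)
  have Dvx := (((da 2 x h0).sub ((da 1 x h0).mul (da 1 x h0))).const_mul κ).const_add (β : ℂ)
  have Dvy := (((dy 2 0 0).sub ((dy 1 0 0).mul (dy 1 0 0))).const_mul κ).const_add (β : ℂ)
  have D1 : ∀ ξ, G 0 0 0 ξ y z ≠ 0 → HasDerivAt (fun ξ => α + κ * (b 1 ξ - a 1 ξ * b 0 ξ))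
      (κ * (b 2 ξ - 2 * a 1 ξ * b 1 ξ - a 2 ξ * b 0 ξ + 2 * a 1 ξ * a 1 ξ * b 0 ξ)) ξ :=
    fun ξ hξ => ((((db 1 ξ hξ).sub ((da 1 ξ hξ).mul (db 0 ξ hξ))).const_mul κ).const_add
      (α : ℂ)).congr_deriv (by ring)
  have D2 : ∀ ξ, G 0 0 0 ξ y z ≠ 0 → HasDerivAt
      (fun ξ => κ * (b 2 ξ - 2 * a 1 ξ * b 1 ξ - a 2 ξ * b 0 ξ + 2 * a 1 ξ * a 1 ξ * b 0 ξ))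
      (κ * (b 3 ξ - 3 * a 1 ξ * b 2 ξ - 3 * a 2 ξ * b 1 ξ + 6 * a 1 ξ * a 1 ξ * b 1 ξ
        - a 3 ξ * b 0 ξ + 6 * a 1 ξ * a 2 ξ * b 0 ξ - 6 * a 1 ξ * a 1 ξ * a 1 ξ * b 0 ξ)) ξ :=
    fun ξ hξ => (((((db 2 ξ hξ).sub (((da 1 ξ hξ).const_mul 2).mul (db 1 ξ hξ))).sub
      ((da 2 ξ hξ).mul (db 0 ξ hξ))).add
      ((((da 1 ξ hξ).const_mul 2).mul (da 1 ξ hξ)).mul (db 0 ξ hξ))).const_mul κ).congr_deriv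
        (by simp only [Pi.mul_apply]; ring)
  have D3 := ((((((((db 3 x h0).sub (((da 1 x h0).const_mul 3).mul (db 2 x h0))).sub
      (((da 2 x h0).const_mul 3).mul (db 1 x h0))).add
      ((((da 1 x h0).const_mul 6).mul (da 1 x h0)).mul (db 1 x h0))).sub
      ((da 3 x h0).mul (db 0 x h0))).add
      ((((da 1 x h0).const_mul 6).mul (da 2 x h0)).mul (db 0 x h0))).sub
      (((((da 1 x h0).const_mul 6).mul (da 1 x h0)).mul (da 1 x h0)).mul (db 0 x h0))).const_mul κ)
  have e1 : deriv (fun ξ => uOf α μ σ (fun x y t => G 0 0 0 x y (R t)) ξ y t) =ᶠ[𝓝 x] _ :=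
    ux.deriv.trans (ex.mono fun ξ hξ => (D1 ξ hξ).deriv)
  have e2 : deriv (deriv (fun ξ => uOf α μ σ (fun x y t => G 0 0 0 x y (R t)) ξ y t)) =ᶠ[𝓝 x] _ :=
    e1.deriv.trans (ex.mono fun ξ hξ => (D2 ξ hξ).deriv)
  have e3 := e2.deriv_eq.trans D3.deriv
  have Duv := ((D1 x h0).congr_of_eventuallyEq ux).mul (Dvx.congr_of_eventuallyEq vx)
  have dc := h.normJet_fst 0 0 1 h0
  have dd := h.normJet_fst 0 1 1 h0
  have DH := ((dd.sub ((db 0 x h0).mul dc)).add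
    (((db 1 x h0).sub ((da 1 x h0).mul (db 0 x h0))).const_mul (3 * μ * β : ℂ))).add
    (((da 2 x h0).sub ((da 1 x h0).mul (da 1 x h0))).const_mul (3 * μ * α : ℂ)) |>.add
    (((((db 3 x h0).sub ((da 3 x h0).mul (db 0 x h0))).sub
      (((da 1 x h0).const_mul 3).mul (db 2 x h0))).add
      (((da 2 x h0).const_mul 3).mul (db 1 x h0))).const_mul (σ : ℂ))
  -- The bilinear form divided by f² vanishes for all ξ near x, so its x-derivative at x vanishes
  -- too. Up to the factor κ = 2σ/μ this derivative is the evolution equation.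
  have eH := DH.congr_of_eventuallyEq (f₁ := fun _ => (0 : ℂ)) (by
    filter_upwards [ex] with ξ hξ
    have := hG ξ y z
    rw [hirota] at this
    have h2 : (0 : ℂ) = 0 / G 0 0 0 ξ y z ^ 2 := by simp
    rw [h2, ← this]
    simp only [ha, hb, normJet, Pi.add_apply, Pi.sub_apply, Pi.mul_apply]
    field_simp) |>.unique (hasDerivAt_const x (0 : ℂ))
  have hρ' : (ρ t : ℂ) ≠ 0 := by exact_mod_cast hρ
  have hκμ : κ * μ = 2 * σ := by
    rw [hκ, div_mul_cancel₀]; exact_mod_cast hμ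
  refine ⟨(Dut.congr_of_eventuallyEq ut).differentiableAt, ?_,
    (Dvx.congr_of_eventuallyEq vx).differentiableAt,
    (Dvy.congr_of_eventuallyEq vy).differentiableAt, ?_, ?_⟩
  · refine ContDiffAt.congr_of_eventuallyEq ?_ ux
    have hN : ∀ p q, ContDiffAt ℝ 3 (fun ξ => normJet G p q 0 ξ y z) x := fun p q =>
      ((h.contDiff_fst 3 p q 0 y z).contDiffAt).mul
        (((h.contDiff_fst 3 0 0 0 y z).contDiffAt).inv h0)
    exact contDiffAt_const.add (contDiffAt_const.mul ((hN 1 1).sub ((hN 1 0).mul (hN 0 1))))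
  · have hut := (Dut.congr_of_eventuallyEq ut).deriv
    have huv : deriv (fun ξ => uOf α μ σ (fun x y t => G 0 0 0 x y (R t)) ξ y t *
      vOf β μ σ (fun x y t => G 0 0 0 x y (R t)) ξ y t) x = _ := Duv.deriv
    rw [iteratedDeriv_succ, iteratedDeriv_succ, iteratedDeriv_one, e3, huv, hut, ux.eq_of_nhds,
      vx.eq_of_nhds]
    simp only [Complex.real_smul, Complex.ofReal_div, Complex.ofReal_one]
    simp only [Pi.mul_apply]
    have hV : normJet G 0 1 0 x y (R t) = b 0 x := rfl
    have hA : normJet G 1 0 0 x y (R t) = a 1 x := rfl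
    have hA' : normJet G 1 0 0 x y z = a 1 x := rfl
    have hB : normJet G 1 1 0 x y z = b 1 x := rfl
    have hA2 : normJet G 2 0 0 x y z = a 2 x := rfl
    have hB0 : normJet G 0 1 0 x y z = b 0 x := rfl
    simp only [hV, hA, hA', hB, hA2, hB0] at eH ⊢
    simp only [Nat.reduceAdd] at eH ⊢
    clear_value κ a b
    have hρ1 : (ρ t : ℂ) * (1 / ρ t) = 1 := by field_simp
    -- The second term replaces κμ by 2σ in the derivative of the product uv; the last one cancels ρ
    -- against the factor 1/ρ from the derivative of R.
    linear_combination κ * eH + 3 * κ * ((b 2 x - 2 * a 1 x * b 1 x - a 2 x * b 0 x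
      + 2 * a 1 x * a 1 x * b 0 x) * (a 2 x - a 1 x * a 1 x) + (b 1 x - a 1 x * b 0 x)
      * (a 3 x - 3 * a 1 x * a 2 x + 2 * a 1 x * a 1 x * a 1 x)) * hκμ
      + κ * (normJet G 1 1 1 x y z - b 1 x * normJet G 0 0 1 x y z
        - ((normJet G 1 0 1 x y z - a 1 x * normJet G 0 0 1 x y z) * b 0 x
          + a 1 x * (normJet G 0 1 1 x y z - b 0 x * normJet G 0 0 1 x y z))) * hρ1
  · rw [e1.eq_of_nhds, (Dvy.congr_of_eventuallyEq vy).deriv]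
    simp only [ha, hb]
    ring

end

/-! ### The multi-soliton function solves the bilinear equation -/

/-- The derivatives of `∑ S, w S * exp (K S * x + L S * y + O S * z)`. -/
def expJet {T : Type*} [Fintype T] (w K L O : T → ℂ) (a b c : ℕ) (x y z : ℝ) : ℂ :=
  ∑ S, w S * Complex.exp (K S * x + L S * y + O S * z) * (K S ^ a * L S ^ b * O S ^ c)

lemma isJet_expJet {T : Type*} [Fintype T] (w K L O : T → ℂ) : IsJet (expJet w K L O) where
  fst a b c x y z := by
    refine HasDerivAt.fun_sum fun S _ => ?_
    have h : HasDerivAt (fun ξ : ℝ => K S * ξ + L S * y + O S * z) (K S) x := by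
      simpa using (((Complex.ofRealCLM.hasDerivAt (x := x)).const_mul (K S)).add_const
        (L S * y)).add_const (O S * z)
    exact ((h.cexp.const_mul (w S)).mul_const _).congr_deriv (by ring)
  snd a b c x y z := by
    refine HasDerivAt.fun_sum fun S _ => ?_
    have h : HasDerivAt (fun η : ℝ => K S * x + L S * η + O S * z) (L S) y := by
      simpa using (((Complex.ofRealCLM.hasDerivAt (x := y)).const_mul (L S)).const_add
        (K S * x)).add_const (O S * z)
    exact ((h.cexp.const_mul (w S)).mul_const _).congr_deriv (by ring)
  trd a b c x y z := by
    refine HasDerivAt.fun_sum fun S _ => ?_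
    have h : HasDerivAt (fun ζ : ℝ => K S * x + L S * y + O S * ζ) (O S) z := by
      simpa using ((Complex.ofRealCLM.hasDerivAt (x := z)).const_mul (O S)).const_add
        (K S * x + L S * y)
    exact ((h.cexp.const_mul (w S)).mul_const _).congr_deriv (by ring)

/-- On a product of two exponentials Hirota operators act through differences of the exponents. The
factor 2 symmetrizes the form in S and S'. -/
lemma two_mul_hirota_expJet {T : Type*} [Fintype T] (w K L O : T → ℂ) (α β μ σ : ℝ) (x y z : ℝ) :
    2 * hirota α β μ σ (expJet w K L O) x y z
      = ∑ S, ∑ S', (w S * Complex.exp (K S * x + L S * y + O S * z)) *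
          (w S' * Complex.exp (K S' * x + L S' * y + O S' * z)) *
          ((L S - L S') * (O S - O S') + 3 * μ * β * ((K S - K S') * (L S - L S'))
            + 3 * μ * α * (K S - K S') ^ 2 + σ * ((K S - K S') ^ 3 * (L S - L S'))) := by
  set e : T → ℂ := fun S => w S * Complex.exp (K S * x + L S * y + O S * z) with he
  have hG : ∀ a b c, expJet w K L O a b c x y z = ∑ S, e S * (K S ^ a * L S ^ b * O S ^ c) :=
    fun a b c => rfl
  have hM : ∀ a b c a' b' c', expJet w K L O a b c x y z * expJet w K L O a' b' c' x y z
      = ∑ S, ∑ S', e S * e S' * ((K S ^ a * L S ^ b * O S ^ c)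
          * (K S' ^ a' * L S' ^ b' * O S' ^ c')) := by
    intro a b c a' b' c'
    rw [hG, hG, Finset.sum_mul_sum]
    exact Finset.sum_congr rfl fun S _ => Finset.sum_congr rfl fun S' _ => by ring
  set G := expJet w K L O
  have e1 : 2 * hirota α β μ σ G x y z
      = (G 0 0 0 x y z * G 0 1 1 x y z + G 0 1 1 x y z * G 0 0 0 x y z
          - G 0 1 0 x y z * G 0 0 1 x y z - G 0 0 1 x y z * G 0 1 0 x y z)
        + 3 * μ * β * (G 0 0 0 x y z * G 1 1 0 x y z + G 1 1 0 x y z * G 0 0 0 x y z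
          - G 1 0 0 x y z * G 0 1 0 x y z - G 0 1 0 x y z * G 1 0 0 x y z)
        + 3 * μ * α * (G 0 0 0 x y z * G 2 0 0 x y z + G 2 0 0 x y z * G 0 0 0 x y z
          - 2 * (G 1 0 0 x y z * G 1 0 0 x y z))
        + σ * (G 0 0 0 x y z * G 3 1 0 x y z + G 3 1 0 x y z * G 0 0 0 x y z
          - G 3 0 0 x y z * G 0 1 0 x y z - G 0 1 0 x y z * G 3 0 0 x y z
          - 3 * (G 1 0 0 x y z * G 2 1 0 x y z) - 3 * (G 2 1 0 x y z * G 1 0 0 x y z)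
          + 3 * (G 2 0 0 x y z * G 1 1 0 x y z) + 3 * (G 1 1 0 x y z * G 2 0 0 x y z)) := by
    rw [hirota]; ring
  rw [e1]
  simp only [hM, Finset.mul_sum, ← Finset.sum_add_distrib, ← Finset.sum_sub_distrib]
  exact Finset.sum_congr rfl fun S _ => Finset.sum_congr rfl fun S' _ => by ring

/-- The frequency of a soliton. -/
def freq (α β μ σ : ℝ) (k p : ℂ) : ℂ :=
  -((σ * k ^ 3 * p + 3 * β * μ * k * p + 3 * α * μ * k ^ 2) / p)

/-- The derivatives of the multi-soliton function. -/
def solitonJet (α β μ σ : ℝ) {N : ℕ} (k p θ₀ : Fin N → ℂ) : ℕ → ℕ → ℕ → ℝ → ℝ → ℝ → ℂ :=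
  expJet (fun S : Finset (Fin N) => Complex.exp (∑ j ∈ S, θ₀ j) *
      ∏ s ∈ S, ∏ j ∈ S.filter (fun j => s < j), expA α μ σ (k s) (p s) (k j) (p j))
    (fun S => ∑ j ∈ S, k j) (fun S => ∑ j ∈ S, p j) (fun S => ∑ j ∈ S, freq α β μ σ (k j) (p j))

lemma isJet_solitonJet (α β μ σ : ℝ) {N : ℕ} (k p θ₀ : Fin N → ℂ) :
    IsJet (solitonJet α β μ σ k p θ₀) := isJet_expJet _ _ _ _

lemma exp_mul_exp_eq_prod (α β μ σ : ℝ) {N : ℕ} (k p θ₀ : Fin N → ℂ) (S : Finset (Fin N))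
    (x y z : ℝ) :
    Complex.exp (∑ j ∈ S, θ₀ j) * Complex.exp ((∑ j ∈ S, k j) * x + (∑ j ∈ S, p j) * y
        + (∑ j ∈ S, freq α β μ σ (k j) (p j)) * z)
      = ∏ j ∈ S, Complex.exp (k j * x + p j * y + freq α β μ σ (k j) (p j) * z + θ₀ j) := by
  rw [← Complex.exp_add, ← Complex.exp_sum]
  simp only [Finset.sum_add_distrib, Finset.sum_mul]
  congr 1; ring

lemma soliton_eq_prod (R : ℝ → ℝ) (α β μ σ : ℝ) {N : ℕ} (k p θ₀ : Fin N → ℂ) (x y t : ℝ) :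
    soliton R α β μ σ k p θ₀ x y t
      = ∑ S : Finset (Fin N), (∏ j ∈ S,
          Complex.exp (k j * x + p j * y + freq α β μ σ (k j) (p j) * R t + θ₀ j)) *
        ∏ s ∈ S, ∏ j ∈ S.filter (fun j => s < j), expA α μ σ (k s) (p s) (k j) (p j) := by
  rw [soliton]
  refine Finset.sum_congr rfl fun S _ => ?_
  rw [← Complex.exp_sum]
  congr 2
  refine Finset.sum_congr rfl fun j _ => ?_
  rw [phase, freq]; ring

lemma soliton_eq (R : ℝ → ℝ) (α β μ σ : ℝ) {N : ℕ} (k p θ₀ : Fin N → ℂ) :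
    soliton R α β μ σ k p θ₀ = fun x y t => solitonJet α β μ σ k p θ₀ 0 0 0 x y (R t) := by
  funext x y t
  rw [soliton_eq_prod, solitonJet, expJet]
  refine Finset.sum_congr rfl fun S _ => ?_
  rw [← exp_mul_exp_eq_prod]
  simp only [pow_zero]
  ring

/-- Numerator and denominator of the interaction coefficient acquire the same prefactor in the
parameters P, Q, so the quotient becomes `paramCoeff`. -/
lemma expADen_param (α μ σ : ℝ) (κ P Q P' Q' : ℂ) (hκ : (α * μ : ℂ) = -σ * κ)
    (hP : P ≠ 0) (hQ : Q ≠ 0) (hP' : P' ≠ 0) (hQ' : Q' ≠ 0) :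
    expADen α μ σ (P + Q) (κ * (P⁻¹ + Q⁻¹)) (P' + Q') (κ * (P'⁻¹ + Q'⁻¹))
      = σ * κ ^ 3 * (P + Q) ^ 2 * (P' + Q') ^ 2 / (P * Q * P' * Q') ^ 2
        * ((P + P') * (P + Q') * (Q + P') * (Q + Q')) := by
  rw [expADen, hκ]
  field_simp
  ring

lemma expANum_param (α μ σ : ℝ) (κ P Q P' Q' : ℂ) (hκ : (α * μ : ℂ) = -σ * κ)
    (hP : P ≠ 0) (hQ : Q ≠ 0) (hP' : P' ≠ 0) (hQ' : Q' ≠ 0) (k p k' p' : ℂ) (hk : k = P + Q)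
    (hp : p = κ * (P⁻¹ + Q⁻¹)) (hk' : k' = P' + Q') (hp' : p' = κ * (P'⁻¹ + Q'⁻¹)) :
    σ * k * k' * (k - k') * (p - p') * p * p' - α * μ * (k' * p - k * p') ^ 2
      = σ * κ ^ 3 * (P + Q) ^ 2 * (P' + Q') ^ 2 / (P * Q * P' * Q') ^ 2
        * ((P - P') * (P - Q') * (Q - P') * (Q - Q')) := by
  rw [hκ, hk, hk', hp, hp']
  field_simp
  ring

/-- P and Q are the roots of w² - k w + κk/p. They are distinct because the discriminant vanishes
only for kp = 4κ. -/
lemma exists_param (κ k p : ℂ) (hκ : κ ≠ 0) (hk : k ≠ 0) (hp : p ≠ 0) (hkp : k * p ≠ 4 * κ) :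
    ∃ P Q : ℂ, P ≠ 0 ∧ Q ≠ 0 ∧ P ≠ Q ∧ P + Q ≠ 0 ∧ k = P + Q ∧ p = κ * (P⁻¹ + Q⁻¹) := by
  obtain ⟨s, hs⟩ := IsAlgClosed.exists_pow_nat_eq (k ^ 2 - 4 * κ * k / p) (n := 2) (by norm_num)
  have hPQ : (k + s) / 2 * ((k - s) / 2) = κ * k / p := by
    have : (k + s) / 2 * ((k - s) / 2) = (k ^ 2 - s ^ 2) / 4 := by ring
    rw [this, hs]; field_simp; ring
  have hne : (k + s) / 2 * ((k - s) / 2) ≠ 0 := by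
    rw [hPQ]; exact div_ne_zero (mul_ne_zero hκ hk) hp
  have hP := left_ne_zero_of_mul hne
  have hQ := right_ne_zero_of_mul hne
  refine ⟨(k + s) / 2, (k - s) / 2, hP, hQ, fun h => ?_, ?_, by ring, ?_⟩
  · have hs0 : s = 0 := by linear_combination h
    rw [hs0] at hs
    have : k * (k * p - 4 * κ) = 0 := by
      have h2 : k ^ 2 - 4 * κ * k / p = 0 := by rw [← hs]; ring
      field_simp at h2
      linear_combination h2
    rcases mul_eq_zero.1 this with h | h
    · exact hk h
    · exact hkp (sub_eq_zero.1 h)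
  · ring_nf; exact hk
  · have : ((k + s) / 2)⁻¹ + ((k - s) / 2)⁻¹ = k / ((k + s) / 2 * ((k - s) / 2)) := by
      rw [inv_add_inv hP hQ]; congr 1; ring
    rw [this, hPQ]
    field_simp

/-- The multi-soliton function solves the bilinear equation. -/
lemma hirota_solitonJet (α β μ σ : ℝ) (hα : α ≠ 0) (hμ : μ ≠ 0) (hσ : σ ≠ 0) {N : ℕ}
    (k p θ₀ : Fin N → ℂ) (hk : ∀ j, k j ≠ 0) (hp : ∀ j, p j ≠ 0)
    (hkp : ∀ j, σ * (k j * p j) + 4 * α * μ ≠ 0)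
    (hA : ∀ s j, s < j → expADen α μ σ (k s) (p s) (k j) (p j) ≠ 0 ∧
      expA α μ σ (k s) (p s) (k j) (p j) ≠ 0) (x y z : ℝ) :
    hirota α β μ σ (solitonJet α β μ σ k p θ₀) x y z = 0 := by
  have hα' : (α : ℂ) ≠ 0 := by exact_mod_cast hα
  have hμ' : (μ : ℂ) ≠ 0 := by exact_mod_cast hμ
  have hσ' : (σ : ℂ) ≠ 0 := by exact_mod_cast hσ
  obtain ⟨κ, hκ⟩ : ∃ κ : ℂ, (α * μ : ℂ) = -σ * κ := ⟨-(α * μ) / σ, by field_simp⟩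
  have hκ0 : κ ≠ 0 := by
    rintro rfl
    rw [mul_zero] at hκ
    exact mul_ne_zero hα' hμ' hκ
  choose P Q hP hQ hPQ hPQ' hkPQ hpPQ using fun j => exists_param κ (k j) (p j) hκ0 (hk j) (hp j)
    (fun h => hkp j (by rw [h]; linear_combination 4 * hκ))
  set r : Fin N × Bool → ℂ := fun a => if a.2 then P a.1 else Q a.1 with hr
  have r1 : ∀ j, r (j, true) = P j := fun j => rfl
  have r2 : ∀ j, r (j, false) = Q j := fun j => rfl
  have hden : ∀ s j, expADen α μ σ (k s) (p s) (k j) (p j)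
      = σ * κ ^ 3 * (P s + Q s) ^ 2 * (P j + Q j) ^ 2 / (P s * Q s * P j * Q j) ^ 2
        * ((P s + P j) * (P s + Q j) * (Q s + P j) * (Q s + Q j)) := by
    intro s j
    rw [hkPQ s, hkPQ j, hpPQ s, hpPQ j]
    exact expADen_param α μ σ κ _ _ _ _ hκ (hP s) (hQ s) (hP j) (hQ j)
  have hexpA : ∀ s j, expA α μ σ (k s) (p s) (k j) (p j) = paramCoeff r s j := by
    intro s j
    rw [expA, hden, expANum_param α μ σ κ (P s) (Q s) (P j) (Q j) hκ (hP s) (hQ s) (hP j) (hQ j)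
      (k s) (p s) (k j) (p j) (hkPQ s) (hpPQ s) (hkPQ j) (hpPQ j), paramCoeff]
    refine mul_div_mul_left _ _ ?_
    have := hP s; have := hQ s; have := hP j; have := hQ j
    have := hPQ' s; have := hPQ' j
    positivity
  have hplus : ∀ s j, s ≠ j → (P s + P j) * (P s + Q j) * (Q s + P j) * (Q s + Q j) ≠ 0 := by
    intro s j hsj
    rcases lt_or_gt_of_ne hsj with h | h
    · have := (hA s j h).1
      rw [hden] at this
      exact right_ne_zero_of_mul this
    · have := (hA j s h).1
      rw [hden] at this
      convert right_ne_zero_of_mul this using 1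
      ring
  -- Nonvanishing of e^A keeps the parameters of different solitons distinct, just as nonvanishing
  -- of the denominators excludes opposite parameters in `hplus`.
  have hminus : ∀ s j, s ≠ j → (P s - P j) * (P s - Q j) * (Q s - P j) * (Q s - Q j) ≠ 0 := by
    intro s j hsj h0
    rcases lt_or_gt_of_ne hsj with h | h
    · have := (hA s j h).2
      rw [hexpA] at this
      exact this (by simp only [paramCoeff, r1, r2, h0, zero_div])
    · have := (hA j s h).2
      rw [hexpA, paramCoeff_comm] at this
      exact this (by simp only [paramCoeff, r1, r2, h0, zero_div])
  have hinj : Function.Injective r := by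
    rintro ⟨i, b⟩ ⟨j, c⟩ h
    by_cases hij : i = j
    · subst hij
      cases b <;> cases c
      exacts [rfl, absurd h.symm (hPQ i), absurd h (hPQ i), rfl]
    · have := hminus i j hij
      simp only [mul_ne_zero_iff, sub_ne_zero] at this
      cases b <;> cases c <;> simp_all
  have hadd : ∀ a b, r a + r b ≠ 0 := by
    rintro ⟨i, b⟩ ⟨j, c⟩
    by_cases hij : i = j
    · subst hij
      have h1 : ∀ w : ℂ, w ≠ 0 → w + w ≠ 0 := fun w hw h => hw (by linear_combination h / 2)
      cases b <;> cases c
      · exact h1 _ (hQ i)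
      · rw [r1, r2, add_comm]; exact hPQ' i
      · exact hPQ' i
      · exact h1 _ (hP i)
    · have := hplus i j hij
      simp only [mul_ne_zero_iff] at this
      cases b <;> cases c
      exacts [this.2, this.1.2, this.1.1.2, this.1.1.1]
  have hcond := hirota_condition r hinj hadd (fun j => Complex.exp (k j * x + p j * y
    + freq α β μ σ (k j) (p j) * z + θ₀ j))
  have hω : ∀ j, freq α β μ σ (k j) (p j) = -3 * β * μ * (P j + Q j) - σ * (P j ^ 3 + Q j ^ 3) := by
    intro j
    have h0 : κ * ((P j)⁻¹ + (Q j)⁻¹) ≠ 0 := hpPQ j ▸ hp j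
    have e : 3 * (α : ℂ) * μ * (P j + Q j) ^ 2
        = -3 * σ * (P j * Q j) * (P j + Q j) * (κ * ((P j)⁻¹ + (Q j)⁻¹)) := by
      have := hP j; have := hQ j
      field_simp
      linear_combination (P j + Q j) ^ 2 * hκ
    rw [freq, hkPQ j, hpPQ j, e, ← add_mul, ← add_mul, mul_div_assoc, div_self h0]
    ring
  have h2 := two_mul_hirota_expJet (fun S : Finset (Fin N) => Complex.exp (∑ j ∈ S, θ₀ j) *
      ∏ s ∈ S, ∏ j ∈ S.filter (fun j => s < j), expA α μ σ (k s) (p s) (k j) (p j))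
    (fun S => ∑ j ∈ S, k j) (fun S => ∑ j ∈ S, p j) (fun S => ∑ j ∈ S, freq α β μ σ (k j) (p j))
    α β μ σ x y z
  have hw : ∀ S : Finset (Fin N), (Complex.exp (∑ j ∈ S, θ₀ j) *
      ∏ s ∈ S, ∏ j ∈ S.filter (fun j => s < j), expA α μ σ (k s) (p s) (k j) (p j)) *
        Complex.exp ((∑ j ∈ S, k j) * x + (∑ j ∈ S, p j) * y
          + (∑ j ∈ S, freq α β μ σ (k j) (p j)) * z)
      = pairWeight (paramCoeff r) (fun j => Complex.exp (k j * x + p j * y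
          + freq α β μ σ (k j) (p j) * z + θ₀ j)) S := by
    intro S
    rw [mul_right_comm, exp_mul_exp_eq_prod]
    simp only [pairWeight, hexpA]
  have hmain : 2 * hirota α β μ σ (solitonJet α β μ σ k p θ₀) x y z = 0 := by
    rw [solitonJet, h2]
    -- In the parameters the dispersion polynomial is σκ(X³Y - TY - 3X²): the terms with β cancel
    -- and 3αμX² equals -3σκX².
    have : (0 : ℂ) = σ * κ * 0 := by simp
    rw [this, ← hcond, Finset.mul_sum]
    refine Finset.sum_congr rfl fun S _ => ?_
    rw [Finset.mul_sum]
    refine Finset.sum_congr rfl fun S' _ => ?_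
    rw [hw, hw]
    have dk : ∑ j ∈ S, k j - ∑ j ∈ S', k j = sumDiff r S S' := by
      simp only [sumDiff, r1, r2, hkPQ]
    have dp : ∑ j ∈ S, p j - ∑ j ∈ S', p j = κ * sumDiff (fun b => (r b)⁻¹) S S' := by
      simp only [sumDiff, r1, r2, hpPQ, mul_sub, Finset.mul_sum]
    have dω : ∑ j ∈ S, freq α β μ σ (k j) (p j) - ∑ j ∈ S', freq α β μ σ (k j) (p j)
        = -3 * β * μ * sumDiff r S S' - σ * sumDiff (fun b => r b ^ 3) S S' := by
      simp only [sumDiff, r1, r2, hω, Finset.sum_sub_distrib, ← Finset.mul_sum]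
      ring
    rw [dk, dp, dω]
    set X := sumDiff r S S'
    set T := sumDiff (fun b => r b ^ 3) S S'
    set Y := sumDiff (fun b => (r b)⁻¹) S S'
    linear_combination pairWeight (paramCoeff r) (fun j => Complex.exp (k j * x + p j * y
      + freq α β μ σ (k j) (p j) * z + θ₀ j)) S * pairWeight (paramCoeff r)
      (fun j => Complex.exp (k j * x + p j * y
      + freq α β μ σ (k j) (p j) * z + θ₀ j)) S' * 3 * X ^ 2 * hκ
  simpa using hmain

/-! ### Partial derivatives of smooth functions with parameters -/

/-- The directional derivative of `H` in the direction `v`. -/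
def dirDeriv {V : Type*} [NormedAddCommGroup V] [NormedSpace ℝ V] (v : V) (H : V → ℂ) (q : V) : ℂ :=
  fderiv ℝ H q v

section

variable {V : Type*} [NormedAddCommGroup V] [NormedSpace ℝ V]

lemma contDiff_dirDeriv (v : V) {H : V → ℂ} (hH : ContDiff ℝ ⊤ H) :
    ContDiff ℝ ⊤ (dirDeriv v H) :=
  (hH.fderiv_right (m := ⊤) (by simp)).clm_apply contDiff_const

lemma contDiff_iterate_dirDeriv (v : V) (n : ℕ) {H : V → ℂ} (hH : ContDiff ℝ ⊤ H) :
    ContDiff ℝ ⊤ ((dirDeriv v)^[n] H) := by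
  induction n with
  | zero => exact hH
  | succ n ih => rw [Function.iterate_succ_apply']; exact contDiff_dirDeriv v ih

lemma dirDeriv_comm (v w : V) {H : V → ℂ} (hH : ContDiff ℝ ⊤ H) :
    dirDeriv v (dirDeriv w H) = dirDeriv w (dirDeriv v H) := by
  have h2 : ∀ v w : V, ∀ q, dirDeriv v (dirDeriv w H) q = fderiv ℝ (fderiv ℝ H) q v w := by
    intro v w q
    have hd : DifferentiableAt ℝ (fderiv ℝ H) q :=
      ((hH.fderiv_right (m := ⊤) (by simp)).differentiable (by simp)).differentiableAt
    have := (hd.hasFDerivAt.clm_apply (hasFDerivAt_const w q)).fderiv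
    rw [dirDeriv]
    change fderiv ℝ (fun q => fderiv ℝ H q w) q v = _
    rw [this]
    simp
  funext q
  rw [h2, h2]
  exact (hH.contDiffAt.isSymmSndFDerivAt (by simp)).eq v w

lemma dirDeriv_iterate_comm (v w : V) (n : ℕ) {H : V → ℂ} (hH : ContDiff ℝ ⊤ H) :
    dirDeriv v ((dirDeriv w)^[n] H) = (dirDeriv w)^[n] (dirDeriv v H) := by
  induction n with
  | zero => rfl
  | succ n ih =>
    rw [Function.iterate_succ_apply', Function.iterate_succ_apply',
      dirDeriv_comm v w (contDiff_iterate_dirDeriv w n hH), ih]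

end

/-- The partial derivatives of `H` in its last three variables. -/
def smoothJet {E : Type*} [NormedAddCommGroup E] [NormedSpace ℝ E] (H : E × ℝ × ℝ × ℝ → ℂ)
    (π : E) (a b c : ℕ) (x y z : ℝ) : ℂ :=
  (dirDeriv (0, 1, 0, 0))^[a] ((dirDeriv (0, 0, 1, 0))^[b] ((dirDeriv (0, 0, 0, 1))^[c] H))
    (π, x, y, z)

section

variable {E : Type*} [NormedAddCommGroup E] [NormedSpace ℝ E] {H : E × ℝ × ℝ × ℝ → ℂ}

/-- Continuity is joint in the parameter and the point; it carries every partial derivative through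
the limit ε → 0. -/
lemma continuous_smoothJet (hH : ContDiff ℝ ⊤ H) (a b c : ℕ) :
    Continuous (fun q : E × ℝ × ℝ × ℝ => smoothJet H q.1 a b c q.2.1 q.2.2.1 q.2.2.2) :=
  (contDiff_iterate_dirDeriv _ a (contDiff_iterate_dirDeriv _ b
    (contDiff_iterate_dirDeriv _ c hH))).continuous

lemma isJet_smoothJet (hH : ContDiff ℝ ⊤ H) (π : E) : IsJet (smoothJet H π) where
  fst a b c x y z := by
    have hK := contDiff_iterate_dirDeriv (0, 1, 0, 0) a (contDiff_iterate_dirDeriv (0, 0, 1, 0) b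
      (contDiff_iterate_dirDeriv (0, 0, 0, 1) c hH))
    have hp : HasDerivAt (fun ξ : ℝ => ((π, ξ, y, z) : E × ℝ × ℝ × ℝ)) (0, 1, 0, 0) x :=
      (hasDerivAt_const x π).prodMk ((hasDerivAt_id x).prodMk
        ((hasDerivAt_const x y).prodMk (hasDerivAt_const x z)))
    have := ((hK.differentiable (by simp)) (π, x, y, z)).hasFDerivAt.comp_hasDerivAt x hp
    refine this.congr_deriv ?_
    rw [smoothJet, Function.iterate_succ_apply']
    rfl
  snd a b c x y z := by
    have hK := contDiff_iterate_dirDeriv (0, 1, 0, 0) a (contDiff_iterate_dirDeriv (0, 0, 1, 0) b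
      (contDiff_iterate_dirDeriv (0, 0, 0, 1) c hH))
    have hp : HasDerivAt (fun η : ℝ => ((π, x, η, z) : E × ℝ × ℝ × ℝ)) (0, 0, 1, 0) y :=
      (hasDerivAt_const y π).prodMk ((hasDerivAt_const y x).prodMk
        ((hasDerivAt_id y).prodMk (hasDerivAt_const y z)))
    have := ((hK.differentiable (by simp)) (π, x, y, z)).hasFDerivAt.comp_hasDerivAt y hp
    refine this.congr_deriv ?_
    rw [smoothJet, Function.iterate_succ_apply', ← dirDeriv_iterate_comm _ _ _
      (contDiff_iterate_dirDeriv _ b (contDiff_iterate_dirDeriv _ c hH))]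
    rfl
  trd a b c x y z := by
    have hK := contDiff_iterate_dirDeriv (0, 1, 0, 0) a (contDiff_iterate_dirDeriv (0, 0, 1, 0) b
      (contDiff_iterate_dirDeriv (0, 0, 0, 1) c hH))
    have hp : HasDerivAt (fun ζ : ℝ => ((π, x, y, ζ) : E × ℝ × ℝ × ℝ)) (0, 0, 0, 1) z :=
      (hasDerivAt_const z π).prodMk ((hasDerivAt_const z x).prodMk
        ((hasDerivAt_const z y).prodMk (hasDerivAt_id z)))
    have := ((hK.differentiable (by simp)) (π, x, y, z)).hasFDerivAt.comp_hasDerivAt z hp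
    refine this.congr_deriv ?_
    rw [smoothJet, Function.iterate_succ_apply', ← dirDeriv_iterate_comm _ _ _
      (contDiff_iterate_dirDeriv _ c hH), ← dirDeriv_iterate_comm _ _ _
      (contDiff_iterate_dirDeriv _ b (contDiff_iterate_dirDeriv _ c hH))]
    rfl

end

/-! ### Multiplication of f by a constant -/

lemma IsJet.const_mul {G : ℕ → ℕ → ℕ → ℝ → ℝ → ℝ → ℂ} (h : IsJet G) (C : ℂ) :
    IsJet (fun a b c x y z => C * G a b c x y z) where
  fst a b c x y z := (h.fst a b c x y z).const_mul C
  snd a b c x y z := (h.snd a b c x y z).const_mul C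
  trd a b c x y z := (h.trd a b c x y z).const_mul C

lemma uJet_const_mul (α μ σ : ℝ) (G : ℕ → ℕ → ℕ → ℝ → ℝ → ℝ → ℂ) {C : ℂ} (hC : C ≠ 0)
    (x y z : ℝ) :
    uJet α μ σ (fun a b c x y z => C * G a b c x y z) x y z = uJet α μ σ G x y z := by
  have : ∀ p q r s g : ℂ, (C * p * (C * q) - C * r * (C * s)) / (C * g) ^ 2
      = (p * q - r * s) / g ^ 2 := by
    intro p q r s g
    rw [← mul_div_mul_left (p * q - r * s) (g ^ 2) (pow_ne_zero 2 hC)]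
    congr 1 <;> ring
  simp only [uJet, this]

lemma vJet_const_mul (β μ σ : ℝ) (G : ℕ → ℕ → ℕ → ℝ → ℝ → ℝ → ℂ) {C : ℂ} (hC : C ≠ 0)
    (x y z : ℝ) :
    vJet β μ σ (fun a b c x y z => C * G a b c x y z) x y z = vJet β μ σ G x y z := by
  have : ∀ p q r s g : ℂ, (C * p * (C * q) - C * r * (C * s)) / (C * g) ^ 2
      = (p * q - r * s) / g ^ 2 := by
    intro p q r s g
    rw [← mul_div_mul_left (p * q - r * s) (g ^ 2) (pow_ne_zero 2 hC)]
    congr 1 <;> ring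
  simp only [vJet, this]

lemma hirota_const_mul (α β μ σ : ℝ) (G : ℕ → ℕ → ℕ → ℝ → ℝ → ℝ → ℂ) (C : ℂ)
    (x y z : ℝ) :
    hirota α β μ σ (fun a b c x y z => C * G a b c x y z) x y z
      = C ^ 2 * hirota α β μ σ G x y z := by
  simp only [hirota]; ring

/-! ### Expansion of the multi-soliton function over sets of pairs -/

/-- The increasing pairs of indices. -/
def incPairs (N : ℕ) : Finset (Fin N × Fin N) := Finset.univ.filter fun e => e.1 < e.2

/-- The indices that occur in a set of pairs. -/
def pairSupp {N : ℕ} (E : Finset (Fin N × Fin N)) : Finset (Fin N) :=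
  E.biUnion fun e => {e.1, e.2}

lemma pairSupp_subset_iff {N : ℕ} (E : Finset (Fin N × Fin N)) (S : Finset (Fin N)) :
    pairSupp E ⊆ S ↔ ∀ e ∈ E, e.1 ∈ S ∧ e.2 ∈ S := by
  simp [pairSupp, Finset.insert_subset_iff]

lemma card_pairSupp_le {N : ℕ} (E : Finset (Fin N × Fin N)) : (pairSupp E).card ≤ 2 * E.card := by
  rw [mul_comm]
  exact Finset.card_biUnion_le_card_mul _ _ _ fun e _ => Finset.card_le_two

/-- Expanding the products of 1 + c gives a sum over graphs E on the index set. For fixed E the sets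
S are those containing all endpoints, and summing over the remaining indices gives a product of
factors 1 + X. -/
lemma sum_prod_mul_prod_one_add {N : ℕ} (X : Fin N → ℂ) (c : Fin N → Fin N → ℂ) :
    ∑ S : Finset (Fin N), (∏ j ∈ S, X j) * ∏ s ∈ S, ∏ j ∈ S.filter (fun j => s < j), (1 + c s j)
      = ∑ E ∈ (incPairs N).powerset, (∏ e ∈ E, c e.1 e.2) *
          ((∏ v ∈ pairSupp E, X v) * ∏ v ∈ (pairSupp E)ᶜ, (1 + X v)) := by
  have h1 : ∀ S : Finset (Fin N), ∏ s ∈ S, ∏ j ∈ S.filter (fun j => s < j), (1 + c s j)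
      = ∑ E ∈ (incPairs N).powerset, if pairSupp E ⊆ S then ∏ e ∈ E, c e.1 e.2 else 0 := by
    intro S
    have : ∏ s ∈ S, ∏ j ∈ S.filter (fun j => s < j), (1 + c s j)
        = ∏ e ∈ (incPairs N).filter (fun e => e.1 ∈ S ∧ e.2 ∈ S), (1 + c e.1 e.2) := by
      rw [Finset.prod_sigma']
      refine Finset.prod_bij' (fun q _ => (q.1, q.2)) (fun e _ => ⟨e.1, e.2⟩) ?_ ?_ ?_ ?_ ?_ <;>
        simp +contextual [incPairs]
    rw [this, Finset.prod_one_add, ← Finset.sum_filter]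
    refine Finset.sum_congr ?_ fun _ _ => rfl
    ext E
    simp only [Finset.mem_powerset, Finset.mem_filter, pairSupp_subset_iff]
    constructor
    · intro h
      exact ⟨h.trans (Finset.filter_subset _ _), fun e he => (Finset.mem_filter.1 (h he)).2⟩
    · rintro ⟨h, h'⟩ e he
      exact Finset.mem_filter.2 ⟨h he, h' e he⟩
  simp only [h1, Finset.mul_sum]
  rw [Finset.sum_comm]
  refine Finset.sum_congr rfl fun E _ => ?_
  rw [Finset.prod_one_add, Finset.mul_sum, Finset.mul_sum]
  simp only [mul_ite, mul_zero]
  rw [← Finset.sum_filter]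
  refine Finset.sum_bij' (fun S _ => S \ pairSupp E) (fun T _ => T ∪ pairSupp E) ?_ ?_ ?_ ?_ ?_
  · intro S _
    simp only [Finset.mem_powerset]
    intro v hv
    simpa using (Finset.mem_sdiff.1 hv).2
  · intro T _
    simp
  · intro S hS
    simpa using (Finset.mem_filter.1 hS).2
  · intro T hT
    simp only [Finset.mem_powerset] at hT
    ext v
    have := @hT v
    simp only [Finset.mem_sdiff, Finset.mem_union, Finset.mem_compl] at *
    tauto
  · intro S hS
    have := (Finset.mem_filter.1 hS).2
    rw [← Finset.prod_sdiff this]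
    ring

/-! ### The normalized multi-soliton function -/

/-- `(exp w - 1) / w`, extended to `w = 0`. -/
def expQuot : ℂ → ℂ := dslope Complex.exp 0

lemma expQuot_zero : expQuot 0 = 1 := by
  simp [expQuot]

lemma mul_expQuot (w : ℂ) : w * expQuot w = Complex.exp w - 1 := by
  have := sub_smul_dslope Complex.exp 0 w
  simpa [expQuot] using this

/-- The singularity at 0 is removable, so the function is entire. -/
lemma contDiff_expQuot : ContDiff ℝ ⊤ expQuot := by
  have : Differentiable ℂ expQuot := by
    rw [← differentiableOn_univ]
    exact (Complex.differentiableOn_dslope (by simp)).2 Complex.differentiable_exp.differentiableOn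
  exact (this.contDiff (n := ⊤)).restrict_scalars ℝ

/-- The phase of a soliton with parameters `(l ε, l ε m)` divided by `l ε`. -/
def scaledTheta (α β μ σ : ℝ) (l m : ℂ) (ε x y z : ℝ) : ℂ :=
  x + m * y - (σ * l ^ 2 * ε ^ 2 + 3 * β * μ + 3 * α * μ / m) * z

/-- The contribution of a set of pairs to the normalized multi-soliton function. -/
def normTerm (α β μ σ : ℝ) {N : ℕ} (l m : Fin N → ℂ) (E : Finset (Fin N × Fin N))
    (q : (ℝ × (Fin N × Fin N → ℂ)) × ℝ × ℝ × ℝ) : ℂ :=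
  (q.1.1 : ℂ) ^ (2 * E.card - (pairSupp E).card) * (∏ e ∈ E, l e.1 * l e.2 * q.1.2 e) *
    ((∏ v ∈ pairSupp E, -(Complex.exp (l v * q.1.1 *
        scaledTheta α β μ σ (l v) (m v) q.1.1 q.2.1 q.2.2.1 q.2.2.2) * (l v)⁻¹)) *
      ∏ v ∈ (pairSupp E)ᶜ, -(scaledTheta α β μ σ (l v) (m v) q.1.1 q.2.1 q.2.2.1 q.2.2.2 *
        expQuot (l v * q.1.1 *
          scaledTheta α β μ σ (l v) (m v) q.1.1 q.2.1 q.2.2.1 q.2.2.2)))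

/-- The normalized multi-soliton function, with the interaction coefficients as parameters. -/
def normSoliton (α β μ σ : ℝ) {N : ℕ} (l m : Fin N → ℂ)
    (q : (ℝ × (Fin N × Fin N → ℂ)) × ℝ × ℝ × ℝ) : ℂ :=
  ∑ E ∈ (incPairs N).powerset, normTerm α β μ σ l m E q

lemma contDiff_normSoliton (α β μ σ : ℝ) {N : ℕ} (l m : Fin N → ℂ) :
    ContDiff ℝ ⊤ (normSoliton α β μ σ l m) := by
  have hofReal : ContDiff ℝ ⊤ (fun x : ℝ => (x : ℂ)) := Complex.ofRealCLM.contDiff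
  have hε : ContDiff ℝ ⊤ (fun q : (ℝ × (Fin N × Fin N → ℂ)) × ℝ × ℝ × ℝ => (q.1.1 : ℂ)) :=
    hofReal.comp contDiff_fst.fst
  have hx : ContDiff ℝ ⊤ (fun q : (ℝ × (Fin N × Fin N → ℂ)) × ℝ × ℝ × ℝ => (q.2.1 : ℂ)) :=
    hofReal.comp contDiff_snd.fst
  have hy : ContDiff ℝ ⊤ (fun q : (ℝ × (Fin N × Fin N → ℂ)) × ℝ × ℝ × ℝ => (q.2.2.1 : ℂ)) :=
    hofReal.comp contDiff_snd.snd.fst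
  have hz : ContDiff ℝ ⊤ (fun q : (ℝ × (Fin N × Fin N → ℂ)) × ℝ × ℝ × ℝ => (q.2.2.2 : ℂ)) :=
    hofReal.comp contDiff_snd.snd.snd
  have hθ : ∀ v, ContDiff ℝ ⊤ (fun q : (ℝ × (Fin N × Fin N → ℂ)) × ℝ × ℝ × ℝ =>
      scaledTheta α β μ σ (l v) (m v) q.1.1 q.2.1 q.2.2.1 q.2.2.2) := fun v =>
    (hx.add (contDiff_const.mul hy)).sub
      ((((contDiff_const.mul (hε.pow 2)).add contDiff_const).add contDiff_const).mul hz)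
  have hη : ∀ v, ContDiff ℝ ⊤ (fun q : (ℝ × (Fin N × Fin N → ℂ)) × ℝ × ℝ × ℝ =>
      l v * q.1.1 * scaledTheta α β μ σ (l v) (m v) q.1.1 q.2.1 q.2.2.1 q.2.2.2) := fun v =>
    (contDiff_const.mul hε).mul (hθ v)
  refine ContDiff.sum fun E _ => ?_
  refine ((hε.pow _).mul (contDiff_prod fun e _ => contDiff_const.mul ?_)).mul
    ((contDiff_prod fun v _ => ((hη v).cexp.mul contDiff_const).neg).mul
      (contDiff_prod fun v _ => ((hθ v).mul (contDiff_expQuot.comp (hη v))).neg))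
  exact (contDiff_apply ℝ ℂ e).comp contDiff_fst.snd

/-- The interaction coefficient of two solitons minus one, normalized. -/
def normCoeff (α μ σ : ℝ) {N : ℕ} (l m : Fin N → ℂ) (ε : ℝ) (e : Fin N × Fin N) : ℂ :=
  if e.1 < e.2 then -2 * σ * m e.1 * m e.2 * (m e.1 + m e.2) /
    (σ * m e.1 * m e.2 * (l e.1 + l e.2) * (l e.1 * m e.1 + l e.2 * m e.2) * ε ^ 2
      - α * μ * (m e.1 - m e.2) ^ 2) else 0

lemma expADen_scaled (α μ σ : ℝ) (l l' m m' ε : ℂ) :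
    expADen α μ σ (l * ε) (l * ε * m) (l' * ε) (l' * ε * m')
      = ε ^ 4 * (l * l') ^ 2 *
        (σ * m * m' * (l + l') * (l * m + l' * m') * ε ^ 2 - α * μ * (m - m') ^ 2) := by
  rw [expADen]; ring

lemma expA_scaled (α μ σ : ℝ) {l l' ε : ℂ} (m m' : ℂ) (hl : l ≠ 0) (hl' : l' ≠ 0) (hε : ε ≠ 0) :
    expA α μ σ (l * ε) (l * ε * m) (l' * ε) (l' * ε * m')
      = (σ * m * m' * (l - l') * (l * m - l' * m') * ε ^ 2 - α * μ * (m - m') ^ 2) /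
        (σ * m * m' * (l + l') * (l * m + l' * m') * ε ^ 2 - α * μ * (m - m') ^ 2) := by
  have h : ε ^ 4 * (l * l') ^ 2 ≠ 0 := by positivity
  rw [expA, expADen_scaled, ← mul_div_mul_left _ (_ - α * μ * (m - m') ^ 2) h]
  congr 1
  ring

lemma expA_scaled_eq_one_add (α μ σ : ℝ) {N : ℕ} (l m : Fin N → ℂ) (hl : ∀ j, l j ≠ 0) {ε : ℝ}
    (hε : ε ≠ 0) {s j : Fin N} (hsj : s < j)
    (h : expADen α μ σ (l s * ε) (l s * ε * m s) (l j * ε) (l j * ε * m j) ≠ 0) :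
    expA α μ σ (l s * ε) (l s * ε * m s) (l j * ε) (l j * ε * m j)
      = 1 + (ε : ℂ) ^ 2 * (l s * l j * normCoeff α μ σ l m ε (s, j)) := by
  have hε' : (ε : ℂ) ≠ 0 := by exact_mod_cast hε
  rw [expADen_scaled] at h
  rw [expA_scaled α μ σ _ _ (hl s) (hl j) hε', normCoeff, if_pos hsj]
  have h' := right_ne_zero_of_mul h
  have key := div_mul_cancel₀ (-2 * σ * m s * m j * (m s + m j)) h'
  rw [div_eq_iff h']
  linear_combination -((ε : ℂ) ^ 2 * l s * l j) * key

lemma prod_pow_mul_const {ι : Type*} (s : Finset ι) (c : ℂ) (g : ι → ℂ) :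
    ∏ i ∈ s, c * g i = c ^ s.card * ∏ i ∈ s, g i := by
  rw [Finset.prod_mul_distrib, Finset.prod_const]

/-- The multi-soliton function in terms of the normalized one. -/
lemma soliton_eq_normSoliton (R : ℝ → ℝ) (α β μ σ : ℝ) {N : ℕ} (l m : Fin N → ℂ)
    (hl : ∀ j, l j ≠ 0) (hm : ∀ j, m j ≠ 0) {ε : ℝ} (hε : ε ≠ 0)
    (hden : ∀ s j : Fin N, s < j →
      expADen α μ σ (l s * ε) (l s * ε * m s) (l j * ε) (l j * ε * m j) ≠ 0) (x y t : ℝ) :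
    soliton R α β μ σ (fun j => l j * (ε : ℂ)) (fun j => l j * (ε : ℂ) * m j)
        (fun _ => Complex.I * (Real.pi : ℂ)) x y t
      = ((ε : ℂ) ^ N * ∏ j, l j)
        * normSoliton α β μ σ l m ((ε, normCoeff α μ σ l m ε), x, y, R t) := by
  have hε' : (ε : ℂ) ≠ 0 := by exact_mod_cast hε
  rw [soliton_eq_prod]
  have h1 : ∀ S : Finset (Fin N), ∏ s ∈ S, ∏ j ∈ S.filter (fun j => s < j),
      expA α μ σ (l s * ε) (l s * ε * m s) (l j * ε) (l j * ε * m j)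
      = ∏ s ∈ S, ∏ j ∈ S.filter (fun j => s < j),
        (1 + (ε : ℂ) ^ 2 * (l s * l j * normCoeff α μ σ l m ε (s, j))) := by
    intro S
    refine Finset.prod_congr rfl fun s _ => Finset.prod_congr rfl fun j hj => ?_
    exact expA_scaled_eq_one_add α μ σ l m hl hε (Finset.mem_filter.1 hj).2
      (hden s j (Finset.mem_filter.1 hj).2)
  set θ : Fin N → ℂ := fun v => scaledTheta α β μ σ (l v) (m v) ε x y (R t) with hθ
  -- The phase constant iπ turns each exponential into its negative, so that `h3` can extract a
  -- factor ε from 1 - exp.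
  have h2 : ∀ j, Complex.exp (l j * ε * x + l j * ε * m j * y
      + freq α β μ σ (l j * ε) (l j * ε * m j) * R t + Complex.I * Real.pi)
      = - Complex.exp (l j * ε * θ j) := by
    intro j
    rw [Complex.exp_add, mul_comm Complex.I, Complex.exp_pi_mul_I, mul_neg_one]
    congr 2
    have := hl j; have := hm j
    simp only [freq, hθ, scaledTheta]
    field_simp
    ring
  have h3 : ∀ j, 1 + - Complex.exp (l j * ε * θ j)
      = ε * (l j * -(θ j * expQuot (l j * ε * θ j))) := by
    intro j
    linear_combination mul_expQuot (l j * ε * θ j)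
  simp only [h1, h2]
  rw [sum_prod_mul_prod_one_add, normSoliton, Finset.mul_sum]
  refine Finset.sum_congr rfl fun E _ => ?_
  simp only [h3, normTerm]
  have h4 : ∀ v, - Complex.exp (l v * ε * θ v)
      = l v * -(Complex.exp (l v * ε * θ v) * (l v)⁻¹) := by
    intro v
    have := hl v
    field_simp
  have h5 : ∏ v ∈ pairSupp E, - Complex.exp (l v * ε * θ v)
      = (∏ v ∈ pairSupp E, l v) *
        ∏ v ∈ pairSupp E, -(Complex.exp (l v * ε * θ v) * (l v)⁻¹) := by
    rw [← Finset.prod_mul_distrib]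
    exact Finset.prod_congr rfl fun v _ => h4 v
  have h6 : (ε : ℂ) ^ (2 * E.card) * (ε : ℂ) ^ ((pairSupp E)ᶜ).card
      = (ε : ℂ) ^ N * (ε : ℂ) ^ (2 * E.card - (pairSupp E).card) := by
    rw [← pow_add, ← pow_add]
    congr 1
    have := card_pairSupp_le E
    have h7 := Finset.card_add_card_compl (pairSupp E)
    rw [Fintype.card_fin] at h7
    omega
  rw [h5, prod_pow_mul_const, prod_pow_mul_const, Finset.prod_mul_distrib (s := (pairSupp E)ᶜ),
    ← pow_mul, ← Finset.prod_mul_prod_compl (pairSupp E) l]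
  linear_combination (∏ e ∈ E, l e.1 * l e.2 * normCoeff α μ σ l m ε (e.1, e.2)) *
    (∏ v ∈ pairSupp E, l v) *
    (∏ v ∈ pairSupp E, -(Complex.exp (l v * ε * θ v) * (l v)⁻¹)) *
    ((∏ v ∈ (pairSupp E)ᶜ, l v) *
      ∏ v ∈ (pairSupp E)ᶜ, -(θ v * expQuot (l v * ε * θ v))) * h6

/-! ### Matchings -/

/-- The components of a pair, indexed by `Fin 2`. -/
def pairComp {N : ℕ} (q : (Fin N × Fin N) × Fin 2) : Fin N := if q.2 = 0 then q.1.1 else q.1.2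

lemma pairSupp_eq_image {N : ℕ} (E : Finset (Fin N × Fin N)) :
    pairSupp E = (E ×ˢ (Finset.univ : Finset (Fin 2))).image pairComp := by
  ext v
  simp only [pairSupp, Finset.mem_biUnion, Finset.mem_insert, Finset.mem_singleton,
    Finset.mem_image, Finset.mem_product, Finset.mem_univ, and_true, Prod.exists, pairComp]
  constructor
  · rintro ⟨a, b, hE, h | h⟩
    · exact ⟨a, b, 0, hE, h.symm⟩
    · exact ⟨a, b, 1, hE, h.symm⟩
  · rintro ⟨a, b, c, hE, h⟩
    refine ⟨a, b, hE, ?_⟩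
    split_ifs at h
    · exact Or.inl h.symm
    · exact Or.inr h.symm

/-- The cardinality condition is the one that defines a matching: it says that no endpoint is
shared. -/
lemma pairComp_injOn {N : ℕ} {E : Finset (Fin N × Fin N)}
    (hE : (pairSupp E).card = 2 * E.card) :
    Set.InjOn pairComp
      ((E ×ˢ Finset.univ : Finset ((Fin N × Fin N) × Fin 2)) : Set ((Fin N × Fin N) × Fin 2)) := by
  rw [← Finset.card_image_iff, ← pairSupp_eq_image, hE, Finset.card_product]
  simp [mul_comm]

lemma prod_pairSupp {N : ℕ} {E : Finset (Fin N × Fin N)}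
    (hE : (pairSupp E).card = 2 * E.card) (g : Fin N → ℂ) :
    ∏ v ∈ pairSupp E, g v = ∏ e ∈ E, g e.1 * g e.2 := by
  rw [pairSupp_eq_image, Finset.prod_image (pairComp_injOn hE), Finset.prod_product]
  refine Finset.prod_congr rfl fun e _ => ?_
  rw [Fin.prod_univ_two]
  rfl

/-- The sum over the matchings of the index set. -/
def matchSum {N : ℕ} (a : Fin N → Fin N → ℂ) (θ : Fin N → ℂ) : ℂ :=
  ∑ E ∈ (incPairs N).powerset with (pairSupp E).card = 2 * E.card,
    (∏ e ∈ E, a e.1 e.2) * ∏ v ∈ (pairSupp E)ᶜ, θ v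

/-- The value of the normalized multi-soliton function at `ε = 0`. -/
lemma normSoliton_zero (α β μ σ : ℝ) {M : ℕ} (l m : Fin (2 * M) → ℂ) (hl : ∀ j, l j ≠ 0)
    (b : Fin (2 * M) × Fin (2 * M) → ℂ) (x y z : ℝ) :
    normSoliton α β μ σ l m ((0, b), x, y, z)
      = matchSum (fun i j => b (i, j))
          (fun v => x + m v * y - (3 * β * μ + 3 * α * μ / m v) * z) := by
  rw [normSoliton, matchSum, Finset.sum_filter]
  refine Finset.sum_congr rfl fun E _ => ?_
  simp only [normTerm, scaledTheta, Complex.ofReal_zero, mul_zero, zero_mul, Complex.exp_zero,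
    expQuot_zero, one_mul, mul_one]
  split_ifs with h
  · have hl' : ∏ v ∈ pairSupp E, -(l v)⁻¹ = (-1) ^ (pairSupp E).card * ∏ e ∈ E, (l e.1 * l e.2)⁻¹ := by
      rw [Finset.prod_neg, prod_pairSupp h]
      simp [mul_comm]
    have hE : (∏ e ∈ E, l e.1 * l e.2) * ∏ e ∈ E, (l e.1 * l e.2)⁻¹ = 1 := by
      rw [← Finset.prod_mul_distrib]
      exact Finset.prod_eq_one fun e _ => mul_inv_cancel₀ (mul_ne_zero (hl _) (hl _))
    -- One sign comes from each of the 2M indices, hence an even number.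
    have hs : (-1 : ℂ) ^ (pairSupp E).card * (-1) ^ ((pairSupp E)ᶜ).card = 1 := by
      rw [← pow_add, Finset.card_add_card_compl, Fintype.card_fin, pow_mul]
      simp
    rw [h, Nat.sub_self, pow_zero, one_mul, hl', Finset.prod_neg, Finset.prod_mul_distrib]
    simp only [zero_pow (two_ne_zero), mul_zero, zero_add]
    linear_combination (∏ e ∈ E, b e) * (∏ x_1 ∈ (pairSupp E)ᶜ,
      (x + m x_1 * y - (3 * β * μ + 3 * α * μ / m x_1) * z)) *
      (hs + (-1 : ℂ) ^ (pairSupp E).card * (-1) ^ ((pairSupp E)ᶜ).card * hE)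
  -- If two pairs share an endpoint, a positive power of ε remains, and it vanishes at ε = 0.
  · have hlt := card_pairSupp_le E
    rw [zero_pow (by omega)]
    simp

/-- The increasingly ordered pair of index `i` of an enumeration. -/
def ordPair {n N : ℕ} (e : (Fin n × Fin 2) ↪ Fin N) (i : Fin n) : Fin N × Fin N :=
  (min (e (i, 0)) (e (i, 1)), max (e (i, 0)) (e (i, 1)))

/-- The set of pairs of an enumeration. -/
def enumPairs {n N : ℕ} (e : (Fin n × Fin 2) ↪ Fin N) : Finset (Fin N × Fin N) :=
  Finset.univ.image (ordPair e)

section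

variable {n N : ℕ} (e : (Fin n × Fin 2) ↪ Fin N)

lemma ordPair_cases (i : Fin n) :
    (e (i, 0) < e (i, 1) ∧ ordPair e i = (e (i, 0), e (i, 1))) ∨
      (e (i, 1) < e (i, 0) ∧ ordPair e i = (e (i, 1), e (i, 0))) := by
  have hne : e (i, 0) ≠ e (i, 1) := fun h => by simpa using e.injective h
  rcases lt_or_gt_of_ne hne with h | h
  · left; simp [ordPair, h, h.le]
  · right; simp [ordPair, h, h.le]

lemma ordPair_injective : Function.Injective (ordPair e) := by
  intro i j h
  rcases ordPair_cases e i with ⟨_, hi⟩ | ⟨_, hi⟩ <;>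
  rcases ordPair_cases e j with ⟨_, hj⟩ | ⟨_, hj⟩ <;>
  · rw [hi, hj] at h
    exact (Prod.ext_iff.1 (e.injective (Prod.ext_iff.1 h).1)).1

lemma card_enumPairs : (enumPairs e).card = n := by
  rw [enumPairs, Finset.card_image_of_injective _ (ordPair_injective e)]; simp

lemma enumPairs_subset : enumPairs e ⊆ incPairs N := by
  intro q hq
  obtain ⟨i, _, rfl⟩ := Finset.mem_image.1 hq
  rcases ordPair_cases e i with ⟨h, hi⟩ | ⟨h, hi⟩ <;> simp [hi, incPairs, h]

lemma pairSupp_enumPairs : pairSupp (enumPairs e) = Finset.univ.map e := by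
  ext v
  simp only [pairSupp, enumPairs, Finset.mem_biUnion, Finset.mem_image, Finset.mem_univ, true_and,
    exists_exists_eq_and, Finset.mem_insert, Finset.mem_singleton, Finset.mem_map, Prod.exists,
    Fin.exists_fin_two]
  refine exists_congr fun i => ?_
  rcases ordPair_cases e i with ⟨_, hi⟩ | ⟨_, hi⟩ <;> rw [hi] <;> simp only [eq_comm (a := v)]
  exact or_comm

lemma prod_enumPairs (a : Fin N → Fin N → ℂ) (ha : ∀ i j, a i j = a j i) :
    ∏ q ∈ enumPairs e, a q.1 q.2 = ∏ i, a (e (i, 0)) (e (i, 1)) := by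
  rw [enumPairs, Finset.prod_image (ordPair_injective e).injOn]
  refine Finset.prod_congr rfl fun i _ => ?_
  rcases ordPair_cases e i with ⟨_, hi⟩ | ⟨_, hi⟩ <;> rw [hi]
  exact ha _ _

end

/-- A matching with `n` pairs has `n! 2ⁿ` enumerations. -/
lemma card_enumPairs_fiber {n N : ℕ} {E : Finset (Fin N × Fin N)} (hE : E ⊆ incPairs N)
    (hn : E.card = n) (hs : (pairSupp E).card = 2 * E.card) :
    (Finset.univ.filter fun e : (Fin n × Fin 2) ↪ Fin N => enumPairs e = E).card
      = n.factorial * 2 ^ n := by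
  have hmem : ∀ e : {e : (Fin n × Fin 2) ↪ Fin N // enumPairs e = E}, ∀ i, ordPair e.1 i ∈ E := by
    rintro ⟨e, rfl⟩ i
    exact Finset.mem_image_of_mem _ (Finset.mem_univ i)
  -- An enumeration amounts to a numbering of the n pairs (n! choices, as E has n elements) and an
  -- orientation of each pair (2ⁿ choices).
  let Φ : {e : (Fin n × Fin 2) ↪ Fin N // enumPairs e = E} → (Fin n ↪ E) × (Fin n → Bool) :=
    fun e => (⟨fun i => ⟨ordPair e.1 i, hmem e i⟩, fun i j h =>
      ordPair_injective e.1 (congrArg Subtype.val h)⟩, fun i => decide (e.1 (i, 0) < e.1 (i, 1)))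
  have hinj : Function.Injective Φ := by
    rintro ⟨e, he⟩ ⟨e', he'⟩ h
    have h1 : ∀ i, ordPair e i = ordPair e' i := fun i => by
      have := DFunLike.congr_fun (congrArg Prod.fst h) i
      exact congrArg Subtype.val this
    have h2 : ∀ i, (e (i, 0) < e (i, 1)) ↔ (e' (i, 0) < e' (i, 1)) := fun i => by
      have := congrFun (congrArg Prod.snd h) i
      simpa [Φ] using this
    apply Subtype.ext
    refine DFunLike.ext _ _ ?_
    have h3 : ∀ i, e (i, 0) = e' (i, 0) ∧ e (i, 1) = e' (i, 1) := by
      intro i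
      have h1 := h1 i
      have h2 := h2 i
      rcases ordPair_cases e i with ⟨hi, hi'⟩ | ⟨hi, hi'⟩ <;>
      rcases ordPair_cases e' i with ⟨hj, hj'⟩ | ⟨hj, hj'⟩ <;>
      rw [hi', hj', Prod.mk.injEq] at h1
      · exact h1
      · exact absurd (h2.1 hi) hj.not_gt
      · exact absurd (h2.2 hj) hi.not_gt
      · exact ⟨h1.2, h1.1⟩
    rintro ⟨i, c⟩
    fin_cases c
    · exact (h3 i).1
    · exact (h3 i).2
  have hsurj : Function.Surjective Φ := by
    rintro ⟨g, s⟩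
    have hinc : ∀ i, (g i).1.1 < (g i).1.2 := fun i => by
      have := hE (g i).2
      simpa [incPairs] using this
    -- In `Fin 2` the map q ↦ 1 - q exchanges the two components; it is applied to the pairs of
    -- reversed orientation.
    let c : Fin n × Fin 2 → (Fin N × Fin N) × Fin 2 := fun q => ((g q.1).1, if s q.1 then q.2 else 1 - q.2)
    have hc : Function.Injective c := by
      rintro ⟨i, p⟩ ⟨j, q⟩ h
      obtain ⟨h1, h2⟩ := Prod.ext_iff.1 h
      have hij : i = j := g.injective (Subtype.ext h1)
      subst hij
      simp only [c] at h2
      split_ifs at h2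
      · rw [h2]
      · rw [sub_right_inj.1 h2]
    let e : (Fin n × Fin 2) ↪ Fin N := ⟨fun q => pairComp (c q), fun p q h =>
      hc (pairComp_injOn hs (by simp [c]) (by simp [c]) h)⟩
    have he : ∀ i, (s i = true → e (i, 0) = (g i).1.1 ∧ e (i, 1) = (g i).1.2) ∧
        (s i = false → e (i, 0) = (g i).1.2 ∧ e (i, 1) = (g i).1.1) := by
      intro i
      constructor <;> intro hi <;> simp [e, c, pairComp, hi]
    have hord : ∀ i, ordPair e i = (g i).1 := by
      intro i
      have hi := hinc i
      rw [ordPair]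
      cases h : s i
      · rw [((he i).2 h).1, ((he i).2 h).2, min_eq_right hi.le, max_eq_left hi.le]
      · rw [((he i).1 h).1, ((he i).1 h).2, min_eq_left hi.le, max_eq_right hi.le]
    have heE : enumPairs e = E := by
      refine Finset.eq_of_subset_of_card_le ?_ (by rw [card_enumPairs, hn])
      intro q hq
      obtain ⟨i, _, rfl⟩ := Finset.mem_image.1 hq
      rw [hord]; exact (g i).2
    refine ⟨⟨e, heE⟩, Prod.ext ?_ ?_⟩
    · exact DFunLike.ext _ _ fun i => Subtype.ext (hord i)
    · funext i
      change decide (e (i, 0) < e (i, 1)) = s i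
      have hi := hinc i
      cases h : s i
      · rw [((he i).2 h).1, ((he i).2 h).2]; simp [hi.le]
      · rw [((he i).1 h).1, ((he i).1 h).2]; simp [hi]
  rw [← Fintype.card_subtype, Fintype.card_of_bijective ⟨hinj, hsurj⟩, Fintype.card_prod,
    Fintype.card_embedding_eq]
  simp [hn, Nat.descFactorial_self]

/-- A summand depends only on the matching that its tuple enumerates, so the prefactor 1/(n! 2ⁿ)
exactly compensates the number of enumerations. -/
lemma sum_enum {n N : ℕ} (a : Fin N → Fin N → ℂ) (ha : ∀ i j, a i j = a j i) (θ : Fin N → ℂ) :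
    ∑ e : (Fin n × Fin 2) ↪ Fin N, (∏ i : Fin n, a (e (i, 0)) (e (i, 1))) *
        ∏ v ∈ (Finset.univ.map e)ᶜ, θ v
      = (n.factorial * 2 ^ n : ℂ) *
        ∑ E ∈ ((incPairs N).powerset.filter (fun E => (pairSupp E).card = 2 * E.card)).filter
          (fun E => E.card = n), (∏ e ∈ E, a e.1 e.2) * ∏ v ∈ (pairSupp E)ᶜ, θ v := by
  rw [Finset.mul_sum, ← Finset.sum_fiberwise_of_maps_to (g := enumPairs)
    (t := ((incPairs N).powerset.filter (fun E => (pairSupp E).card = 2 * E.card)).filter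
          (fun E => E.card = n))]
  · refine Finset.sum_congr rfl fun E hE => ?_
    simp only [Finset.mem_filter, Finset.mem_powerset] at hE
    have := card_enumPairs_fiber hE.1.1 hE.2 hE.1.2
    have hcast : (n.factorial * 2 ^ n : ℂ) = ((n.factorial * 2 ^ n : ℕ) : ℂ) := by push_cast; rfl
    rw [hcast, ← this, ← nsmul_eq_mul]
    refine Finset.sum_eq_card_nsmul fun e he => ?_
    rw [← prod_enumPairs e a ha, ← pairSupp_enumPairs, (Finset.mem_filter.1 he).2]
  · intro e _
    simp only [Finset.mem_filter, Finset.mem_powerset]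
    refine ⟨⟨enumPairs_subset e, ?_⟩, card_enumPairs e⟩
    rw [pairSupp_enumPairs, card_enumPairs]
    simp [mul_comm]

lemma lumpCoeff_comm (α μ σ : ℝ) (p p' : ℂ) : lumpCoeff α μ σ p p' = lumpCoeff α μ σ p' p := by
  rw [lumpCoeff, lumpCoeff]
  congr 1 <;> ring

/-- The lump function is a sum over matchings. -/
lemma lump_eq_matchSum (R : ℝ → ℝ) (α β μ σ : ℝ) {M : ℕ} (m : Fin (2 * M) → ℂ) (x y t : ℝ) :
    lump R α β μ σ m x y t = matchSum (fun i j => lumpCoeff α μ σ (m i) (m j))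
      (fun v => lumpTheta R α β μ (m v) x y t) := by
  rw [lump, matchSum, ← Finset.sum_fiberwise_of_maps_to (g := Finset.card)
    (t := Finset.range (M + 1))]
  · refine Finset.sum_congr rfl fun n _ => ?_
    rw [sum_enum (fun i j => lumpCoeff α μ σ (m i) (m j)) (fun i j => lumpCoeff_comm _ _ _ _ _)
      (fun v => lumpTheta R α β μ (m v) x y t), ← mul_assoc, one_div_mul_cancel, one_mul]
    exact mul_ne_zero (by exact_mod_cast n.factorial_ne_zero) (by simp)
  · intro E hE
    have h1 := (Finset.mem_filter.1 hE).2
    have h2 := Finset.card_le_univ (pairSupp E)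
    rw [Fintype.card_fin] at h2
    rw [Finset.mem_range]
    omega

/-! ### The lump polynomial -/

/-- The polynomial of `lumpTheta`. -/
def thetaPoly (α β μ : ℝ) (p : ℂ) : MvPolynomial (Fin 3) ℂ :=
  MvPolynomial.X 0 + MvPolynomial.C p * MvPolynomial.X 1
    - MvPolynomial.C (3 * μ * ((β * p + α) / p)) * MvPolynomial.X 2

/-- The part of the lump polynomial that belongs to the matchings with `n` pairs. -/
def lumpPart (α β μ σ : ℝ) {N : ℕ} (p : Fin N → ℂ) (n : ℕ) : MvPolynomial (Fin 3) ℂ :=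
  MvPolynomial.C (1 / ((n.factorial : ℂ) * 2 ^ n)) *
    ∑ e : (Fin n × Fin 2) ↪ Fin N,
      MvPolynomial.C (∏ i : Fin n, lumpCoeff α μ σ (p (e (i, 0))) (p (e (i, 1)))) *
        ∏ l ∈ (Finset.univ.map e)ᶜ, thetaPoly α β μ (p l)

/-- The polynomial of `lump`. -/
def lumpPoly (α β μ σ : ℝ) {M : ℕ} (p : Fin (2 * M) → ℂ) : MvPolynomial (Fin 3) ℂ :=
  ∑ n ∈ Finset.range (M + 1), lumpPart α β μ σ p n

lemma eval_thetaPoly (R : ℝ → ℝ) (α β μ : ℝ) (p : ℂ) (x y t : ℝ) :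
    MvPolynomial.eval ![(x : ℂ), (y : ℂ), (R t : ℂ)] (thetaPoly α β μ p)
      = lumpTheta R α β μ p x y t := by
  simp [thetaPoly, lumpTheta]
  ring

lemma eval_lumpPoly (R : ℝ → ℝ) (α β μ σ : ℝ) {M : ℕ} (p : Fin (2 * M) → ℂ) (x y t : ℝ) :
    MvPolynomial.eval ![(x : ℂ), (y : ℂ), (R t : ℂ)] (lumpPoly α β μ σ p)
      = lump R α β μ σ p x y t := by
  simp only [lumpPoly, lumpPart, lump, map_sum, map_mul, map_prod, MvPolynomial.eval_C,
    eval_thetaPoly]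

lemma isHomogeneous_thetaPoly (α β μ : ℝ) (p : ℂ) : (thetaPoly α β μ p).IsHomogeneous 1 := by
  refine ((MvPolynomial.isHomogeneous_X _ _).add ?_).sub ?_
  · simpa using (MvPolynomial.isHomogeneous_C (Fin 3) p).mul (MvPolynomial.isHomogeneous_X ℂ 1)
  · simpa using (MvPolynomial.isHomogeneous_C (Fin 3) (3 * μ * ((β * p + α) / p) : ℂ)).mul
      (MvPolynomial.isHomogeneous_X ℂ 2)

lemma isHomogeneous_prod_thetaPoly (α β μ : ℝ) {N : ℕ} (p : Fin N → ℂ) (s : Finset (Fin N)) :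
    (∏ l ∈ s, thetaPoly α β μ (p l)).IsHomogeneous s.card := by
  have := MvPolynomial.IsHomogeneous.prod s (fun l => thetaPoly α β μ (p l)) (fun _ => 1)
    (fun l _ => isHomogeneous_thetaPoly α β μ (p l))
  simpa using this

lemma isHomogeneous_lumpPart (α β μ σ : ℝ) {N : ℕ} (p : Fin N → ℂ) (n : ℕ) :
    (lumpPart α β μ σ p n).IsHomogeneous (N - 2 * n) := by
  refine MvPolynomial.IsHomogeneous.C_mul (MvPolynomial.IsHomogeneous.sum _ _ _ fun e _ =>
    MvPolynomial.IsHomogeneous.C_mul ?_ _) _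
  have h := isHomogeneous_prod_thetaPoly α β μ p (Finset.univ.map e)ᶜ
  rwa [Finset.card_compl, Finset.card_map, Finset.card_univ, Fintype.card_prod, Fintype.card_fin,
    Fintype.card_fin, Fintype.card_fin, mul_comm n] at h

lemma lumpPart_zero (α β μ σ : ℝ) {N : ℕ} (p : Fin N → ℂ) :
    lumpPart α β μ σ p 0 = ∏ l, thetaPoly α β μ (p l) := by
  have hu : (Finset.univ : Finset ((Fin 0 × Fin 2) ↪ Fin N)) = {Function.Embedding.ofIsEmpty} := by
    ext e
    simp only [Finset.mem_univ, Finset.mem_singleton, true_iff]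
    exact DFunLike.ext _ _ fun q => q.1.elim0
  rw [lumpPart, hu, Finset.sum_singleton]
  simp

lemma thetaPoly_ne_zero (α β μ : ℝ) (p : ℂ) : thetaPoly α β μ p ≠ 0 := by
  intro h
  have := congrArg (MvPolynomial.eval ![1, 0, 0]) h
  simp [thetaPoly] at this

/-- All monomials of `Q` have total degree less than `N`. -/
def DegLT (N : ℕ) (Q : MvPolynomial (Fin 3) ℂ) : Prop :=
  ∀ s ∈ Q.support, (s.sum fun _ e => e) < N

lemma DegLT.of_isHomogeneous {N n : ℕ} {Q : MvPolynomial (Fin 3) ℂ} (h : Q.IsHomogeneous n)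
    (hn : n < N) : DegLT N Q := fun _ hs =>
  (MvPolynomial.le_totalDegree hs).trans_lt (h.totalDegree_le.trans_lt hn)

lemma DegLT.sum {ι : Type*} {N : ℕ} (t : Finset ι) (Q : ι → MvPolynomial (Fin 3) ℂ)
    (h : ∀ i ∈ t, DegLT N (Q i)) : DegLT N (∑ i ∈ t, Q i) := by
  classical
  intro s hs
  obtain ⟨i, hi, his⟩ := Finset.mem_biUnion.1 (MvPolynomial.support_sum hs)
  exact h i hi s his

lemma DegLT.pderiv {N : ℕ} {Q : MvPolynomial (Fin 3) ℂ} (h : Q.totalDegree ≤ N) (i : Fin 3) :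
    DegLT N (MvPolynomial.pderiv i Q) := by
  intro s hs
  rw [MvPolynomial.mem_support_iff, MvPolynomial.coeff_pderiv] at hs
  have h1 : s + Finsupp.single i 1 ∈ Q.support :=
    MvPolynomial.mem_support_iff.2 (left_ne_zero_of_mul hs)
  have h2 := (MvPolynomial.le_totalDegree h1).trans h
  rw [Finsupp.sum_add_index' (by simp) (by simp)] at h2
  simp at h2
  omega

lemma DegLT.totalDegree_le {N : ℕ} {Q : MvPolynomial (Fin 3) ℂ} (h : DegLT N Q) :
    Q.totalDegree ≤ N :=
  Finset.sup_le fun s hs => (h s hs).le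

/-- The empty matching contributes the product of all linear forms; each pair of a matching lowers
the degree by two. -/
lemma lumpPoly_eq (α β μ σ : ℝ) {M : ℕ} (p : Fin (2 * M) → ℂ) :
    ∃ Q, DegLT (2 * M) Q ∧ lumpPoly α β μ σ p = (∏ l, thetaPoly α β μ (p l)) + Q := by
  refine ⟨∑ n ∈ Finset.range M, lumpPart α β μ σ p (n + 1), ?_, ?_⟩
  · refine DegLT.sum _ _ fun n hn => ?_
    have := Finset.mem_range.1 hn
    exact DegLT.of_isHomogeneous (isHomogeneous_lumpPart α β μ σ p (n + 1)) (by omega)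
  · rw [lumpPoly, Finset.sum_range_succ', lumpPart_zero, add_comm]

lemma totalDegree_lumpPoly (α β μ σ : ℝ) {M : ℕ} (p : Fin (2 * M) → ℂ) :
    (lumpPoly α β μ σ p).totalDegree = 2 * M := by
  obtain ⟨Q, hQ, h⟩ := lumpPoly_eq α β μ σ p
  have h0 : (∏ l, thetaPoly α β μ (p l)).totalDegree = 2 * M := by
    have := (isHomogeneous_prod_thetaPoly α β μ p Finset.univ).totalDegree
      (Finset.prod_ne_zero_iff.2 fun l _ => thetaPoly_ne_zero α β μ (p l))
    simpa using this
  rw [h]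
  -- For M = 0 the remainder has the same total degree 0 as the leading part, so the comparison of
  -- degrees fails; `DegLT 0` instead forces the remainder to be zero.
  rcases Nat.eq_zero_or_pos M with hM | hM
  · have : Q = 0 := by
      rw [← MvPolynomial.support_eq_empty, Finset.eq_empty_iff_forall_notMem]
      intro s hs
      have := hQ s hs
      omega
    rw [this, add_zero, h0]
  · rw [MvPolynomial.totalDegree_add_eq_left_of_totalDegree_lt, h0]
    rw [h0]
    exact (Finset.sup_lt_iff (by simpa using hM)).2 hQ

/-! ### Reality -/

/-- The permutation exchanges n and n + M. Being free of fixed points, it also shows, by injectivity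
of m, that no m_i is real. -/
lemma exists_conj_perm {M : ℕ} (m : Fin (2 * M) → ℂ) (hminj : Function.Injective m)
    (hconj : ∀ i j : Fin (2 * M), (j : ℕ) = (i : ℕ) + M → m j = (starRingEnd ℂ) (m i)) :
    ∃ τ : Equiv.Perm (Fin (2 * M)), ∀ i, m (τ i) = (starRingEnd ℂ) (m i) ∧ τ i ≠ i := by
  have h : ∀ i, ∃ j, m j = (starRingEnd ℂ) (m i) ∧ j ≠ i := by
    intro i
    have hi := i.2
    by_cases h : (i : ℕ) < M
    · exact ⟨⟨i + M, by omega⟩, hconj i _ rfl, fun h' => by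
        have := congrArg Fin.val h'; simp only at this; omega⟩
    · refine ⟨⟨i - M, by omega⟩, ?_, fun h' => by
        have := congrArg Fin.val h'; simp only at this; omega⟩
      rw [hconj ⟨i - M, by omega⟩ i (by simp only; omega), Complex.conj_conj]
  choose τ hτ using h
  have hinj : Function.Injective τ := by
    intro i j hij
    apply hminj
    apply (starRingEnd ℂ).injective
    rw [← (hτ i).1, ← (hτ j).1, hij]
  exact ⟨Equiv.ofBijective τ (Finite.injective_iff_bijective.1 hinj), hτ⟩

lemma map_conj_thetaPoly (α β μ : ℝ) (p : ℂ) :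
    MvPolynomial.map (starRingEnd ℂ) (thetaPoly α β μ p)
      = thetaPoly α β μ ((starRingEnd ℂ) p) := by
  simp [thetaPoly, Complex.conj_ofNat]

lemma conj_lumpCoeff (α μ σ : ℝ) (p p' : ℂ) :
    (starRingEnd ℂ) (lumpCoeff α μ σ p p')
      = lumpCoeff α μ σ ((starRingEnd ℂ) p) ((starRingEnd ℂ) p') := by
  simp [lumpCoeff, Complex.conj_ofNat]

/-- Conjugation replaces every m_i by m_{τ i}, which is undone by reindexing the enumerations along
τ. -/
lemma map_conj_lumpPart (α β μ σ : ℝ) {N : ℕ} (m : Fin N → ℂ) (τ : Equiv.Perm (Fin N))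
    (hτ : ∀ i, m (τ i) = (starRingEnd ℂ) (m i)) (n : ℕ) :
    MvPolynomial.map (starRingEnd ℂ) (lumpPart α β μ σ m n) = lumpPart α β μ σ m n := by
  simp only [lumpPart, map_mul, map_sum, map_prod, MvPolynomial.map_C, map_conj_thetaPoly,
    conj_lumpCoeff, ← hτ]
  refine congrArg₂ (· * ·) ?_ ?_
  · simp [Complex.conj_ofNat]
  · refine Fintype.sum_equiv (Equiv.embeddingCongr (Equiv.refl _) τ) _ _ fun e => ?_
    have he : ∀ q, (Equiv.embeddingCongr (Equiv.refl (Fin n × Fin 2)) τ) e q = τ (e q) :=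
      fun q => rfl
    simp only [he]
    refine congrArg₂ (· * ·) rfl ?_
    refine Finset.prod_bij (fun i _ => τ i) ?_ ?_ ?_ ?_
    · intro i hi
      simpa [he] using hi
    · intro i _ j _ h
      exact τ.injective h
    · intro j hj
      refine ⟨τ.symm j, ?_, by simp⟩
      simp only [Finset.mem_compl, Finset.mem_map, Finset.mem_univ, true_and, not_exists, he] at hj ⊢
      intro q hq
      exact hj q (by rw [hq]; simp)
    · intro i _
      rfl

lemma exists_real_lumpPoly (α β μ σ : ℝ) {M : ℕ} (m : Fin (2 * M) → ℂ)
    (τ : Equiv.Perm (Fin (2 * M))) (hτ : ∀ i, m (τ i) = (starRingEnd ℂ) (m i)) :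
    ∃ P : MvPolynomial (Fin 3) ℝ, MvPolynomial.map Complex.ofRealHom P = lumpPoly α β μ σ m ∧
      P.totalDegree = 2 * M := by
  have hreal : MvPolynomial.map (starRingEnd ℂ) (lumpPoly α β μ σ m) = lumpPoly α β μ σ m := by
    simp only [lumpPoly, map_sum, map_conj_lumpPart α β μ σ m τ hτ]
  have hmem : lumpPoly α β μ σ m ∈ Set.range (MvPolynomial.map (σ := Fin 3) Complex.ofRealHom) := by
    rw [MvPolynomial.mem_range_map_iff_coeffs_subset]
    intro c hc
    obtain ⟨s, _, rfl⟩ := MvPolynomial.mem_coeffs_iff.1 hc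
    refine Complex.conj_eq_iff_real.1 ?_ |>.imp fun r hr => hr.symm
    rw [← MvPolynomial.coeff_map, hreal]
  obtain ⟨P, hP⟩ := hmem
  refine ⟨P, hP, ?_⟩
  rw [← totalDegree_lumpPoly α β μ σ m, ← hP, MvPolynomial.totalDegree, MvPolynomial.totalDegree,
    MvPolynomial.support_map_of_injective _ Complex.ofRealHom.injective]

lemma eval_map_ofReal (P : MvPolynomial (Fin 3) ℝ) (x y z : ℝ) :
    MvPolynomial.eval ![(x : ℂ), (y : ℂ), (z : ℂ)] (MvPolynomial.map Complex.ofRealHom P)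
      = ((MvPolynomial.eval ![x, y, z] P : ℝ) : ℂ) := by
  rw [MvPolynomial.eval_map]
  have : (![(x : ℂ), (y : ℂ), (z : ℂ)] : Fin 3 → ℂ) = Complex.ofRealHom ∘ ![x, y, z] := by
    funext i; fin_cases i <;> rfl
  rw [this, ← MvPolynomial.eval₂_comp]
  rfl

/-! ### Derivatives of polynomials -/

lemma pderiv_comm_apply (i j : Fin 3) (Q : MvPolynomial (Fin 3) ℂ) :
    MvPolynomial.pderiv i (MvPolynomial.pderiv j Q)
      = MvPolynomial.pderiv j (MvPolynomial.pderiv i Q) := by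
  by_cases hij : i = j
  · rw [hij]
  ext s
  simp only [MvPolynomial.coeff_pderiv, Finsupp.add_apply, Finsupp.single_apply, if_neg hij,
    if_neg (Ne.symm hij), add_right_comm s (Finsupp.single i 1)]
  push_cast
  ring

lemma hasDerivAt_eval (Q : MvPolynomial (Fin 3) ℂ) (i : Fin 3) (w : Fin 3 → ℝ → ℂ) (x : ℝ)
    (hw : ∀ j, HasDerivAt (w j) (if j = i then 1 else 0) x) :
    HasDerivAt (fun ξ => MvPolynomial.eval (fun j => w j ξ) Q)
      (MvPolynomial.eval (fun j => w j x) (MvPolynomial.pderiv i Q)) x := by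
  induction Q using MvPolynomial.induction_on with
  | C a => simpa using hasDerivAt_const x a
  | add p q hp hq =>
    simp only [map_add]
    exact hp.add hq
  | mul_X p j hp =>
    have := hp.mul (hw j)
    simp only [map_mul, MvPolynomial.eval_X, MvPolynomial.pderiv_mul, map_add,
      MvPolynomial.pderiv_X]
    refine this.congr_deriv ?_
    by_cases h : j = i <;> simp [h]

/-- The partial derivatives of a polynomial function. -/
def polyJet (Q : MvPolynomial (Fin 3) ℂ) (a b c : ℕ) (x y z : ℝ) : ℂ :=
  MvPolynomial.eval ![(x : ℂ), (y : ℂ), (z : ℂ)]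
    ((MvPolynomial.pderiv 0)^[a] ((MvPolynomial.pderiv 1)^[b] ((MvPolynomial.pderiv 2)^[c] Q)))

lemma pderiv_iterate_comm (i j : Fin 3) (n : ℕ) (Q : MvPolynomial (Fin 3) ℂ) :
    MvPolynomial.pderiv i ((MvPolynomial.pderiv j)^[n] Q)
      = (MvPolynomial.pderiv j)^[n] (MvPolynomial.pderiv i Q) := by
  induction n generalizing Q with
  | zero => rfl
  | succ n ih => rw [Function.iterate_succ_apply, Function.iterate_succ_apply, ih,
      pderiv_comm_apply]

lemma isJet_polyJet (Q : MvPolynomial (Fin 3) ℂ) : IsJet (polyJet Q) where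
  fst a b c x y z := by
    have h := hasDerivAt_eval ((MvPolynomial.pderiv 0)^[a] ((MvPolynomial.pderiv 1)^[b]
      ((MvPolynomial.pderiv 2)^[c] Q))) 0 (fun j ξ => ![(ξ : ℂ), (y : ℂ), (z : ℂ)] j) x (by
        intro j
        fin_cases j
        · exact (Complex.ofRealCLM.hasDerivAt (x := x)).congr_deriv (by simp)
        · simpa using hasDerivAt_const x (y : ℂ)
        · simpa using hasDerivAt_const x (z : ℂ))
    rw [polyJet, Function.iterate_succ_apply']
    exact h
  snd a b c x y z := by
    have h := hasDerivAt_eval ((MvPolynomial.pderiv 0)^[a] ((MvPolynomial.pderiv 1)^[b]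
      ((MvPolynomial.pderiv 2)^[c] Q))) 1 (fun j η => ![(x : ℂ), (η : ℂ), (z : ℂ)] j) y (by
        intro j
        fin_cases j
        · simpa using hasDerivAt_const y (x : ℂ)
        · exact (Complex.ofRealCLM.hasDerivAt (x := y)).congr_deriv (by simp)
        · simpa using hasDerivAt_const y (z : ℂ))
    rw [polyJet, Function.iterate_succ_apply', ← pderiv_iterate_comm]
    exact h
  trd a b c x y z := by
    have h := hasDerivAt_eval ((MvPolynomial.pderiv 0)^[a] ((MvPolynomial.pderiv 1)^[b]
      ((MvPolynomial.pderiv 2)^[c] Q))) 2 (fun j ζ => ![(x : ℂ), (y : ℂ), (ζ : ℂ)] j) z (by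
        intro j
        fin_cases j
        · simpa using hasDerivAt_const z (x : ℂ)
        · simpa using hasDerivAt_const z (y : ℂ)
        · exact (Complex.ofRealCLM.hasDerivAt (x := z)).congr_deriv (by simp))
    rw [polyJet, Function.iterate_succ_apply', ← pderiv_iterate_comm, ← pderiv_iterate_comm]
    exact h

/-! ### Behaviour at infinity in the plane -/

lemma norm_isLittleO_const (c : ℂ) :
    (fun _ : ℝ × ℝ => c) =o[cocompact (ℝ × ℝ)] (fun q : ℝ × ℝ => ‖q‖) := by
  rw [Asymptotics.isLittleO_const_left]
  right
  simpa [Function.comp_def] using tendsto_norm_cocompact_atTop (E := ℝ × ℝ)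

/-- With z fixed, a monomial grows at most like the norm to its degree in the first two variables,
which is below N. -/
lemma DegLT.isLittleO {N : ℕ} {Q : MvPolynomial (Fin 3) ℂ} (h : DegLT N Q) (z : ℝ) :
    (fun q : ℝ × ℝ => MvPolynomial.eval ![(q.1 : ℂ), (q.2 : ℂ), (z : ℂ)] Q)
      =o[cocompact (ℝ × ℝ)] (fun q : ℝ × ℝ => ‖q‖ ^ N) := by
  simp only [MvPolynomial.eval_eq']
  suffices hs : ∀ s ∈ Q.support,
      (fun q : ℝ × ℝ => Q.coeff s * ∏ i : Fin 3, ![(q.1 : ℂ), (q.2 : ℂ), (z : ℂ)] i ^ s i)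
        =o[cocompact (ℝ × ℝ)] (fun q : ℝ × ℝ => ‖q‖ ^ N) from Asymptotics.IsLittleO.fun_sum hs
  intro s hs
  have hlt := h s hs
  rw [Finsupp.sum_fintype _ _ (by simp)] at hlt
  simp only [Fin.sum_univ_three] at hlt
  have h1 : (fun q : ℝ × ℝ => Q.coeff s * ∏ i : Fin 3, ![(q.1 : ℂ), (q.2 : ℂ), (z : ℂ)] i ^ s i)
      =O[cocompact (ℝ × ℝ)] (fun q : ℝ × ℝ => ‖q‖ ^ (s 0 + s 1)) := by
    refine Asymptotics.IsBigO.of_bound (‖Q.coeff s‖ * |z| ^ s 2) (Eventually.of_forall fun q => ?_)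
    simp only [Fin.prod_univ_three, norm_mul, norm_pow, Matrix.cons_val_zero, Matrix.cons_val_one,
      Matrix.cons_val, Complex.norm_real, Real.norm_eq_abs, abs_norm, pow_add]
    have h1 : |q.1| ^ s 0 ≤ ‖q‖ ^ s 0 := pow_le_pow_left₀ (abs_nonneg _) (norm_fst_le q) _
    have h2 : |q.2| ^ s 1 ≤ ‖q‖ ^ s 1 := pow_le_pow_left₀ (abs_nonneg _) (norm_snd_le q) _
    calc ‖Q.coeff s‖ * (|q.1| ^ s 0 * |q.2| ^ s 1 * |z| ^ s 2)
        ≤ ‖Q.coeff s‖ * (‖q‖ ^ s 0 * ‖q‖ ^ s 1 * |z| ^ s 2) := by gcongr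
      _ = _ := by ring
  refine h1.trans_isLittleO ?_
  exact (Asymptotics.isLittleO_pow_pow_atTop_of_lt (𝕜 := ℝ) (by omega)).comp_tendsto
    (tendsto_norm_cocompact_atTop (E := ℝ × ℝ))

/-- For nonreal p the map (x, y) ↦ x + py is a real linear isomorphism onto ℂ: its imaginary part
controls y, and then x is controlled as well. The term in z is constant. -/
lemma norm_isBigO_thetaPoly (α β μ : ℝ) {p : ℂ} (hp : p.im ≠ 0) (z : ℝ) :
    (fun q : ℝ × ℝ => ‖q‖) =O[cocompact (ℝ × ℝ)]
      (fun q : ℝ × ℝ => MvPolynomial.eval ![(q.1 : ℂ), (q.2 : ℂ), (z : ℂ)] (thetaPoly α β μ p)) := by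
  have h1 : (fun q : ℝ × ℝ => ‖q‖) =O[cocompact (ℝ × ℝ)]
      (fun q : ℝ × ℝ => (q.1 + p * q.2 : ℂ)) := by
    refine Asymptotics.IsBigO.of_bound (1 + (1 + ‖p‖) / |p.im|) (Eventually.of_forall fun q => ?_)
    have hpos : 0 < |p.im| := abs_pos.2 hp
    have h2 : |q.2| ≤ ‖(q.1 + p * q.2 : ℂ)‖ / |p.im| := by
      rw [le_div_iff₀ hpos, ← abs_mul]
      have := Complex.abs_im_le_norm (q.1 + p * q.2 : ℂ)
      simpa [mul_comm] using this
    have h3 : |q.1| ≤ ‖(q.1 + p * q.2 : ℂ)‖ + ‖p‖ * |q.2| := by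
      have := norm_sub_le (q.1 + p * q.2 : ℂ) (p * q.2)
      simpa using this
    rw [norm_norm, Prod.norm_def, Real.norm_eq_abs, Real.norm_eq_abs]
    set n := ‖(q.1 + p * q.2 : ℂ)‖
    have hn : 0 ≤ n := norm_nonneg _
    have e : (1 + (1 + ‖p‖) / |p.im|) * n = n + n / |p.im| + ‖p‖ * (n / |p.im|) := by ring
    have h4 : 0 ≤ n / |p.im| := by positivity
    have h5 : ‖p‖ * |q.2| ≤ ‖p‖ * (n / |p.im|) := by gcongr
    have h6 : 0 ≤ ‖p‖ * (n / |p.im|) := by positivity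
    rw [e]
    exact max_le (by linarith) (by linarith)
  have h2 := (norm_isLittleO_const (-(3 * μ * ((β * p + α) / p)) * z)).trans_isBigO h1
  have h3 := h1.trans h2.right_isBigO_add
  refine h3.congr_right fun q => ?_
  simp [thetaPoly]
  ring

lemma norm_pow_isBigO_lumpPoly (α β μ σ : ℝ) {M : ℕ} (m : Fin (2 * M) → ℂ)
    (hm : ∀ i, (m i).im ≠ 0) (z : ℝ) :
    (fun q : ℝ × ℝ => ‖q‖ ^ (2 * M)) =O[cocompact (ℝ × ℝ)]
      (fun q : ℝ × ℝ => MvPolynomial.eval ![(q.1 : ℂ), (q.2 : ℂ), (z : ℂ)]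
        (lumpPoly α β μ σ m)) := by
  obtain ⟨Q, hQ, h⟩ := lumpPoly_eq α β μ σ m
  have h1 : (fun q : ℝ × ℝ => ‖q‖ ^ (2 * M)) =O[cocompact (ℝ × ℝ)]
      (fun q : ℝ × ℝ => MvPolynomial.eval ![(q.1 : ℂ), (q.2 : ℂ), (z : ℂ)]
        (∏ l, thetaPoly α β μ (m l))) := by
    have := Asymptotics.IsBigO.finsetProd (s := (Finset.univ : Finset (Fin (2 * M))))
      (fun i _ => norm_isBigO_thetaPoly α β μ (hm i) z)
    simpa only [map_prod, Finset.prod_const, Finset.card_univ, Fintype.card_fin] using this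
  have h2 := ((hQ.isLittleO z).trans_isBigO h1).right_isBigO_add
  refine h1.trans (h2.congr_right fun q => ?_)
  rw [h, map_add, add_comm]

/-- A second logarithmic derivative has this form, with A, B, C derivatives of F; all three are
o(F). -/
lemma tendsto_logDeriv_quotient {N : ℕ} {F A B C : ℝ × ℝ → ℂ}
    (hF : (fun q : ℝ × ℝ => ‖q‖ ^ N) =O[cocompact (ℝ × ℝ)] F)
    (hA : A =o[cocompact (ℝ × ℝ)] (fun q : ℝ × ℝ => ‖q‖ ^ N))
    (hB : B =o[cocompact (ℝ × ℝ)] (fun q : ℝ × ℝ => ‖q‖ ^ N))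
    (hC : C =o[cocompact (ℝ × ℝ)] (fun q : ℝ × ℝ => ‖q‖ ^ N)) :
    Tendsto (fun q => (A q * F q - B q * C q) / F q ^ 2) (cocompact (ℝ × ℝ)) (𝓝 0) := by
  have h1 : (fun q => A q * F q - B q * C q) =o[cocompact (ℝ × ℝ)] (fun q => F q ^ 2) := by
    simp only [pow_two]
    exact ((hA.trans_isBigO hF).mul_isBigO (Asymptotics.isBigO_refl F _)).sub
      ((hB.trans_isBigO hF).mul (hC.trans_isBigO hF))
  exact h1.tendsto_div_nhds_zero

lemma eventually_ne_zero_of_norm_pow_isBigO {N : ℕ} {F : ℝ × ℝ → ℂ}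
    (hF : (fun q : ℝ × ℝ => ‖q‖ ^ N) =O[cocompact (ℝ × ℝ)] F) :
    ∀ᶠ q in cocompact (ℝ × ℝ), F q ≠ 0 := by
  obtain ⟨c, hc⟩ := hF.bound
  filter_upwards [hc, (tendsto_norm_cocompact_atTop (E := ℝ × ℝ)).eventually_gt_atTop 0]
    with q hq hpos h0
  rw [h0, norm_zero, mul_zero] at hq
  have : 0 < ‖‖q‖ ^ N‖ := norm_pos_iff.2 (pow_pos hpos N).ne'
  linarith

lemma lump_eq_polyJet (R : ℝ → ℝ) (α β μ σ : ℝ) {M : ℕ} (m : Fin (2 * M) → ℂ) :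
    lump R α β μ σ m = fun x y t => polyJet (lumpPoly α β μ σ m) 0 0 0 x y (R t) := by
  funext x y t
  exact (eval_lumpPoly R α β μ σ m x y t).symm

/-- The lump solution is localized in the plane. -/
lemma lump_localized (R : ℝ → ℝ) (α β μ σ : ℝ) {M : ℕ} (m : Fin (2 * M) → ℂ)
    (hm : ∀ i, (m i).im ≠ 0) (t : ℝ) :
    (∀ᶠ q : ℝ × ℝ in cocompact (ℝ × ℝ), lump R α β μ σ m q.1 q.2 t ≠ 0) ∧
      Tendsto (fun q : ℝ × ℝ => uOf α μ σ (lump R α β μ σ m) q.1 q.2 t) (cocompact (ℝ × ℝ))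
        (𝓝 (α : ℂ)) ∧
      Tendsto (fun q : ℝ × ℝ => vOf β μ σ (lump R α β μ σ m) q.1 q.2 t) (cocompact (ℝ × ℝ))
        (𝓝 (β : ℂ)) := by
  set Q := lumpPoly α β μ σ m with hQ
  have hdeg : Q.totalDegree ≤ 2 * M := (totalDegree_lumpPoly α β μ σ m).le
  have hF := norm_pow_isBigO_lumpPoly α β μ σ m hm (R t)
  have hne := eventually_ne_zero_of_norm_pow_isBigO hF
  have d1 : ∀ i, DegLT (2 * M) (MvPolynomial.pderiv i Q) := fun i => DegLT.pderiv hdeg i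
  have d2 : ∀ i j, DegLT (2 * M) (MvPolynomial.pderiv i (MvPolynomial.pderiv j Q)) :=
    fun i j => DegLT.pderiv (d1 j).totalDegree_le i
  have hJ := isJet_polyJet Q
  refine ⟨?_, ?_, ?_⟩
  · filter_upwards [hne] with q hq
    rw [lump_eq_polyJet]
    exact hq
  · have hlim := tendsto_logDeriv_quotient hF ((d2 0 1).isLittleO (R t)) ((d1 0).isLittleO (R t))
      ((d1 1).isLittleO (R t))
    have := (hlim.const_mul (2 * σ / μ : ℂ)).const_add (α : ℂ)
    rw [mul_zero, add_zero] at this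
    refine this.congr' ?_
    filter_upwards [hne] with q hq
    rw [lump_eq_polyJet, hJ.uOf_eq_uJet α μ σ R hq]
    rfl
  · have hlim := tendsto_logDeriv_quotient hF ((d2 0 0).isLittleO (R t)) ((d1 0).isLittleO (R t))
      ((d1 0).isLittleO (R t))
    have := (hlim.const_mul (2 * σ / μ : ℂ)).const_add (β : ℂ)
    rw [mul_zero, add_zero] at this
    refine this.congr' ?_
    filter_upwards [hne] with q hq
    rw [lump_eq_polyJet, hJ.vOf_eq_vJet β μ σ R hq]
    rfl

/-- The lump solution is real and rational. -/
lemma lump_rational (R : ℝ → ℝ) (α β μ σ : ℝ) {M : ℕ} (m : Fin (2 * M) → ℂ)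
    (τ : Equiv.Perm (Fin (2 * M))) (hτ : ∀ i, m (τ i) = (starRingEnd ℂ) (m i)) :
    ∃ P A B : MvPolynomial (Fin 3) ℝ, P.totalDegree = 2 * M ∧ ∀ x y t,
      lump R α β μ σ m x y t = ((MvPolynomial.eval ![x, y, R t] P : ℝ) : ℂ) ∧
      (lump R α β μ σ m x y t ≠ 0 →
        uOf α μ σ (lump R α β μ σ m) x y t =
          ((MvPolynomial.eval ![x, y, R t] A / MvPolynomial.eval ![x, y, R t] P ^ 2 : ℝ) : ℂ) ∧
        vOf β μ σ (lump R α β μ σ m) x y t =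
          ((MvPolynomial.eval ![x, y, R t] B / MvPolynomial.eval ![x, y, R t] P ^ 2 : ℝ) : ℂ)) := by
  obtain ⟨P, hP, hdeg⟩ := exists_real_lumpPoly α β μ σ m τ hτ
  -- The numerators are (2) with the common denominator P².
  refine ⟨P, MvPolynomial.C α * P ^ 2 + MvPolynomial.C (2 * σ / μ) *
      (MvPolynomial.pderiv 0 (MvPolynomial.pderiv 1 P) * P
        - MvPolynomial.pderiv 0 P * MvPolynomial.pderiv 1 P),
    MvPolynomial.C β * P ^ 2 + MvPolynomial.C (2 * σ / μ) *
      (MvPolynomial.pderiv 0 (MvPolynomial.pderiv 0 P) * P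
        - MvPolynomial.pderiv 0 P * MvPolynomial.pderiv 0 P), hdeg, fun x y t => ?_⟩
  have hJ := isJet_polyJet (lumpPoly α β μ σ m)
  have h0 : polyJet (lumpPoly α β μ σ m) 0 0 0 x y (R t)
      = ((MvPolynomial.eval ![x, y, R t] P : ℝ) : ℂ) := by
    rw [← eval_map_ofReal, hP]; rfl
  have h1 : ∀ i, MvPolynomial.eval ![(x : ℂ), (y : ℂ), (R t : ℂ)]
      (MvPolynomial.pderiv i (lumpPoly α β μ σ m))
      = ((MvPolynomial.eval ![x, y, R t] (MvPolynomial.pderiv i P) : ℝ) : ℂ) := by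
    intro i
    rw [← eval_map_ofReal, ← hP, MvPolynomial.pderiv_map]
  have h2 : ∀ i j, MvPolynomial.eval ![(x : ℂ), (y : ℂ), (R t : ℂ)]
      (MvPolynomial.pderiv i (MvPolynomial.pderiv j (lumpPoly α β μ σ m)))
      = ((MvPolynomial.eval ![x, y, R t] (MvPolynomial.pderiv i (MvPolynomial.pderiv j P)) : ℝ) :
        ℂ) := by
    intro i j
    rw [← eval_map_ofReal, ← hP, MvPolynomial.pderiv_map, MvPolynomial.pderiv_map]
  refine ⟨by rw [lump_eq_polyJet]; exact h0, fun hne => ?_⟩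
  rw [lump_eq_polyJet] at hne ⊢
  have hne' : (MvPolynomial.eval ![x, y, R t] P : ℂ) ≠ 0 := h0 ▸ hne
  have j10 : polyJet (lumpPoly α β μ σ m) 1 0 0 x y (R t) = _ := h1 0
  have j01 : polyJet (lumpPoly α β μ σ m) 0 1 0 x y (R t) = _ := h1 1
  have j11 : polyJet (lumpPoly α β μ σ m) 1 1 0 x y (R t) = _ := h2 0 1
  have j20 : polyJet (lumpPoly α β μ σ m) 2 0 0 x y (R t) = _ := h2 0 0
  constructor
  · rw [hJ.uOf_eq_uJet α μ σ R hne, uJet, h0, j10, j01, j11]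
    simp only [map_add, map_mul, map_sub, map_pow, MvPolynomial.eval_C]
    push_cast
    rw [add_div, mul_div_cancel_right₀ _ (pow_ne_zero 2 hne')]
    ring
  · rw [hJ.vOf_eq_vJet β μ σ R hne, vJet, h0, j10, j20]
    simp only [map_add, map_mul, map_sub, map_pow, MvPolynomial.eval_C]
    push_cast
    rw [add_div, mul_div_cancel_right₀ _ (pow_ne_zero 2 hne')]
    ring

/-! ### The long wave limit -/

/-- If V is jointly continuous at the points (0, q₀), then Φ and φ have the same limit there. This
is locally uniform convergence on s, and V need only agree with Φ near q₀ for small ε ≠ 0. -/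
lemma tendstoLocallyUniformlyOn_of_param {Φ : ℝ → ℝ × ℝ × ℝ → ℂ} {φ : ℝ × ℝ × ℝ → ℂ}
    {s : Set (ℝ × ℝ × ℝ)} (V : ℝ → ℝ × ℝ × ℝ → ℂ)
    (hV : ∀ q₀ ∈ s, Tendsto (fun p : ℝ × ℝ × ℝ × ℝ => V p.1 p.2) (𝓝 0 ×ˢ 𝓝[s] q₀) (𝓝 (V 0 q₀)))
    (h1 : ∀ q₀ ∈ s, ∀ᶠ p : ℝ × ℝ × ℝ × ℝ in 𝓝[≠] 0 ×ˢ 𝓝[s] q₀, Φ p.1 p.2 = V p.1 p.2)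
    (h2 : ∀ q ∈ s, φ q = V 0 q) : TendstoLocallyUniformlyOn Φ φ (𝓝[≠] 0) s := by
  rw [tendstoLocallyUniformlyOn_iff_forall_tendsto]
  intro q₀ hq₀
  have hΦ : Tendsto (fun p : ℝ × ℝ × ℝ × ℝ => Φ p.1 p.2) (𝓝[≠] 0 ×ˢ 𝓝[s] q₀) (𝓝 (V 0 q₀)) :=
    ((hV q₀ hq₀).mono_left (prod_mono_left _ nhdsWithin_le_nhds)).congr'
      ((h1 q₀ hq₀).mono fun _ h => h.symm)
  have hφ' : Tendsto (fun q => V 0 q) (𝓝[s] q₀) (𝓝 (V 0 q₀)) :=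
    (hV q₀ hq₀).comp (tendsto_const_nhds.prodMk tendsto_id)
  have hφ : Tendsto φ (𝓝[s] q₀) (𝓝 (V 0 q₀)) :=
    hφ'.congr' (eventually_nhdsWithin_of_forall fun q hq => (h2 q hq).symm)
  have hφ2 : Tendsto (fun p : ℝ × ℝ × ℝ × ℝ => φ p.2) (𝓝[≠] 0 ×ˢ 𝓝[s] q₀) (𝓝 (V 0 q₀)) :=
    hφ.comp tendsto_snd
  exact (hφ2.prodMk_nhds hΦ).mono_right (nhds_le_uniformity _)

section

variable (α β μ σ : ℝ) {M : ℕ} (l m : Fin (2 * M) → ℂ)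

/-- The derivatives of the normalized multi-soliton function; at `ε = 0`, of the lump function. -/
def limitJet (ε : ℝ) : ℕ → ℕ → ℕ → ℝ → ℝ → ℝ → ℂ :=
  smoothJet (normSoliton α β μ σ l m) (ε, normCoeff α μ σ l m ε)

lemma isJet_limitJet (ε : ℝ) : IsJet (limitJet α β μ σ l m ε) :=
  isJet_smoothJet (contDiff_normSoliton α β μ σ l m) _

/-- At ε = 0 the denominator is -αμ(m_s - m_j)², which is nonzero for s < j. Since only continuity
at 0 is available here, the coefficients enter `normSoliton` as independent variables, in which it
is smooth everywhere. -/
lemma continuousAt_normCoeff (hα : α ≠ 0) (hμ : μ ≠ 0) (hminj : Function.Injective m) :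
    ContinuousAt (normCoeff α μ σ l m) 0 := by
  rw [continuousAt_pi]
  intro e
  simp only [normCoeff]
  split_ifs with h
  · refine ContinuousAt.div continuousAt_const ?_ ?_
    · have : Continuous (fun ε : ℝ => (ε : ℂ)) := Complex.continuous_ofReal
      fun_prop
    · have hα' : (α : ℂ) ≠ 0 := by exact_mod_cast hα
      have hμ' : (μ : ℂ) ≠ 0 := by exact_mod_cast hμ
      have hm : m e.1 - m e.2 ≠ 0 := sub_ne_zero.2 fun h' => h.ne (hminj h')
      simpa using And.intro (And.intro hα hμ) hm
  · exact continuousAt_const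

lemma tendsto_limitJet (hα : α ≠ 0) (hμ : μ ≠ 0) (hminj : Function.Injective m) (a b c : ℕ)
    {R : ℝ → ℝ} {s : Set (ℝ × ℝ × ℝ)} {q₀ : ℝ × ℝ × ℝ} (hR : ContinuousAt R q₀.2.2) :
    Tendsto (fun p : ℝ × ℝ × ℝ × ℝ =>
        limitJet α β μ σ l m p.1 a b c p.2.1 p.2.2.1 (R p.2.2.2))
      (𝓝 0 ×ˢ 𝓝[s] q₀) (𝓝 (limitJet α β μ σ l m 0 a b c q₀.1 q₀.2.1 (R q₀.2.2))) := by
  have hc := continuous_smoothJet (contDiff_normSoliton α β μ σ l m) a b c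
  have hb := continuousAt_normCoeff α μ σ l m hα hμ hminj
  have h1 : Tendsto (fun p : ℝ × ℝ × ℝ × ℝ => p.1) (𝓝 0 ×ˢ 𝓝[s] q₀) (𝓝 0) := tendsto_fst
  have h2 : Tendsto (fun p : ℝ × ℝ × ℝ × ℝ => p.2) (𝓝 (0 : ℝ) ×ˢ 𝓝[s] q₀) (𝓝 q₀) :=
    tendsto_snd.mono_right nhdsWithin_le_nhds
  have h3 : Tendsto (fun p : ℝ × ℝ × ℝ × ℝ =>
      (((p.1, normCoeff α μ σ l m p.1), p.2.1, p.2.2.1, R p.2.2.2) :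
        (ℝ × (Fin (2 * M) × Fin (2 * M) → ℂ)) × ℝ × ℝ × ℝ)) (𝓝 0 ×ˢ 𝓝[s] q₀)
      (𝓝 ((0, normCoeff α μ σ l m 0), q₀.1, q₀.2.1, R q₀.2.2)) :=
    (h1.prodMk_nhds (hb.tendsto.comp h1)).prodMk_nhds
      (((continuous_fst.tendsto q₀).comp h2).prodMk_nhds
        ((((continuous_fst.comp continuous_snd).tendsto q₀).comp h2).prodMk_nhds
          (hR.tendsto.comp (((continuous_snd.comp continuous_snd).tendsto q₀).comp h2))))
  exact (hc.tendsto _).comp h3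

lemma lump_eq_limitJet (R : ℝ → ℝ) (hl : ∀ j, l j ≠ 0) (hm : ∀ j, m j ≠ 0) :
    lump R α β μ σ m = fun x y t => limitJet α β μ σ l m 0 0 0 0 x y (R t) := by
  funext x y t
  change _ = normSoliton α β μ σ l m ((0, normCoeff α μ σ l m 0), x, y, R t)
  rw [lump_eq_matchSum, normSoliton_zero α β μ σ l m hl, matchSum, matchSum]
  refine Finset.sum_congr rfl fun E hE => ?_
  have hE' := Finset.mem_powerset.1 (Finset.mem_filter.1 hE).1
  congr 1
  · refine Finset.prod_congr rfl fun e he => ?_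
    have hlt : e.1 < e.2 := (Finset.mem_filter.1 (hE' he)).2
    simp only [normCoeff, if_pos hlt, lumpCoeff, Complex.ofReal_zero]
    rw [← neg_div_neg_eq]
    congr 1 <;> ring
  · refine Finset.prod_congr rfl fun v _ => ?_
    have := hm v
    rw [lumpTheta]
    field_simp

/-- The regular values of `ε`. -/
def Regular (ε : ℝ) : Prop :=
  ε ≠ 0 ∧ (∀ s j : Fin (2 * M), s < j →
    expADen α μ σ (l s * ε) (l s * ε * m s) (l j * ε) (l j * ε * m j) ≠ 0 ∧
    expA α μ σ (l s * ε) (l s * ε * m s) (l j * ε) (l j * ε * m j) ≠ 0) ∧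
  ∀ j, σ * (l j * ε * (l j * ε * m j)) + 4 * α * μ ≠ 0

/-- Once the powers of ε are removed, each condition concerns a polynomial in ε whose value at 0 is
-αμ(m_s - m_j)² or 4αμ. -/
lemma eventually_regular (hα : α ≠ 0) (hμ : μ ≠ 0) (hl : ∀ j, l j ≠ 0)
    (hminj : Function.Injective m) : ∀ᶠ ε : ℝ in 𝓝[≠] 0, Regular α μ σ l m ε := by
  have hα' : (α : ℂ) ≠ 0 := by exact_mod_cast hα
  have hμ' : (μ : ℂ) ≠ 0 := by exact_mod_cast hμ
  have hcont : Continuous (fun ε : ℝ => (ε : ℂ)) := Complex.continuous_ofReal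
  have hq : ∀ c : ℂ, ∀ s j : Fin (2 * M), s < j →
      ∀ᶠ ε : ℝ in 𝓝[≠] 0, c * (ε : ℂ) ^ 2 - α * μ * (m s - m j) ^ 2 ≠ 0 := by
    intro c s j hsj
    have hcc : ContinuousAt (fun ε : ℝ => c * (ε : ℂ) ^ 2 - α * μ * (m s - m j) ^ 2) 0 := by
      fun_prop
    have hm : m s - m j ≠ 0 := sub_ne_zero.2 fun h' => hsj.ne (hminj h')
    refine (hcc.eventually_ne ?_).filter_mono nhdsWithin_le_nhds
    simpa using And.intro (And.intro hα hμ) hm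
  have h3 : ∀ j, ∀ᶠ ε : ℝ in 𝓝[≠] 0, σ * (l j * ε * (l j * ε * m j)) + 4 * α * μ ≠ 0 := by
    intro j
    have hcc : ContinuousAt (fun ε : ℝ => σ * (l j * ε * (l j * ε * m j)) + 4 * α * μ) 0 := by
      fun_prop
    refine (hcc.eventually_ne ?_).filter_mono nhdsWithin_le_nhds
    simpa using And.intro hα hμ
  have h1 : ∀ s j : Fin (2 * M), ∀ᶠ ε : ℝ in 𝓝[≠] 0, s < j →
      expADen α μ σ (l s * ε) (l s * ε * m s) (l j * ε) (l j * ε * m j) ≠ 0 ∧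
      expA α μ σ (l s * ε) (l s * ε * m s) (l j * ε) (l j * ε * m j) ≠ 0 := by
    intro s j
    by_cases hsj : s < j
    · filter_upwards [hq (σ * m s * m j * (l s + l j) * (l s * m s + l j * m j)) s j hsj,
        hq (σ * m s * m j * (l s - l j) * (l s * m s - l j * m j)) s j hsj,
        self_mem_nhdsWithin] with ε hd hn hε _
      have hε' : (ε : ℂ) ≠ 0 := by exact_mod_cast hε
      rw [expADen_scaled, expA_scaled α μ σ _ _ (hl s) (hl j) hε']
      exact ⟨mul_ne_zero (mul_ne_zero (pow_ne_zero _ hε')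
        (pow_ne_zero _ (mul_ne_zero (hl s) (hl j)))) hd, div_ne_zero hn hd⟩
    · exact Eventually.of_forall fun ε h => absurd h hsj
  filter_upwards [self_mem_nhdsWithin, eventually_all.2 fun s => eventually_all.2 (h1 s),
    eventually_all.2 h3] with ε hε ha hb
  exact ⟨hε, ha, hb⟩

variable {α β μ σ l m}

lemma Regular.soliton_eq_limitJet {ε : ℝ} (h : Regular α μ σ l m ε) (R : ℝ → ℝ)
    (hl : ∀ j, l j ≠ 0) (hm : ∀ j, m j ≠ 0) :
    soliton R α β μ σ (fun j => l j * (ε : ℂ)) (fun j => l j * (ε : ℂ) * m j)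
        (fun _ => Complex.I * (Real.pi : ℂ))
      = fun x y t => ((ε : ℂ) ^ (2 * M) * ∏ j, l j) * limitJet α β μ σ l m ε 0 0 0 x y (R t) := by
  funext x y t
  exact soliton_eq_normSoliton R α β μ σ l m hl hm h.1 (fun s j hsj => (h.2.1 s j hsj).1) x y t

lemma Regular.const_ne_zero {ε : ℝ} (h : Regular α μ σ l m ε) (hl : ∀ j, l j ≠ 0) :
    (ε : ℂ) ^ (2 * M) * ∏ j, l j ≠ 0 :=
  mul_ne_zero (pow_ne_zero _ (by exact_mod_cast h.1)) (Finset.prod_ne_zero_iff.2 fun j _ => hl j)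

lemma Regular.hirota_solitonJet {ε : ℝ} (h : Regular α μ σ l m ε)
    (hα : α ≠ 0) (hμ : μ ≠ 0) (hσ : σ ≠ 0) (hl : ∀ j, l j ≠ 0) (hm : ∀ j, m j ≠ 0) (x y z : ℝ) :
    hirota α β μ σ (solitonJet α β μ σ (fun j => l j * (ε : ℂ)) (fun j => l j * (ε : ℂ) * m j)
        (fun _ => Complex.I * (Real.pi : ℂ))) x y z = 0 := by
  have hε' : (ε : ℂ) ≠ 0 := by exact_mod_cast h.1
  exact VcKdV.hirota_solitonJet α β μ σ hα hμ hσ _ _ _ (fun j => mul_ne_zero (hl j) hε')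
    (fun j => mul_ne_zero (mul_ne_zero (hl j) hε') (hm j)) h.2.2 h.2.1 x y z

lemma Regular.hirota_limitJet {ε : ℝ} (h : Regular α μ σ l m ε)
    (hα : α ≠ 0) (hμ : μ ≠ 0) (hσ : σ ≠ 0) (hl : ∀ j, l j ≠ 0) (hm : ∀ j, m j ≠ 0) (x y z : ℝ) :
    hirota α β μ σ (limitJet α β μ σ l m ε) x y z = 0 := by
  have h1 := h.hirota_solitonJet (β := β) hα hμ hσ hl hm x y z
  have h2 : solitonJet α β μ σ (fun j => l j * (ε : ℂ)) (fun j => l j * (ε : ℂ) * m j)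
        (fun _ => Complex.I * (Real.pi : ℂ))
      = fun a b c x y z => ((ε : ℂ) ^ (2 * M) * ∏ j, l j) * limitJet α β μ σ l m ε a b c x y z := by
    refine (isJet_solitonJet α β μ σ _ _ _).ext
      ((isJet_limitJet α β μ σ l m ε).const_mul _) ?_
    -- Taking the identity for R gives the equality for every real z, not only for values of a
    -- particular R.
    have := h.soliton_eq_limitJet (β := β) id hl hm
    rw [soliton_eq] at this
    exact this
  rw [h2, hirota_const_mul] at h1
  exact (mul_eq_zero.1 h1).resolve_left (pow_ne_zero 2 (h.const_ne_zero hl))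

/-- The bilinear form is a polynomial in finitely many derivatives, all of which converge as ε → 0.
-/
lemma hirota_limitJet_zero (hα : α ≠ 0) (hμ : μ ≠ 0) (hσ : σ ≠ 0) (hl : ∀ j, l j ≠ 0)
    (hm : ∀ j, m j ≠ 0) (hminj : Function.Injective m) (x y z : ℝ) :
    hirota α β μ σ (limitJet α β μ σ l m 0) x y z = 0 := by
  have ht : ∀ a b c, Tendsto (fun ε : ℝ => limitJet α β μ σ l m ε a b c x y z) (𝓝[≠] 0)
      (𝓝 (limitJet α β μ σ l m 0 a b c x y z)) := by
    intro a b c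
    have h := tendsto_limitJet α β μ σ l m hα hμ hminj a b c (R := id) (s := {(x, y, z)})
      (q₀ := (x, y, z)) continuousAt_id
    rw [nhdsWithin_singleton] at h
    exact h.comp ((tendsto_id.mono_left nhdsWithin_le_nhds).prodMk
      (tendsto_pure.2 (Eventually.of_forall fun _ => rfl)))
  have hlim : Tendsto (fun ε : ℝ => hirota α β μ σ (limitJet α β μ σ l m ε) x y z) (𝓝[≠] 0)
      (𝓝 (hirota α β μ σ (limitJet α β μ σ l m 0) x y z)) := by
    unfold hirota
    exact (((((ht 0 0 0).mul (ht 0 1 1)).sub ((ht 0 1 0).mul (ht 0 0 1))).add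
      ((((ht 0 0 0).mul (ht 1 1 0)).sub ((ht 1 0 0).mul (ht 0 1 0))).const_mul _)).add
      ((((ht 0 0 0).mul (ht 2 0 0)).sub ((ht 1 0 0).mul (ht 1 0 0))).const_mul _)).add
      ((((((ht 0 0 0).mul (ht 3 1 0)).sub ((ht 3 0 0).mul (ht 0 1 0))).sub
        (((ht 1 0 0).const_mul 3).mul (ht 2 1 0))).add
        (((ht 2 0 0).const_mul 3).mul (ht 1 1 0))).const_mul _)
  refine tendsto_nhds_unique hlim (tendsto_const_nhds.congr' ?_)
  filter_upwards [eventually_regular α μ σ l m hα hμ hl hminj] with ε hε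
  exact (hε.hirota_limitJet hα hμ hσ hl hm x y z).symm

end

end

end VcKdV

/-! ### Assembly of the theorem -/

theorem mainTheorem4
    (M : ℕ) (I : Set ℝ) (ρ R : ℝ → ℝ) (α β μ σ : ℝ)
    (hα : α ≠ 0) (hμ : μ ≠ 0) (hσ : σ ≠ 0)
    (hρ : ∀ t ∈ I, ρ t ≠ 0) (hR : ∀ t ∈ I, HasDerivAt R (1 / ρ t) t)
    (l m : Fin (2 * M) → ℂ)
    (hl : ∀ j, l j ≠ 0) (hm : ∀ j, m j ≠ 0) (hminj : Function.Injective m)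
    (hconj : ∀ i j : Fin (2 * M), (j : ℕ) = (i : ℕ) + M → m j = (starRingEnd ℂ) (m i))
    -- the `2M`-soliton function with `k_j = l_j ε`, `p_j = k_j m_j`, `θ_j⁰ = iπ`
    (f : ℝ → ℝ → ℝ → ℝ → ℂ)
    (hf : f = fun ε : ℝ => VcKdV.soliton R α β μ σ (fun j => l j * (ε : ℂ))
      (fun j => l j * (ε : ℂ) * m j) (fun _ => Complex.I * (Real.pi : ℂ)))
    -- the polynomial `f_{2M}` built from the `m_j`
    (F : ℝ → ℝ → ℝ → ℂ) (hF : F = VcKdV.lump R α β μ σ m) :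
    -- for small `ε ≠ 0` the interaction coefficients are regular and nonzero, and the `2M`-soliton
    -- is a solution
    (∀ᶠ ε : ℝ in 𝓝[≠] 0,
      (∀ s j : Fin (2 * M), s < j →
        VcKdV.expADen α μ σ (l s * ε) (l s * ε * m s) (l j * ε) (l j * ε * m j) ≠ 0 ∧
        VcKdV.expA α μ σ (l s * ε) (l s * ε * m s) (l j * ε) (l j * ε * m j) ≠ 0) ∧
      ∀ x y, ∀ t ∈ I, f ε x y t ≠ 0 →
        VcKdV.SolvesAt ρ μ σ (VcKdV.uOf α μ σ (f ε)) (VcKdV.vOf β μ σ (f ε)) x y t) ∧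
    -- the normalized `2M`-soliton function tends to `f_{2M}`
    TendstoLocallyUniformlyOn
      (fun (ε : ℝ) (q : ℝ × ℝ × ℝ) => f ε q.1 q.2.1 q.2.2 / ((ε : ℂ) ^ (2 * M) * ∏ j, l j))
      (fun q => F q.1 q.2.1 q.2.2) (𝓝[≠] 0) {q | q.2.2 ∈ I} ∧
    -- the `2M`-soliton solution tends to the solution built from `f_{2M}`
    TendstoLocallyUniformlyOn
      (fun (ε : ℝ) (q : ℝ × ℝ × ℝ) => VcKdV.uOf α μ σ (f ε) q.1 q.2.1 q.2.2)
      (fun q => VcKdV.uOf α μ σ F q.1 q.2.1 q.2.2) (𝓝[≠] 0)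
      {q | q.2.2 ∈ I ∧ F q.1 q.2.1 q.2.2 ≠ 0} ∧
    TendstoLocallyUniformlyOn
      (fun (ε : ℝ) (q : ℝ × ℝ × ℝ) => VcKdV.vOf β μ σ (f ε) q.1 q.2.1 q.2.2)
      (fun q => VcKdV.vOf β μ σ F q.1 q.2.1 q.2.2) (𝓝[≠] 0)
      {q | q.2.2 ∈ I ∧ F q.1 q.2.1 q.2.2 ≠ 0} ∧
    -- the limit solves the system
    (∀ x y, ∀ t ∈ I, F x y t ≠ 0 →
      VcKdV.SolvesAt ρ μ σ (VcKdV.uOf α μ σ F) (VcKdV.vOf β μ σ F) x y t) ∧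
    -- it is real and rational in `x`, `y` and `R(t)`, and `f_{2M}` is a real polynomial of degree `2M`
    (∃ P A B : MvPolynomial (Fin 3) ℝ, P.totalDegree = 2 * M ∧
      ∀ x y, ∀ t ∈ I,
        F x y t = ((MvPolynomial.eval ![x, y, R t] P : ℝ) : ℂ) ∧
        (F x y t ≠ 0 →
          VcKdV.uOf α μ σ F x y t =
            ((MvPolynomial.eval ![x, y, R t] A / MvPolynomial.eval ![x, y, R t] P ^ 2 : ℝ) : ℂ) ∧
          VcKdV.vOf β μ σ F x y t =
            ((MvPolynomial.eval ![x, y, R t] B / MvPolynomial.eval ![x, y, R t] P ^ 2 : ℝ) : ℂ))) ∧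
    -- it is localized in every direction of the plane
    (∀ t ∈ I,
      (∀ᶠ q : ℝ × ℝ in cocompact (ℝ × ℝ), F q.1 q.2 t ≠ 0) ∧
      Tendsto (fun q : ℝ × ℝ => VcKdV.uOf α μ σ F q.1 q.2 t) (cocompact (ℝ × ℝ)) (𝓝 (α : ℂ)) ∧
      Tendsto (fun q : ℝ × ℝ => VcKdV.vOf β μ σ F q.1 q.2 t) (cocompact (ℝ × ℝ)) (𝓝 (β : ℂ))) := by
  have hF0 : F = fun x y t => VcKdV.limitJet α β μ σ l m 0 0 0 0 x y (R t) := by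
    rw [hF, VcKdV.lump_eq_limitJet α β μ σ l m R hl hm]
  have hJ0 := VcKdV.isJet_limitJet α β μ σ l m 0
  have hreg := VcKdV.eventually_regular α μ σ l m hα hμ hl hminj
  have hfε : ∀ ε, VcKdV.Regular α μ σ l m ε → f ε = fun x y t =>
      ((ε : ℂ) ^ (2 * M) * ∏ j, l j) * VcKdV.limitJet α β μ σ l m ε 0 0 0 x y (R t) := by
    intro ε hε
    rw [hf]
    exact hε.soliton_eq_limitJet R hl hm
  have hcR : ∀ t ∈ I, ContinuousAt R t := fun t ht => (hR t ht).continuousAt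
  have hlim := fun (a b c : ℕ) (s : Set (ℝ × ℝ × ℝ)) (q₀ : ℝ × ℝ × ℝ) (ht : q₀.2.2 ∈ I) =>
    VcKdV.tendsto_limitJet α β μ σ l m hα hμ hminj a b c (s := s) (hcR _ ht)
  have hreg' : ∀ (s : Set (ℝ × ℝ × ℝ)) (q₀ : ℝ × ℝ × ℝ),
      ∀ᶠ p : ℝ × ℝ × ℝ × ℝ in 𝓝[≠] 0 ×ˢ 𝓝[s] q₀, VcKdV.Regular α μ σ l m p.1 :=
    fun s q₀ => hreg.prod_inl _
  -- Where F ≠ 0 the normalized soliton function is nonzero for nearby points and small ε,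
  -- uniformly; there u and v are quotients of its derivatives.
  have hne : ∀ (s : Set (ℝ × ℝ × ℝ)) (q₀ : ℝ × ℝ × ℝ), q₀.2.2 ∈ I → F q₀.1 q₀.2.1 q₀.2.2 ≠ 0 →
      ∀ᶠ p : ℝ × ℝ × ℝ × ℝ in 𝓝[≠] 0 ×ˢ 𝓝[s] q₀,
        VcKdV.limitJet α β μ σ l m p.1 0 0 0 p.2.1 p.2.2.1 (R p.2.2.2) ≠ 0 := by
    intro s q₀ ht h0
    rw [hF0] at h0
    exact ((hlim 0 0 0 s q₀ ht).mono_left (prod_mono_left _ nhdsWithin_le_nhds)).eventually_ne h0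
  refine ⟨?_, ?_, ?_, ?_, ?_, ?_, ?_⟩
  · filter_upwards [hreg] with ε hε
    refine ⟨hε.2.1, fun x y t ht h0 => ?_⟩
    rw [hf] at h0 ⊢
    simp only [VcKdV.soliton_eq] at h0 ⊢
    exact (VcKdV.isJet_solitonJet α β μ σ _ _ _).solvesAt ρ R α β μ σ hμ (hρ t ht) (hR t ht)
      (hε.hirota_solitonJet hα hμ hσ hl hm) h0
  · refine VcKdV.tendstoLocallyUniformlyOn_of_param
      (fun ε q => VcKdV.limitJet α β μ σ l m ε 0 0 0 q.1 q.2.1 (R q.2.2))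
      (fun q₀ hq₀ => hlim 0 0 0 _ q₀ hq₀) (fun q₀ _ => ?_) (fun q _ => by rw [hF0])
    filter_upwards [hreg' _ q₀] with p hp
    rw [hfε _ hp, mul_div_cancel_left₀ _ (hp.const_ne_zero hl)]
  · refine VcKdV.tendstoLocallyUniformlyOn_of_param
      (fun ε q => VcKdV.uJet α μ σ (VcKdV.limitJet α β μ σ l m ε) q.1 q.2.1 (R q.2.2))
      (fun q₀ hq₀ => ?_) (fun q₀ hq₀ => ?_) (fun q hq => ?_)
    · have h0 := hq₀.2
      rw [hF0] at h0
      exact ((((hlim 1 1 0 _ q₀ hq₀.1).mul (hlim 0 0 0 _ q₀ hq₀.1)).sub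
        ((hlim 1 0 0 _ q₀ hq₀.1).mul (hlim 0 1 0 _ q₀ hq₀.1))).div
        ((hlim 0 0 0 _ q₀ hq₀.1).pow 2) (pow_ne_zero 2 h0)).const_mul _ |>.const_add _
    · filter_upwards [hreg' _ q₀, hne _ q₀ hq₀.1 hq₀.2] with p hp h0
      -- The normalizing constant ε^{2M} ∏ l drops out of the logarithmic derivatives.
      rw [hfε _ hp, ← VcKdV.uJet_const_mul α μ σ _ (hp.const_ne_zero hl)]
      exact ((VcKdV.isJet_limitJet α β μ σ l m p.1).const_mul _).uOf_eq_uJet α μ σ R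
        (mul_ne_zero (hp.const_ne_zero hl) h0)
    · have h0 := hq.2
      rw [hF0] at h0 ⊢
      exact hJ0.uOf_eq_uJet α μ σ R h0
  · refine VcKdV.tendstoLocallyUniformlyOn_of_param
      (fun ε q => VcKdV.vJet β μ σ (VcKdV.limitJet α β μ σ l m ε) q.1 q.2.1 (R q.2.2))
      (fun q₀ hq₀ => ?_) (fun q₀ hq₀ => ?_) (fun q hq => ?_)
    · have h0 := hq₀.2
      rw [hF0] at h0
      exact ((((hlim 2 0 0 _ q₀ hq₀.1).mul (hlim 0 0 0 _ q₀ hq₀.1)).sub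
        ((hlim 1 0 0 _ q₀ hq₀.1).mul (hlim 1 0 0 _ q₀ hq₀.1))).div
        ((hlim 0 0 0 _ q₀ hq₀.1).pow 2) (pow_ne_zero 2 h0)).const_mul _ |>.const_add _
    · filter_upwards [hreg' _ q₀, hne _ q₀ hq₀.1 hq₀.2] with p hp h0
      rw [hfε _ hp, ← VcKdV.vJet_const_mul β μ σ _ (hp.const_ne_zero hl)]
      exact ((VcKdV.isJet_limitJet α β μ σ l m p.1).const_mul _).vOf_eq_vJet β μ σ R
        (mul_ne_zero (hp.const_ne_zero hl) h0)
    · have h0 := hq.2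
      rw [hF0] at h0 ⊢
      exact hJ0.vOf_eq_vJet β μ σ R h0
  · intro x y t ht h0
    rw [hF0] at h0 ⊢
    exact hJ0.solvesAt ρ R α β μ σ hμ (hρ t ht) (hR t ht)
      (VcKdV.hirota_limitJet_zero hα hμ hσ hl hm hminj) h0
  · obtain ⟨τ, hτ⟩ := VcKdV.exists_conj_perm m hminj hconj
    obtain ⟨P, A, B, hdeg, h⟩ := VcKdV.lump_rational R α β μ σ m τ fun i => (hτ i).1
    rw [hF]
    exact ⟨P, A, B, hdeg, fun x y t _ => h x y t⟩
  · obtain ⟨τ, hτ⟩ := VcKdV.exists_conj_perm m hminj hconj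
    -- A real m_i would equal its conjugate m_{τ i}, contrary to injectivity and τ i ≠ i.
    have him : ∀ i, (m i).im ≠ 0 := fun i h =>
      (hτ i).2 (hminj ((hτ i).1.trans (Complex.conj_eq_iff_im.2 h)))
    intro t _
    rw [hF]
    exact VcKdV.lump_localized R α β μ σ m him t
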